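/- **Setting.** Let $\mathbb T=\mathbb R/2\pi\mathbb Z$ with $\int_{\mathbb T}f\,dx=\frac1{2\pi}\int_0^{2\pi}f(x)\,dx$, let $\langle n\rangle=(1+n^2)^{1/2}$, $\widehat u(n)=\int_{\mathbb T}u\,e^{-inx}dx$, $P_{\le N}u=\sum_{|n|\le N}\widehat u(n)e^{inx}$, and $H^{1/2-}(\mathbb T)=\bigcap_{s<1/2}H^s(\mathbb T)$. Let $(g_n)_{n\in\mathbb Z}$ be i.i.d. complex Gaussians of mean $0$ and variance $1$ (that is, $g_n=a_n+ib_n$ with $a_n,b_n$ independent and $N(0,\tfrac12)$-distributed) on a probability space $(\Omega,\mathcal F,\mathbb P)$, and let $\mu$ be the law on $H^{1/2-}(\mathbb T)$ of the random function $u=\sum_{n\in\mathbb Z}\frac{g_n}{\langle n\rangle}e^{inx}$. For an integer $N\ge0$ put $$f_N(u)=\frac{-3i}{4}\int_{\mathbb T}\overline{P_{\le N}u}^{\,2}\,\partial_x\big((P_{\le N}u)^2\big)\,dx,\qquad \Psi_N(u)=1_{\|P_{\le N}u\|_{L^2(\mathbb T)}^2<m}\;e^{f_N(u)-\frac12\int_{\mathbb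 T}|P_{\le N}u|^6dx},$$ and, for $c:\mathbb Z\to\mathbb R$, $$S_{4,N}=\frac32\sum_{\substack{n_1+n_2=n_3+n_4\\|n_i|\le N}}c(n_1)c(n_2)c(n_3)c(n_4)\,n_1\,\frac{g_{n_1}g_{n_2}\overline{g_{n_3}}\,\overline{g_{n_4}}}{\langle n_1\rangle\langle n_2\rangle\langle n_3\rangle\langle n_4\rangle},$$ regarded as a function of $u$ through $g_n=\langle n\rangle\widehat u(n)$. Both $f_N$ and $S_{4,N}$ are real-valued. **Theorem.** (1) For all real $\mathcal M$ and $p\ge1$ there are constants $m_{\mathcal M,p}>0$ and $C(\mathcal M,p)$, depending only on $\mathcal M$ and $p$, such that for every $c:\mathbb Z\to\mathbb R$ with $|c(n)|\le\mathcal M$ and $c(-n)=c(n)$ for all $n$, every $0<m\le m_{\mathcal M,p}$ and every integer $N\ge0$, $$\int_{H^{1/2-}(\mathbb T)}1_{\|u\|_{L^2}^2<m}\,e^{pS_{4,N}(u)}\,d\mu\le C(\mathcal M,p)\quad\text{and}\quad\int_{H^{1/2-}(\mathbb T)}1_{\|P_{\le N}u\|_{L^2}^2<m}\,e^{pS_{4,N}(u)}\,d\mu\le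 C(\mathcal M,p).$$ (2) For every real $p\ge1$ there are constants $m_p>0$ and $C(p)$, depending only on $p$, such that for every $0<m\le m_p$ and every integer $N\ge0$ (in particular for every dyadic $N$), $$\big\|1_{\|P_{\le N}u\|_{L^2(\mathbb T)}^2<m}\,e^{f_N(u)}\big\|_{L^p(\mu)}^p\le C(p)\quad\text{and}\quad\|\Psi_N\|_{L^p(\mu)}^p\le C(p).$$ -/

import Mathlib

open MeasureTheory ProbabilityTheory

noncomputable section

namespace DNLS

/-- The torus `ℝ / 2πℤ` has positive length; Mathlib's Fourier theory on `AddCircle` asks for it. -/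
instance factTwoPiPos : Fact (0 < 2 * Real.pi) := ⟨Real.two_pi_pos⟩

/-- `L²(𝕋)`, `𝕋 = ℝ / 2πℤ`, for the normalized measure `dx / 2π`. -/
abbrev L2T : Type := Lp ℂ 2 (AddCircle.haarAddCircle (T := 2 * Real.pi))

/-- The Japanese bracket `⟨n⟩ = (1 + n²)^{1/2}`. -/
def bracket (n : ℤ) : ℝ := Real.sqrt (1 + (n : ℝ) ^ 2)

/-- The Fourier coefficient `û(n)`, where `u = ∑ û(n) e^{inx}`. -/
def coeff (u : L2T) (n : ℤ) : ℂ := fourierCoeff (u : AddCircle (2 * Real.pi) → ℂ) n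

/-- `u ∈ H^s(𝕋)`: `‖u‖²_{H^s} = ∑ ⟨n⟩^{2s} |û(n)|²` is finite. -/
def MemSobolev (s : ℝ) (u : L2T) : Prop :=
  Summable fun n : ℤ => bracket n ^ (2 * s) * ‖coeff u n‖ ^ 2

/-- `H^{1/2-}(𝕋) = ⋂_{s < 1/2} H^s(𝕋)`, with (see below) the trace of the Borel `σ`-algebra of
`L²(𝕋)`, which is also the Borel `σ`-algebra of its own intersection topology. -/
structure HHalfMinus where
  /-- the underlying function in `L²(𝕋)` -/
  val : L2T
  mem : ∀ s : ℝ, s < 1 / 2 → MemSobolev s val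

namespace HHalfMinus

instance : CoeOut HHalfMinus L2T := ⟨HHalfMinus.val⟩

instance : MeasurableSpace HHalfMinus := (borel L2T).comap HHalfMinus.val

end HHalfMinus

theorem memSobolev_zero (s : ℝ) : MemSobolev s (0 : L2T) := by
  have h : ∀ n, coeff (0 : L2T) n = 0 := fun n => by
    have := fourierBasis_repr (0 : L2T) n
    simpa [coeff] using this.symm
  simp [MemSobolev, h]

instance : Zero HHalfMinus := ⟨⟨0, fun s _ => memSobolev_zero s⟩⟩

/-- The standard complex Gaussian law: `a + ib` with independent `a, b ∼ N(0, 1/2)`. -/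
def stdComplexGaussian : Measure ℂ :=
  ((gaussianReal 0 (1 / 2)).prod (gaussianReal 0 (1 / 2))).map
    fun z : ℝ × ℝ => (z.1 : ℂ) + (z.2 : ℂ) * Complex.I

/-- `g` is a family, indexed by `ℤ`, of i.i.d. complex Gaussians of mean `0` and variance `1`. -/
def IsGaussianFamily {Ω : Type*} [MeasurableSpace Ω] (P : Measure Ω) (g : ℤ → Ω → ℂ) : Prop :=
  (∀ n, HasLaw (g n) stdComplexGaussian P) ∧ iIndepFun g P

/-- The sum `∑ (g_n / ⟨n⟩) e^{inx}` in `L²(𝕋)`. -/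
def randomSeries {Ω : Type*} (g : ℤ → Ω → ℂ) (ω : Ω) : L2T :=
  ∑' n : ℤ, (g n ω / (bracket n : ℂ)) • (fourierLp (T := 2 * Real.pi) 2 n : L2T)

open Classical in
/-- The random function `φ(ω) = ∑ (g_n(ω) / ⟨n⟩) e^{inx}`, set to `0` on the null event that the
sum is not in `H^{1/2-}(𝕋)`. -/
def randomData {Ω : Type*} (g : ℤ → Ω → ℂ) (ω : Ω) : HHalfMinus :=
  if h : ∀ s : ℝ, s < 1 / 2 → MemSobolev s (randomSeries g ω) then ⟨randomSeries g ω, h⟩ else 0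

/-- The measure `μ = P ∘ φ⁻¹` on `H^{1/2-}(𝕋)`. -/
def gaussMeasure {Ω : Type*} [MeasurableSpace Ω] (P : Measure Ω) (g : ℤ → Ω → ℂ) :
    Measure HHalfMinus :=
  P.map (randomData g)

/-- The trigonometric polynomial `P_{≤N} u = ∑_{|n| ≤ N} û(n) e^{inx}`. -/
def lowFreq (N : ℕ) (u : L2T) (x : ℝ) : ℂ :=
  ∑ n ∈ Finset.Icc (-(N : ℤ)) N, coeff u n * Complex.exp (Complex.I * n * x)

/-- `∫_𝕋 f dx = (1 / 2π) ∫_0^{2π} f(x) dx` for a `2π`-periodic function `f`. -/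
def torusIntegral {E : Type*} [NormedAddCommGroup E] [NormedSpace ℝ E] (f : ℝ → E) : E :=
  (2 * Real.pi)⁻¹ • ∫ x in (0 : ℝ)..(2 * Real.pi), f x

/-- The mass `‖P_{≤N} u‖²_{L²(𝕋)}` of the low frequencies. -/
def lowMass (N : ℕ) (u : L2T) : ℝ := torusIntegral fun x => ‖lowFreq N u x‖ ^ 2

/-- `(-3i/4) ∫_𝕋 (conj P_{≤N}u)² ∂ₓ((P_{≤N}u)²) dx`, as a complex number. -/
def fComplex (N : ℕ) (u : L2T) : ℂ :=
  (-3 * Complex.I / 4) *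
    torusIntegral fun x =>
      (starRingEnd ℂ (lowFreq N u x)) ^ 2 * deriv (fun y : ℝ => lowFreq N u y ^ 2) x

/-- `f_N(u)`; the complex number `fComplex N u` is real by `fComplex_im`. -/
def f (N : ℕ) (u : L2T) : ℝ := (fComplex N u).re

/-- `Ψ_N(u) = 1_{‖P_{≤N}u‖² < m} exp(f_N(u) - ½ ∫_𝕋 |P_{≤N}u|⁶ dx)`. -/
def Psi (m : ℝ) (N : ℕ) (u : L2T) : ℝ :=
  Set.indicator {v : L2T | lowMass N v < m}
    (fun v => Real.exp (f N v - 1 / 2 * torusIntegral fun x => ‖lowFreq N v x‖ ^ 6)) u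

/-- The fourth order sum
`(3/2) ∑ c(n₁)c(n₂)c(n₃)c(n₄) n₁ g_{n₁} g_{n₂} conj(g_{n₃}) conj(g_{n₄}) / (⟨n₁⟩⟨n₂⟩⟨n₃⟩⟨n₄⟩)`
over all `n₁ + n₂ = n₃ + n₄`, `|n_i| ≤ N`, as a complex number. -/
def chaosComplex (c : ℤ → ℝ) (N : ℕ) (g : ℤ → ℂ) : ℂ :=
  (3 / 2 : ℂ) *
    ∑ n₁ ∈ Finset.Icc (-(N : ℤ)) N, ∑ n₂ ∈ Finset.Icc (-(N : ℤ)) N,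
      ∑ n₃ ∈ Finset.Icc (-(N : ℤ)) N, ∑ n₄ ∈ Finset.Icc (-(N : ℤ)) N,
        if n₁ + n₂ = n₃ + n₄ then
          (c n₁ * c n₂ * c n₃ * c n₄ : ℂ) * n₁ *
            (g n₁ * g n₂ * starRingEnd ℂ (g n₃) * starRingEnd ℂ (g n₄)) /
            (bracket n₁ * bracket n₂ * bracket n₃ * bracket n₄)
        else 0

/-- `S_{4,N}` as a function of the Gaussians; `chaosComplex c N g` is real by `chaosComplex_im`. -/
def chaos (c : ℤ → ℝ) (N : ℕ) (g : ℤ → ℂ) : ℝ := (chaosComplex c N g).re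

/-- `S_{4,N}` as a function on `H^{1/2-}(𝕋)`: the Gaussians are read off from `u` as
`g_n = ⟨n⟩ û(n)`. -/
def S4 (c : ℤ → ℝ) (N : ℕ) (u : L2T) : ℝ := chaos c N fun n => bracket n * coeff u n


theorem chaosComplex_im (c : ℤ → ℝ) (N : ℕ) (g : ℤ → ℂ) : (chaosComplex c N g).im = 0 := by
  rw [← Complex.conj_eq_iff_im]
  -- `T k` is the sum with the weight `n₁` replaced by the `k`-th frequency
  let I := Finset.Icc (-(N : ℤ)) N
  let b : ℤ → ℤ → ℤ → ℤ → ℂ := fun n₁ n₂ n₃ n₄ =>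
    if n₁ + n₂ = n₃ + n₄ then
      (c n₁ * c n₂ * c n₃ * c n₄ : ℂ) *
        (g n₁ * g n₂ * starRingEnd ℂ (g n₃) * starRingEnd ℂ (g n₄)) /
        (bracket n₁ * bracket n₂ * bracket n₃ * bracket n₄)
    else 0
  have hb12 : ∀ n₁ n₂ n₃ n₄, b n₁ n₂ n₃ n₄ = b n₂ n₁ n₃ n₄ := fun n₁ n₂ n₃ n₄ => by
    simp only [b, add_comm n₁ n₂]; congr 1; ring
  have hb34 : ∀ n₁ n₂ n₃ n₄, b n₁ n₂ n₃ n₄ = b n₁ n₂ n₄ n₃ := fun n₁ n₂ n₃ n₄ => by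
    simp only [b, add_comm n₃ n₄]; congr 1; ring
  have hconj : ∀ n₁ n₂ n₃ n₄, starRingEnd ℂ (b n₁ n₂ n₃ n₄) = b n₃ n₄ n₁ n₂ :=
    fun n₁ n₂ n₃ n₄ => by
      simp only [b, eq_comm (a := n₃ + n₄)]
      split_ifs
      · simp only [map_div₀, map_mul, Complex.conj_conj, Complex.conj_ofReal]; ring
      · simp
  have hS : chaosComplex c N g = (3 / 2 : ℂ) *
      ∑ n₁ ∈ I, ∑ n₂ ∈ I, ∑ n₃ ∈ I, ∑ n₄ ∈ I, (n₁ : ℂ) * b n₁ n₂ n₃ n₄ := by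
    simp only [chaosComplex, b, I]
    congr 1
    refine Finset.sum_congr rfl fun n₁ _ => Finset.sum_congr rfl fun n₂ _ =>
      Finset.sum_congr rfl fun n₃ _ => Finset.sum_congr rfl fun n₄ _ => ?_
    split_ifs
    · ring
    · simp
  -- the sum with weight `n₂` equals that with weight `n₁`
  have h2 : ∑ n₁ ∈ I, ∑ n₂ ∈ I, ∑ n₃ ∈ I, ∑ n₄ ∈ I, (n₂ : ℂ) * b n₁ n₂ n₃ n₄ =
      ∑ n₁ ∈ I, ∑ n₂ ∈ I, ∑ n₃ ∈ I, ∑ n₄ ∈ I, (n₁ : ℂ) * b n₁ n₂ n₃ n₄ := by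
    rw [Finset.sum_comm]
    refine Finset.sum_congr rfl fun n₁ _ => Finset.sum_congr rfl fun n₂ _ =>
      Finset.sum_congr rfl fun n₃ _ => Finset.sum_congr rfl fun n₄ _ => ?_
    rw [hb12]
  have h4 : ∑ n₁ ∈ I, ∑ n₂ ∈ I, ∑ n₃ ∈ I, ∑ n₄ ∈ I, (n₄ : ℂ) * b n₁ n₂ n₃ n₄ =
      ∑ n₁ ∈ I, ∑ n₂ ∈ I, ∑ n₃ ∈ I, ∑ n₄ ∈ I, (n₃ : ℂ) * b n₁ n₂ n₃ n₄ := by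
    refine Finset.sum_congr rfl fun n₁ _ => Finset.sum_congr rfl fun n₂ _ => ?_
    rw [Finset.sum_comm]
    refine Finset.sum_congr rfl fun n₃ _ => Finset.sum_congr rfl fun n₄ _ => ?_
    rw [hb34]
  have hsum : ∑ n₁ ∈ I, ∑ n₂ ∈ I, ∑ n₃ ∈ I, ∑ n₄ ∈ I, ((n₁ : ℂ) + n₂) * b n₁ n₂ n₃ n₄ =
      ∑ n₁ ∈ I, ∑ n₂ ∈ I, ∑ n₃ ∈ I, ∑ n₄ ∈ I, ((n₃ : ℂ) + n₄) * b n₁ n₂ n₃ n₄ := by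
    refine Finset.sum_congr rfl fun n₁ _ => Finset.sum_congr rfl fun n₂ _ =>
      Finset.sum_congr rfl fun n₃ _ => Finset.sum_congr rfl fun n₄ _ => ?_
    by_cases h : n₁ + n₂ = n₃ + n₄
    · have h' : (n₁ : ℂ) + n₂ = n₃ + n₄ := by exact_mod_cast h
      rw [h']
    · simp [b, h]
  simp only [add_mul, Finset.sum_add_distrib, h2, h4] at hsum
  have hc : ∑ n₁ ∈ I, ∑ n₂ ∈ I, ∑ n₃ ∈ I, ∑ n₄ ∈ I, (n₁ : ℂ) * b n₃ n₄ n₁ n₂ =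
      ∑ n₁ ∈ I, ∑ n₂ ∈ I, ∑ n₃ ∈ I, ∑ n₄ ∈ I, (n₃ : ℂ) * b n₁ n₂ n₃ n₄ := by
    simp only [← Finset.sum_product']
    refine Finset.sum_bij' (fun x _ => (x.2.2.1, x.2.2.2, x.1, x.2.1))
      (fun x _ => (x.2.2.1, x.2.2.2, x.1, x.2.1)) ?_ ?_ ?_ ?_ ?_ <;>
      simp +contextual [Finset.mem_product]
  rw [hS]
  simp only [map_mul, map_sum, hconj, map_intCast, hc]
  rw [show starRingEnd ℂ (3 / 2 : ℂ) = 3 / 2 by rw [map_div₀, map_ofNat, map_ofNat]]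
  congr 1
  linear_combination (-1 / 2 : ℂ) * hsum

theorem fComplex_im (N : ℕ) (u : L2T) : (fComplex N u).im = 0 := by
  have hv : ContDiff ℝ 1 (lowFreq N u) := by
    have h : ContDiff ℝ 1 (fun x : ℝ => (x : ℂ)) := Complex.ofRealCLM.contDiff
    exact ContDiff.sum fun n _ => contDiff_const.mul (contDiff_const.mul h).cexp
  set w : ℝ → ℂ := fun y => lowFreq N u y ^ 2 with hw
  have hwd : ContDiff ℝ 1 w := by fun_prop
  have hder : ∀ x, HasDerivAt w (deriv w x) x := fun x =>
    ((hwd.differentiable one_ne_zero) x).hasDerivAt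
  have hcont : Continuous (deriv w) := hwd.continuous_deriv le_rfl
  have hderc : ∀ x, HasDerivAt (fun y => starRingEnd ℂ (w y)) (starRingEnd ℂ (deriv w x)) x :=
    fun x => (hder x).star
  have hcc : Continuous fun x => starRingEnd ℂ (w x) := Complex.continuous_conj.comp hwd.continuous
  have hcd : Continuous fun x => starRingEnd ℂ (deriv w x) := Complex.continuous_conj.comp hcont
  have hper : w (2 * Real.pi) = w 0 := by
    simp only [hw, lowFreq]
    congr 1
    refine Finset.sum_congr rfl fun n _ => ?_
    congr 1
    have : Complex.I * n * ((2 * Real.pi : ℝ) : ℂ) = n * (2 * Real.pi * Complex.I) := by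
      push_cast; ring
    rw [this, Complex.exp_int_mul_two_pi_mul_I]; simp
  have hparts := intervalIntegral.integral_mul_deriv_eq_deriv_mul (a := 0) (b := 2 * Real.pi)
    (u := fun y => starRingEnd ℂ (w y)) (v := w) (fun x _ => hderc x) (fun x _ => hder x)
    (hcd.intervalIntegrable _ _) (hcont.intervalIntegrable _ _)
  rw [hper, sub_self, zero_sub] at hparts
  have hconj : starRingEnd ℂ (∫ x in (0 : ℝ)..(2 * Real.pi), starRingEnd ℂ (w x) * deriv w x) =
      ∫ x in (0 : ℝ)..(2 * Real.pi), starRingEnd ℂ (deriv w x) * w x := by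
    rw [intervalIntegral.integral_of_le Real.two_pi_pos.le,
      intervalIntegral.integral_of_le Real.two_pi_pos.le, ← integral_conj]
    congr 1; ext x; simp [mul_comm]
  have hre : (∫ x in (0 : ℝ)..(2 * Real.pi), starRingEnd ℂ (w x) * deriv w x).re = 0 := by
    have h := congrArg Complex.re (hconj.trans (neg_eq_iff_eq_neg.mpr hparts |>.symm ▸ rfl :
      _ = -∫ x in (0 : ℝ)..(2 * Real.pi), starRingEnd ℂ (w x) * deriv w x))
    rw [Complex.conj_re, Complex.neg_re] at h
    linarith
  have : fComplex N u = (-3 * Complex.I / 4) * ((2 * Real.pi)⁻¹ •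
      ∫ x in (0 : ℝ)..(2 * Real.pi), starRingEnd ℂ (w x) * deriv w x) := by
    simp only [fComplex, torusIntegral, hw, map_pow]
  rw [this]
  simp [Complex.mul_im, hre]


theorem bracket_pos (n : ℤ) : 0 < bracket n := Real.sqrt_pos.mpr (by positivity)

instance : IsProbabilityMeasure stdComplexGaussian := by
  unfold stdComplexGaussian
  exact Measure.isProbabilityMeasure_map (by fun_prop)

theorem lintegral_sq_stdComplexGaussian_lt_top :
    ∫⁻ z, ENNReal.ofReal (‖z‖ ^ 2) ∂stdComplexGaussian < ⊤ := by
  have hf : Integrable (fun x : ℝ => x ^ 2) (gaussianReal 0 (1 / 2)) :=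
    (memLp_id_gaussianReal 2).integrable_sq
  have hi : Integrable (fun z : ℝ × ℝ => z.1 ^ 2 + z.2 ^ 2)
      ((gaussianReal 0 (1 / 2)).prod (gaussianReal 0 (1 / 2))) :=
    (hf.comp_fst _).add (hf.comp_snd _)
  rw [stdComplexGaussian, lintegral_map (by fun_prop) (by fun_prop)]
  refine lt_of_le_of_lt (lintegral_mono fun z => ?_) hi.lintegral_lt_top
  rw [Complex.sq_norm, Complex.normSq_apply]
  simp [pow_two]

/-- Almost surely `∑ ⟨n⟩^{2s} |g_n / ⟨n⟩|²` is finite for all `s < 1/2`. -/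
theorem ae_summable {Ω : Type*} [MeasurableSpace Ω] {P : Measure Ω} {g : ℤ → Ω → ℂ}
    (hg : IsGaussianFamily P g) : ∀ᵐ ω ∂P, ∀ s : ℝ, s < 1 / 2 →
      Summable fun n : ℤ => bracket n ^ (2 * s) * ‖g n ω / (bracket n : ℂ)‖ ^ 2 := by
  have hone : ∀ n, 1 ≤ bracket n := fun n => by
    rw [bracket, Real.one_le_sqrt]; nlinarith [sq_nonneg (n : ℝ)]
  have key : ∀ s : ℝ, s < 1 / 2 → ∀ᵐ ω ∂P,
      Summable fun n : ℤ => bracket n ^ (2 * s) * ‖g n ω / (bracket n : ℂ)‖ ^ 2 := by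
    intro s hs
    have hnn : ∀ (n : ℤ) ω, 0 ≤ bracket n ^ (2 * s) * ‖g n ω / (bracket n : ℂ)‖ ^ 2 :=
      fun n ω => mul_nonneg (Real.rpow_nonneg (bracket_pos n).le _) (sq_nonneg _)
    have hw : Summable fun n : ℤ => bracket n ^ (2 * s - 2) := by
      have h1 : Summable fun n : ℤ => |(n : ℝ)| ^ (2 * s - 2) := by
        have := Real.summable_abs_int_rpow (b := 2 - 2 * s) (by linarith)
        simpa [neg_sub] using this
      refine Summable.of_norm_bounded_eventually h1 ?_
      filter_upwards [(Set.finite_singleton (0 : ℤ)).compl_mem_cofinite] with n hn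
      have hn0 : 0 < |(n : ℝ)| := abs_pos.mpr (by exact_mod_cast hn)
      rw [Real.norm_of_nonneg (Real.rpow_nonneg (bracket_pos n).le _)]
      refine Real.rpow_le_rpow_of_nonpos hn0 ?_ (by linarith)
      rw [bracket, ← Real.sqrt_sq_eq_abs]
      exact Real.sqrt_le_sqrt (by linarith)
    have heq : ∀ (n : ℤ) ω, bracket n ^ (2 * s) * ‖g n ω / (bracket n : ℂ)‖ ^ 2 =
        bracket n ^ (2 * s - 2) * ‖g n ω‖ ^ 2 := fun n ω => by
      rw [norm_div, Complex.norm_real, Real.norm_of_nonneg (bracket_pos n).le, div_pow,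
        Real.rpow_sub (bracket_pos n), Real.rpow_two]
      ring
    have hint : ∫⁻ ω, ∑' n : ℤ,
        ENNReal.ofReal (bracket n ^ (2 * s) * ‖g n ω / (bracket n : ℂ)‖ ^ 2) ∂P ≠ ⊤ := by
      have hm : ∀ n : ℤ, AEMeasurable (fun ω => ENNReal.ofReal (‖g n ω‖ ^ 2)) P := fun n =>
        ((hg.1 n).aemeasurable.norm.pow_const 2).ennreal_ofReal
      have hE : ∀ n : ℤ, ∫⁻ ω, ENNReal.ofReal (‖g n ω‖ ^ 2) ∂P =
          ∫⁻ z, ENNReal.ofReal (‖z‖ ^ 2) ∂stdComplexGaussian := fun n => by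
        rw [← (hg.1 n).map_eq, lintegral_map' (by fun_prop) (hg.1 n).aemeasurable]
      simp only [heq, ENNReal.ofReal_mul (Real.rpow_nonneg (bracket_pos _).le _)]
      rw [lintegral_tsum fun n => (hm n).const_mul _]
      simp only [lintegral_const_mul' _ _ ENNReal.ofReal_ne_top, hE, ENNReal.tsum_mul_right]
      exact ENNReal.mul_ne_top hw.tsum_ofReal_ne_top lintegral_sq_stdComplexGaussian_lt_top.ne
    have hmeas : AEMeasurable (fun ω => ∑' n : ℤ,
        ENNReal.ofReal (bracket n ^ (2 * s) * ‖g n ω / (bracket n : ℂ)‖ ^ 2)) P :=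
      AEMeasurable.tsum fun n =>
        (((hg.1 n).aemeasurable.div_const _).norm.pow_const 2 |>.const_mul _).ennreal_ofReal
    filter_upwards [ae_lt_top' hmeas hint] with ω hω
    have := ENNReal.summable_toReal hω.ne
    simpa only [ENNReal.toReal_ofReal (hnn _ ω)] using this
  have hcount : ∀ᵐ ω ∂P, ∀ k : ℕ, Summable fun n : ℤ =>
      bracket n ^ (2 * (1 / 2 - 1 / ((k : ℝ) + 1))) * ‖g n ω / (bracket n : ℂ)‖ ^ 2 :=
    ae_all_iff.mpr fun k => key _ (by have : 0 < 1 / ((k : ℝ) + 1) := by positivity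
                                      linarith)
  filter_upwards [hcount] with ω hω s hs
  obtain ⟨k, hk⟩ := exists_nat_one_div_lt (sub_pos.mpr hs)
  refine Summable.of_nonneg_of_le
    (fun n => mul_nonneg (Real.rpow_nonneg (bracket_pos n).le _) (sq_nonneg _))
    (fun n => mul_le_mul_of_nonneg_right
      (Real.rpow_le_rpow_of_exponent_le (hone n) ?_) (sq_nonneg _)) (hω k)
  linarith

/-- The random series converges almost surely in `L²(𝕋)`, with Fourier coefficients
`g_n / ⟨n⟩`. -/
theorem ae_hasSum {Ω : Type*} [MeasurableSpace Ω] {P : Measure Ω} {g : ℤ → Ω → ℂ}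
    (hg : IsGaussianFamily P g) : ∀ᵐ ω ∂P,
      HasSum (fun n : ℤ => (g n ω / (bracket n : ℂ)) • (fourierLp (T := 2 * Real.pi) 2 n : L2T))
        (randomSeries g ω) ∧
      ∀ n, coeff (randomSeries g ω) n = g n ω / (bracket n : ℂ) := by
  filter_upwards [ae_summable hg] with ω hω
  have h0 : Summable fun n : ℤ => ‖g n ω / (bracket n : ℂ)‖ ^ 2 := by
    simpa using hω 0 (by norm_num)
  let a : lp (fun _ : ℤ => ℂ) 2 := ⟨fun n => g n ω / (bracket n : ℂ), by
    refine memℓp_gen ?_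
    simpa using h0⟩
  have hs := (fourierBasis (T := 2 * Real.pi)).hasSum_repr_symm a
  rw [coe_fourierBasis] at hs
  have hu : randomSeries g ω = (fourierBasis (T := 2 * Real.pi)).repr.symm a := hs.tsum_eq
  refine ⟨hu ▸ hs, fun n => ?_⟩
  rw [coeff, ← fourierBasis_repr, hu, LinearIsometryEquiv.apply_symm_apply]

/-- Almost surely the random function is the sum of its series and has the Fourier coefficients
`g_n / ⟨n⟩`. -/
theorem ae_coeff_randomData {Ω : Type*} [MeasurableSpace Ω] {P : Measure Ω} {g : ℤ → Ω → ℂ}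
    (hg : IsGaussianFamily P g) : ∀ᵐ ω ∂P,
      (randomData g ω : L2T) = randomSeries g ω ∧
      ∀ n, coeff (randomData g ω : L2T) n = g n ω / (bracket n : ℂ) := by
  filter_upwards [ae_summable hg, ae_hasSum hg] with ω hω h
  have hmem : ∀ s : ℝ, s < 1 / 2 → MemSobolev s (randomSeries g ω) := fun s hs => by
    simpa only [MemSobolev, h.2] using hω s hs
  have he : (randomData g ω : L2T) = randomSeries g ω := by rw [randomData, dif_pos hmem]
  exact ⟨he, fun n => by rw [he, h.2 n]⟩

/-- The random function is a random variable, so that `gaussMeasure` is its law. -/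
theorem aemeasurable_randomData {Ω : Type*} [MeasurableSpace Ω] {P : Measure Ω}
    {g : ℤ → Ω → ℂ} (hg : IsGaussianFamily P g) : AEMeasurable (randomData g) P := by
  let _ : MeasurableSpace L2T := borel L2T
  have : BorelSpace L2T := ⟨rfl⟩
  have h1 : AEMeasurable (randomSeries g) P := by
    refine aemeasurable_of_tendsto_metrizable_ae (Filter.atTop : Filter (Finset ℤ))
      (f := fun t ω => ∑ n ∈ t, (g n ω / (bracket n : ℂ)) •
        (fourierLp (T := 2 * Real.pi) 2 n : L2T)) (fun t => ?_) ?_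
    · have hc : Continuous fun z : ℤ → ℂ =>
          ∑ n ∈ t, (z n / (bracket n : ℂ)) • (fourierLp (T := 2 * Real.pi) 2 n : L2T) :=
        continuous_finsetSum _ fun n _ =>
          ((continuous_apply n).div_const _).smul continuous_const
      exact hc.measurable.comp_aemeasurable
        (aemeasurable_pi_lambda (fun ω n => g n ω) fun n => (hg.1 n).aemeasurable)
    · filter_upwards [ae_hasSum hg] with ω hω
      exact hω.1
  have h2 : AEMeasurable (fun ω => (randomData g ω : L2T)) P :=
    h1.congr (by filter_upwards [ae_coeff_randomData hg] with ω hω using hω.1.symm)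
  obtain ⟨k, hk, hr, he⟩ := h2.exists_ae_eq_range_subset
    (t := {u : L2T | ∀ s : ℝ, s < 1 / 2 → MemSobolev s u})
    (Filter.Eventually.of_forall fun ω => (randomData g ω).mem) ⟨0, fun s _ => memSobolev_zero s⟩
  refine ⟨fun ω => ⟨k ω, hr ⟨ω, rfl⟩⟩, ?_, ?_⟩
  · rintro _ ⟨B, hB, rfl⟩
    exact hk hB
  · filter_upwards [he] with ω hω
    
    cases hx : randomData g ω
    simp_all

end DNLS

end

noncomputable section

namespace DNLS

open Filter Topology
open scoped ENNReal NNReal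

/-! ### Gaussian concentration by the rotation (Maurey–Pisier) method -/

section Concentration

variable {E : Type*} [NormedAddCommGroup E] [InnerProductSpace ℝ E] [FiniteDimensional ℝ E]
  [MeasurableSpace E] [BorelSpace E]

/-! On the Fourier side both exponents are `3/4` of one quartic form, the energy `E(v) = ∑ k |(v *
v)(k)|²`, with `v(n) = c(n) g_n / ⟨n⟩` (`f_eq`, `S4_eq`; `c = 1` for `f_N`). Since `1/2 ∫ |P_{≤N}
u|⁶` is nonnegative, dropping it only enlarges `Ψ_N`, and by Bessel the ball for the full mass lies
in the ball for the low mass. So everything reduces to one bound, uniform in `N` and `c`, for `∫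
1_{mass < m} exp(p · 3/4 · E)` over finitely many independent complex Gaussians:
`exists_lintegral_exp_energy_le`.

That bound comes from Gaussian concentration. If a set `A` of Gaussian vectors has measure at least
`1/4`, then the exponential of a small multiple of the squared distance to `A` has a bounded
integral in every dimension (`lintegral_exp_infDist_sq_le`). Hence it suffices to find such an `A`
with `p · 3/4 · E(x) ≤ C + |x - y|² / 20` for every `x` in the small ball and every `y ∈ A`
(`lintegral_exp_le_of_le_dist`).

The comparison is deterministic. Let `a` be the part of the signal of `y` at frequencies `|n| > L`
and write the signal of `x` as `a + b`. Above `L` the `H¹` norm of `b` is controlled by the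
Euclidean distance of `x` and `y`, because the covariance weight is `1/⟨n⟩`; below `L` it is
controlled by the mass of `x`. Expanding `E(a + b)` and using Parseval, the derivative is arranged
so that `a` enters only through `E(a)`, its mass, the `L²` norm of its square, and the `H⁻¹` norms
of its momentum density and of a cubic expression. The terms quadratic in the `H¹` norm of `b` carry
a factor that small mass makes small: `energy_add_le`, `energy_add_le_of_small`, with
`wienerNorm_sq_le` supplying the smallness.

It remains to see that these conditions on `a` are typical. Because `c` is even, `n ↦ -n` preserves
the law and reverses the sign of `E`, so `E(a) ≤ 0` has probability at least `1/2`
(`half_le_measure_energy_nonpos`). The mass is small on average once `L` is large, and the other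
quantities have means bounded independently of `N` by orthogonality of Gaussian monomials. Here
evenness is used again, to remove the mean of the total momentum. Four Markov bounds cost `1/16`
each, leaving `1/4` (`quarter_le_measure_typicalSet`). -/

theorem integrable_exp_mul_norm_stdGaussian (c : ℝ) :
    Integrable (fun x : E => Real.exp (c * ‖x‖)) (stdGaussian E) := by
  obtain ⟨C, hC, hi⟩ := IsGaussian.exists_integrable_exp_sq (stdGaussian E)
  refine (hi.const_mul (Real.exp (c ^ 2 / (4 * C)))).mono' (by fun_prop) (ae_of_all _ fun x => ?_)
  rw [Real.norm_of_nonneg (Real.exp_nonneg _), ← Real.exp_add, Real.exp_le_exp]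
  have : 0 ≤ (2 * C * ‖x‖ - c) ^ 2 / (4 * C) := by positivity
  have h2 : (2 * C * ‖x‖ - c) ^ 2 / (4 * C) = C * ‖x‖ ^ 2 - c * ‖x‖ + c ^ 2 / (4 * C) := by
    field_simp; ring
  linarith

theorem lintegral_exp_dual_stdGaussian (L : StrongDual ℝ E) :
    ∫⁻ y, ENNReal.ofReal (Real.exp (L y)) ∂(stdGaussian E) =
      ENNReal.ofReal (Real.exp (‖L‖ ^ 2 / 2)) := by
  have hmap : (stdGaussian E).map L = gaussianReal 0 (Real.toNNReal (‖L‖ ^ 2)) := by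
    rw [IsGaussian.map_eq_gaussianReal, variance_dual_stdGaussian,
      integral_strongDual_stdGaussian]
  rw [← ofReal_integral_eq_lintegral_ofReal]
  · have h := mgf_gaussianReal hmap 1
    simp only [mgf, one_mul] at h
    rw [h, Real.coe_toNNReal _ (by positivity)]
    simp
  · have h := integrable_exp_mul_gaussianReal (μ := 0) (v := Real.toNNReal (‖L‖ ^ 2)) 1
    rw [← hmap, integrable_map_measure (by fun_prop) (by fun_prop)] at h
    simpa [Function.comp_def] using h
  · exact ae_of_all _ fun _ => Real.exp_nonneg _

/-- The displacement `f(cos θ x + sin θ y) - f(x)` controls `f(y) - f(x)`: cut the quarter turn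
from `x` to `y` into `K` rotations and use Hölder's inequality. -/
theorem lintegral_exp_sub_le_lintegral_rotation {f : E → ℝ} (hf : Continuous f) (K : ℕ)
    (hK : K ≠ 0) :
    ∫⁻ z : E × E, ENNReal.ofReal (Real.exp (f z.2 - f z.1)) ∂((stdGaussian E).prod (stdGaussian E))
      ≤ ∫⁻ z : E × E, ENNReal.ofReal (Real.exp (K * (f (Real.cos (Real.pi / 2 / K) • z.1 +
        Real.sin (Real.pi / 2 / K) • z.2) - f z.1))) ∂((stdGaussian E).prod (stdGaussian E)) := by
  have hK0 : (K : ℝ) ≠ 0 := by exact_mod_cast hK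
  set θ : ℝ := Real.pi / 2 / K with hθ
  set γ := (stdGaussian E).prod (stdGaussian E)
  let D : E × E → ℝ≥0∞ := fun z =>
    ENNReal.ofReal (Real.exp (K * (f (Real.cos θ • z.1 + Real.sin θ • z.2) - f z.1)))
  have hD : Measurable D := by fun_prop
  -- The point at angle `k θ` on the quarter circle from `x` to `y`. Rotating the pair by `k θ`
  -- turns the first step of this path into its `k`-th step.
  let pos : ℕ → E × E → E := fun k z => Real.cos (k * θ) • z.1 + Real.sin (k * θ) • z.2
  have hstep : ∀ (k : ℕ) (z : E × E), D (ContinuousLinearMap.rotation (k * θ) z) =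
      ENNReal.ofReal (Real.exp (K * (f (pos (k + 1) z) - f (pos k z)))) := by
    intro k z
    simp only [D, ContinuousLinearMap.rotation_apply, pos]
    have : Real.cos θ • (Real.cos (k * θ) • z.1 + Real.sin (k * θ) • z.2) +
        Real.sin θ • (-Real.sin (k * θ) • z.1 + Real.cos (k * θ) • z.2) =
        Real.cos ((k + 1 : ℕ) * θ) • z.1 + Real.sin ((k + 1 : ℕ) * θ) • z.2 := by
      push_cast
      rw [add_mul, one_mul, Real.cos_add, Real.sin_add]
      module
    rw [this]
  -- A pair of independent standard Gaussians is invariant under rotation, so all `K` Hölder factors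
  -- below, each with exponent `1/K`, have the same integral.
  have hinv : ∀ k : ℕ, ∫⁻ z, D (ContinuousLinearMap.rotation (k * θ) z) ∂γ = ∫⁻ z, D z ∂γ := by
    intro k
    have h := IsGaussian.map_rotation_eq_self (μ := stdGaussian E) (by simp) (k * θ)
    calc ∫⁻ z, D (ContinuousLinearMap.rotation (k * θ) z) ∂γ
        = ∫⁻ z, D z ∂(γ.map (ContinuousLinearMap.rotation (k * θ))) :=
          (lintegral_map hD (by fun_prop)).symm
      _ = ∫⁻ z, D z ∂γ := by rw [h]
  have hprod : ∀ z : E × E, ENNReal.ofReal (Real.exp (f z.2 - f z.1)) =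
      ∏ k ∈ Finset.range K, D (ContinuousLinearMap.rotation (k * θ) z) ^ (1 / K : ℝ) := by
    intro z
    have h1 : ∀ k ∈ Finset.range K, D (ContinuousLinearMap.rotation (k * θ) z) ^ (1 / K : ℝ) =
        ENNReal.ofReal (Real.exp (f (pos (k + 1) z) - f (pos k z))) := by
      intro k _
      rw [hstep, ENNReal.ofReal_rpow_of_pos (Real.exp_pos _), ← Real.exp_mul]
      congr 2
      field_simp
    rw [Finset.prod_congr rfl h1, ← ENNReal.ofReal_prod_of_nonneg fun _ _ => Real.exp_nonneg _,
      ← Real.exp_sum, Finset.sum_range_sub (fun k => f (pos k z))]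
    have hend : (K : ℝ) * θ = Real.pi / 2 := by rw [hθ]; field_simp
    simp [pos, hend]
  calc ∫⁻ z, ENNReal.ofReal (Real.exp (f z.2 - f z.1)) ∂γ
      = ∫⁻ z, ∏ k ∈ Finset.range K, D (ContinuousLinearMap.rotation (k * θ) z) ^ (1 / K : ℝ) ∂γ :=
        lintegral_congr hprod
    _ ≤ ∏ k ∈ Finset.range K,
          (∫⁻ z, D (ContinuousLinearMap.rotation (k * θ) z) ∂γ) ^ (1 / K : ℝ) := by
        refine ENNReal.lintegral_prod_norm_pow_le _ (fun k _ => ?_) ?_ (fun _ _ => by positivity)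
        · exact (hD.comp (by fun_prop)).aemeasurable
        · simp [hK0]
    _ = ∫⁻ z, D z ∂γ := by
        simp only [hinv, Finset.prod_const, Finset.card_range]
        rw [← ENNReal.rpow_mul_natCast, one_div, inv_mul_cancel₀ hK0, ENNReal.rpow_one]

/-- Exponential moments of `f(y) - f(x)` for a Lipschitz function that is almost everywhere
differentiable. -/
theorem lintegral_exp_sub_le_of_ae_differentiable {f : E → ℝ} {r : ℝ≥0} (hf : LipschitzWith r f)
    (hd : ∀ᵐ x ∂(stdGaussian E), DifferentiableAt ℝ f x) :
    ∫⁻ z : E × E, ENNReal.ofReal (Real.exp (f z.2 - f z.1)) ∂((stdGaussian E).prod (stdGaussian E))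
      ≤ ENNReal.ofReal (Real.exp (r ^ 2 * Real.pi ^ 2 / 8)) := by
  set γ := (stdGaussian E).prod (stdGaussian E) with hγ
  let θ : ℕ → ℝ := fun K => Real.pi / 2 / K
  have hθlim : Tendsto θ atTop (𝓝 0) := tendsto_const_div_atTop_nhds_zero_nat _
  let G : ℕ → E × E → ℝ≥0∞ := fun K z => ENNReal.ofReal (Real.exp (K * (f (Real.cos (θ K) • z.1 +
        Real.sin (θ K) • z.2) - f z.1)))
  have hfc := hf.continuous
  -- As `K θ = π/2`, the scaled displacement is a difference quotient along the circle and tends to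
  -- `(π/2) f'(x) y`. The Lipschitz bound dominates it by `r (π/2) (‖x‖ + ‖y‖)`.
  have hlim : Tendsto (fun K => ∫⁻ z, G K z ∂γ) atTop
      (𝓝 (∫⁻ z, ENNReal.ofReal (Real.exp ((Real.pi / 2) * fderiv ℝ f z.1 z.2)) ∂γ)) := by
    refine tendsto_lintegral_of_dominated_convergence
      (fun z => ENNReal.ofReal (Real.exp (r * (Real.pi / 2) * ‖z.1‖) *
        Real.exp (r * (Real.pi / 2) * ‖z.2‖))) (fun K => by fun_prop) (fun K => ?_) ?_ ?_
    · refine ae_of_all _ fun z => ENNReal.ofReal_le_ofReal ?_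
      rw [← Real.exp_add, Real.exp_le_exp]
      rcases eq_or_ne K 0 with rfl | hK
      · simp; positivity
      have hK0 : (0 : ℝ) < K := by positivity
      have h1 : f (Real.cos (θ K) • z.1 + Real.sin (θ K) • z.2) - f z.1 ≤
          r * (θ K * (‖z.1‖ + ‖z.2‖)) := by
        refine (le_abs_self _).trans ?_
        rw [← Real.dist_eq]
        refine (hf.dist_le_mul _ _).trans ?_
        gcongr
        rw [dist_eq_norm]
        have hθ0 : 0 ≤ θ K := by positivity
        have e : Real.cos (θ K) • z.1 + Real.sin (θ K) • z.2 - z.1 =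
          (Real.cos (θ K) - 1) • z.1 + Real.sin (θ K) • z.2 := by module
        rw [e]
        refine (norm_add_le _ _).trans ?_
        rw [norm_smul, norm_smul, mul_add]
        have hs : ‖Real.sin (θ K)‖ ≤ θ K := by
          simpa [abs_of_nonneg hθ0] using Real.abs_sin_le_abs (x := θ K)
        have hc : ‖Real.cos (θ K) - 1‖ ≤ θ K := by
          rw [Real.norm_eq_abs]
          have := Real.abs_cos_sub_cos_le (θ K) 0
          simpa [abs_of_nonneg hθ0] using this
        gcongr
      calc K * (f (Real.cos (θ K) • z.1 + Real.sin (θ K) • z.2) - f z.1)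
          ≤ K * (r * (θ K * (‖z.1‖ + ‖z.2‖))) := by gcongr
        _ = _ := by simp only [θ]; field_simp
    · have := ((integrable_exp_mul_norm_stdGaussian (E := E) (r * (Real.pi / 2))).mul_prod
        (integrable_exp_mul_norm_stdGaussian (E := E) (r * (Real.pi / 2))))
      exact this.lintegral_lt_top.ne
    · have hd' : ∀ᵐ z ∂γ, DifferentiableAt ℝ f z.1 :=
        Measure.quasiMeasurePreserving_fst.ae hd
      filter_upwards [hd'] with z hz
      refine (ENNReal.continuous_ofReal.tendsto _).comp ((Real.continuous_exp.tendsto _).comp ?_)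
      have hcurve : HasDerivAt (fun t : ℝ => Real.cos t • z.1 + Real.sin t • z.2) z.2 0 := by
        have h1 := (Real.hasDerivAt_cos 0).smul_const z.1
        have h2 := (Real.hasDerivAt_sin 0).smul_const z.2
        have h3 := h1.fun_add h2
        simpa using h3
      have hz' : HasFDerivAt f (fderiv ℝ f z.1) (Real.cos 0 • z.1 + Real.sin 0 • z.2) := by
        simpa using hz.hasFDerivAt
      have hcomp := hz'.comp_hasDerivAt (0 : ℝ) hcurve
      have hsl := hcomp.tendsto_slope_zero
      have hθne : Tendsto θ atTop (𝓝[≠] 0) := by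
        refine tendsto_nhdsWithin_iff.mpr ⟨hθlim, ?_⟩
        filter_upwards [eventually_gt_atTop 0] with K hK
        have : (0 : ℝ) < K := by exact_mod_cast hK
        simp only [θ, Set.mem_compl_iff, Set.mem_singleton_iff]
        positivity
      have h3 := (hsl.comp hθne).const_mul (Real.pi / 2)
      refine h3.congr' ?_
      filter_upwards [eventually_gt_atTop 0] with K hK
      have : (0 : ℝ) < K := by exact_mod_cast hK
      simp only [Function.comp_def, zero_add, Real.cos_zero, one_smul, Real.sin_zero, zero_smul,
        add_zero, smul_eq_mul]
      rw [← mul_assoc]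
      congr 1
      simp only [θ]
      field_simp
  have hle : ∀ᶠ K in atTop, ∫⁻ z : E × E, ENNReal.ofReal (Real.exp (f z.2 - f z.1)) ∂γ ≤
      ∫⁻ z, G K z ∂γ := by
    filter_upwards [eventually_ne_atTop 0] with K hK
    exact lintegral_exp_sub_le_lintegral_rotation hfc K hK
  refine (ge_of_tendsto hlim hle).trans ?_
  have hmeas : Measurable fun z : E × E =>
      ENNReal.ofReal (Real.exp ((Real.pi / 2) * fderiv ℝ f z.1 z.2)) := by
    have h1 : Measurable (fderiv ℝ f) := measurable_fderiv ℝ f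
    have h2 : Measurable fun z : E × E => fderiv ℝ f z.1 z.2 := by
      have : Measurable fun q : (E →L[ℝ] ℝ) × E => q.1 q.2 :=
        (by fun_prop : Continuous fun q : (E →L[ℝ] ℝ) × E => q.1 q.2).measurable
      exact this.comp ((h1.comp measurable_fst).prodMk measurable_snd)
    fun_prop
  rw [hγ, lintegral_prod _ hmeas.aemeasurable]
  calc ∫⁻ x, ∫⁻ y, ENNReal.ofReal (Real.exp ((Real.pi / 2) * fderiv ℝ f x y)) ∂(stdGaussian E)
          ∂(stdGaussian E)
      ≤ ∫⁻ _x : E, ENNReal.ofReal (Real.exp (r ^ 2 * Real.pi ^ 2 / 8)) ∂(stdGaussian E) := by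
        -- For fixed `x` the variable `(π/2) f'(x) y` is a centered Gaussian of variance at most
        -- `(π/2)² r²`; half of this is the exponent `r² π² / 8`.
        refine lintegral_mono fun x => ?_
        have h := lintegral_exp_dual_stdGaussian ((Real.pi / 2) • fderiv ℝ f x)
        simp only [smul_apply, smul_eq_mul] at h
        rw [h]
        refine ENNReal.ofReal_le_ofReal (Real.exp_le_exp.mpr ?_)
        have hn : ‖fderiv ℝ f x‖ ≤ r := norm_fderiv_le_of_lipschitz ℝ hf
        rw [norm_smul, Real.norm_of_nonneg (by positivity), mul_pow]
        have : ‖fderiv ℝ f x‖ ^ 2 ≤ (r : ℝ) ^ 2 := by gcongr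
        nlinarith [sq_nonneg Real.pi]
    _ = _ := by simp

/-- Exponential moments of `f(y) - f(x)` for a Lipschitz function `f` and independent standard
Gaussian vectors `x`, `y`. -/
theorem lintegral_exp_sub_le {f : E → ℝ} {r : ℝ≥0} (hf : LipschitzWith r f) :
    ∫⁻ z : E × E, ENNReal.ofReal (Real.exp (f z.2 - f z.1)) ∂((stdGaussian E).prod (stdGaussian E))
      ≤ ENNReal.ofReal (Real.exp (r ^ 2 * Real.pi ^ 2 / 8)) := by
  -- Rademacher's theorem concerns Lebesgue measure. By Fubini, for almost every translation `a` the
  -- function `f(· + a)` is differentiable almost everywhere for the Gaussian. Such `a` exist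
  -- arbitrarily close to `0`, and replacing `f` by `f(· + a)` costs a factor `exp(2 r δ)`, which
  -- disappears as `δ → 0`.
  have hae : ∀ᵐ a : E ∂(volume : Measure E),
      ∀ᵐ x ∂(stdGaussian E), DifferentiableAt ℝ f (x + a) := by
    have hm : MeasurableSet {x | DifferentiableAt ℝ f x} := measurableSet_of_differentiableAt ℝ f
    have hprod : ∀ᵐ z : E × E ∂((stdGaussian E).prod volume), DifferentiableAt ℝ f (z.1 + z.2) := by
      refine (Measure.ae_prod_iff_ae_ae ?_).mpr (ae_of_all _ fun x => ?_)
      · exact (by fun_prop : Measurable fun z : E × E => z.1 + z.2) hm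
      · have h := hf.ae_differentiableAt (μ := (volume : Measure E))
        exact (measurePreserving_add_left volume x).quasiMeasurePreserving.ae h
    have hs := (Measure.ae_prod_iff_ae_ae (μ := (volume : Measure E)) (ν := stdGaussian E)
      (p := fun z => DifferentiableAt ℝ f (z.2 + z.1))
      ((by fun_prop : Measurable fun z : E × E => z.2 + z.1) hm)).mp ?_
    · exact hs
    · have := (Measure.measurePreserving_swap (μ := (volume : Measure E))
        (ν := stdGaussian E)).quasiMeasurePreserving.ae hprod
      exact this
  have hdense := Measure.dense_of_ae hae
  have hbound : ∀ δ > 0, ∫⁻ z : E × E, ENNReal.ofReal (Real.exp (f z.2 - f z.1))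
      ∂((stdGaussian E).prod (stdGaussian E)) ≤
      ENNReal.ofReal (Real.exp (2 * r * δ)) *
        ENNReal.ofReal (Real.exp (r ^ 2 * Real.pi ^ 2 / 8)) := by
    intro δ hδ
    obtain ⟨a, ha, hda⟩ := hdense.exists_dist_lt (0 : E) hδ
    have hfa : LipschitzWith r fun x => f (x + a) := by
      simpa [Function.comp_def] using hf.comp (isometry_add_right a).lipschitz
    have hda' : ∀ᵐ x ∂(stdGaussian E), DifferentiableAt ℝ (fun x => f (x + a)) x := by
      filter_upwards [ha] with x hx
      exact (differentiableAt_comp_add_right a).mpr hx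
    have hmain := lintegral_exp_sub_le_of_ae_differentiable hfa hda'
    rw [dist_zero_left] at hda
    have hclose : ∀ x, |f (x + a) - f x| ≤ r * δ := fun x => by
      rw [← Real.dist_eq]
      refine (hf.dist_le_mul _ _).trans ?_
      gcongr
      simpa using hda.le
    calc ∫⁻ z : E × E, ENNReal.ofReal (Real.exp (f z.2 - f z.1))
          ∂((stdGaussian E).prod (stdGaussian E))
        ≤ ∫⁻ z : E × E, ENNReal.ofReal (Real.exp (2 * r * δ)) *
            ENNReal.ofReal (Real.exp (f (z.2 + a) - f (z.1 + a)))
          ∂((stdGaussian E).prod (stdGaussian E)) := by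
          refine lintegral_mono fun z => ?_
          rw [← ENNReal.ofReal_mul (Real.exp_nonneg _), ← Real.exp_add]
          refine ENNReal.ofReal_le_ofReal (Real.exp_le_exp.mpr ?_)
          have h1 := abs_le.mp (hclose z.1)
          have h2 := abs_le.mp (hclose z.2)
          linarith [h1.1, h1.2, h2.1, h2.2]
      _ ≤ _ := by
          rw [lintegral_const_mul' _ _ ENNReal.ofReal_ne_top]
          gcongr
  have hlim : Tendsto (fun δ : ℝ => ENNReal.ofReal (Real.exp (2 * r * δ)) *
      ENNReal.ofReal (Real.exp (r ^ 2 * Real.pi ^ 2 / 8))) (𝓝[>] 0)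
      (𝓝 (ENNReal.ofReal (Real.exp (2 * r * 0)) *
        ENNReal.ofReal (Real.exp (r ^ 2 * Real.pi ^ 2 / 8)))) := by
    refine ENNReal.Tendsto.mul_const ?_ (Or.inr ENNReal.ofReal_ne_top)
    have : Continuous fun δ : ℝ => ENNReal.ofReal (Real.exp (2 * r * δ)) :=
      ENNReal.continuous_ofReal.comp (by fun_prop)
    exact (this.tendsto 0).mono_left nhdsWithin_le_nhds
  have := ge_of_tendsto hlim (eventually_nhdsWithin_of_forall fun δ hδ => hbound δ hδ)
  simpa using this

/-- The exponential moment `E exp(π² λ² / 8)` of a centered Gaussian `λ` of variance `1/10`. -/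
def expSqConst : ℝ≥0∞ :=
  ∫⁻ t, ENNReal.ofReal (Real.exp (t ^ 2 * Real.pi ^ 2 / 8)) ∂(gaussianReal 0 (1 / 10))

theorem expSqConst_lt_top : expSqConst < ⊤ := by
  unfold expSqConst
  rw [gaussianReal_of_var_ne_zero _ (by norm_num), lintegral_withDensity_eq_lintegral_mul _
    (by fun_prop) (by fun_prop)]
  -- Variance `1/10` means density proportional to `exp(-5 t²)`, which beats `exp(π² t² / 8)`
  -- because `π² < 40`.
  have hi : Integrable fun t : ℝ => (Real.sqrt (2 * Real.pi * (1 / 10 : ℝ≥0)))⁻¹ *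
      Real.exp (-(5 - Real.pi ^ 2 / 8) * t ^ 2) := by
    refine (integrable_exp_neg_mul_sq ?_).const_mul _
    nlinarith [Real.pi_lt_four, Real.pi_pos]
  refine lt_of_le_of_lt (lintegral_mono fun t => ?_) hi.lintegral_lt_top
  simp only [Pi.mul_apply, gaussianPDF, gaussianPDFReal]
  rw [← ENNReal.ofReal_mul (by positivity), mul_assoc, ← Real.exp_add]
  refine ENNReal.ofReal_le_ofReal (le_of_eq ?_)
  congr 2
  push_cast
  ring

/-- Gaussian concentration: the square of the distance to a set of positive measure is
exponentially integrable, with constants that do not depend on the dimension. -/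
theorem lintegral_exp_infDist_sq_le (A : Set E) :
    stdGaussian E A * ∫⁻ x, ENNReal.ofReal (Real.exp (Metric.infDist x A ^ 2 / 20)) ∂(stdGaussian E)
      ≤ expSqConst := by
  rcases Set.eq_empty_or_nonempty A with rfl | hA
  · simp
  set γ := stdGaussian E
  set F : E → ℝ := fun x => Metric.infDist x A
  have hF : LipschitzWith 1 F := Metric.lipschitz_infDist_pt A
  have hFc : Continuous F := hF.continuous
  -- In the moment bound for `t F(y) - t F(x)`, keep only those `x` where the distance `F(x)`
  -- vanishes. As `A` need not be measurable, these are taken in its closure.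
  have hexp : ∀ t : ℝ, γ A * ∫⁻ x, ENNReal.ofReal (Real.exp (t * F x)) ∂γ ≤
      ENNReal.ofReal (Real.exp (t ^ 2 * Real.pi ^ 2 / 8)) := by
    intro t
    have ht : LipschitzWith (Real.nnabs t) fun x => t * F x := by
      refine LipschitzWith.of_dist_le_mul fun x y => ?_
      rw [Real.dist_eq, ← mul_sub, abs_mul, Real.coe_nnabs, ← Real.dist_eq]
      gcongr
      simpa using hF.dist_le_mul x y
    have h := lintegral_exp_sub_le ht
    rw [Real.coe_nnabs, sq_abs, lintegral_prod _ (by fun_prop)] at h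
    refine le_trans ?_ h
    have hz : ∀ x ∈ closure A, F x = 0 := fun x hx =>
      (Metric.mem_closure_iff_infDist_zero hA).mp hx
    calc γ A * ∫⁻ x, ENNReal.ofReal (Real.exp (t * F x)) ∂γ
        ≤ γ (closure A) * ∫⁻ x, ENNReal.ofReal (Real.exp (t * F x)) ∂γ := by
          gcongr; exact subset_closure
      _ = ∫⁻ x in closure A, ∫⁻ y, ENNReal.ofReal (Real.exp (t * F y - t * F x)) ∂γ ∂γ := by
          rw [setLIntegral_congr_fun (g := fun _ => ∫⁻ x, ENNReal.ofReal (Real.exp (t * F x)) ∂γ)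
            isClosed_closure.measurableSet (fun x hx => by simp [hz x hx])]
          rw [setLIntegral_const, mul_comm]
      _ ≤ ∫⁻ x, ∫⁻ y, ENNReal.ofReal (Real.exp (t * F y - t * F x)) ∂γ ∂γ :=
          setLIntegral_le_lintegral _ _
  -- Linearize the square: `exp(s² / 20)` is the moment generating function at `s` of a centered
  -- Gaussian of variance `1/10`. Averaging the linear bounds over `t` then gives the quadratic one.
  have hsq : ∀ s : ℝ, ENNReal.ofReal (Real.exp (s ^ 2 / 20)) =
      ∫⁻ t, ENNReal.ofReal (Real.exp (t * s)) ∂(gaussianReal 0 (1 / 10)) := by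
    intro s
    rw [← ofReal_integral_eq_lintegral_ofReal _ (ae_of_all _ fun _ => Real.exp_nonneg _)]
    · have h := mgf_gaussianReal (X := id) (p := gaussianReal 0 (1 / 10)) Measure.map_id s
      simp only [mgf, id] at h
      simp only [mul_comm _ s]
      rw [h]
      congr 2
      push_cast
      ring
    · simpa [mul_comm] using integrable_exp_mul_gaussianReal (μ := 0) (v := 1 / 10) s
  simp only [hsq]
  rw [lintegral_lintegral_swap (by fun_prop), ← lintegral_const_mul _ (by fun_prop)]
  exact lintegral_mono hexp

end Concentration

/-! ### Convolutions and correlations of sequences supported in `|n| ≤ N` -/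

section Sequences

/-- The frequencies `|n| ≤ N`. -/
def box (N : ℕ) : Finset ℤ := Finset.Icc (-(N : ℤ)) N

theorem mem_box {N : ℕ} {n : ℤ} : n ∈ box N ↔ -(N : ℤ) ≤ n ∧ n ≤ N := Finset.mem_Icc

/-- The translate of `box N` by an element of `box N` lies in `box (2 * N)`, so no term is lost.
This is the change of variables behind the Parseval identities, in which convolutions are summed
over `box (2 * N)`. -/
theorem sum_box_sub {M : Type*} [AddCommMonoid M] {N : ℕ} {φ : ℤ → M}
    (hφ : ∀ n, n ∉ box N → φ n = 0) {s : ℤ} (hs : s ∈ box N) :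
    ∑ k ∈ box (2 * N), φ (k - s) = ∑ n ∈ box N, φ n := by
  symm
  refine Finset.sum_bij_ne_zero (fun n _ _ => n + s) ?_ ?_ ?_ ?_
  · intro n hn _; rw [mem_box] at *; push_cast; omega
  · intro a _ _ b _ _ h; simpa using h
  · intro k _ hk
    exact ⟨k - s, by_contra fun h => hk (hφ _ h), hk, by simp⟩
  · intro n _ _; simp

theorem sum_box_sub_left {M : Type*} [AddCommMonoid M] {N : ℕ} {φ : ℤ → M}
    (hφ : ∀ n, n ∉ box N → φ n = 0) {s : ℤ} (hs : s ∈ box N) :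
    ∑ k ∈ box (2 * N), φ (s - k) = ∑ n ∈ box N, φ n := by
  symm
  refine Finset.sum_bij_ne_zero (fun n _ _ => s - n) ?_ ?_ ?_ ?_
  · intro n hn _; rw [mem_box] at *; push_cast; omega
  · intro a _ _ b _ _ h; simpa using h
  · intro k _ hk
    exact ⟨s - k, by_contra fun h => hk (hφ _ h), hk, by simp⟩
  · intro n _ _; simp

theorem sum_box_reflect {M : Type*} [AddCommMonoid M] {N : ℕ} {φ : ℤ → M} (k : ℤ)
    (h1 : ∀ n, k - n ∉ box N → φ n = 0) (h2 : ∀ n, n ∉ box N → φ n = 0) :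
    ∑ n ∈ box N, φ (k - n) = ∑ n ∈ box N, φ n := by
  refine Finset.sum_bij_ne_zero (fun n _ _ => k - n) ?_ ?_ ?_ ?_
  · intro n _ hne; exact by_contra fun h => hne (h2 _ h)
  · intro a _ _ b _ _ h; simpa using h
  · intro n _ hn
    exact ⟨k - n, by_contra fun h => hn (h1 _ h), by simpa using hn, by simp⟩
  · intro n _ _; rfl

theorem sum_box_neg {M : Type*} [AddCommMonoid M] (N : ℕ) (φ : ℤ → M) :
    ∑ n ∈ box N, φ (-n) = ∑ n ∈ box N, φ n := by
  refine Finset.sum_bij' (fun n _ => -n) (fun n _ => -n) ?_ ?_ ?_ ?_ ?_ <;>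
    simp only [mem_box, neg_neg, implies_true]
  all_goals intro n hn; omega

theorem sum_mul_le_of_sq_le {ι : Type*} {s : Finset ι} {f g : ι → ℝ} {a b : ℝ} (ha : 0 ≤ a)
    (hb : 0 ≤ b) (hf : ∑ i ∈ s, f i ^ 2 ≤ a ^ 2) (hg : ∑ i ∈ s, g i ^ 2 ≤ b ^ 2) :
    ∑ i ∈ s, f i * g i ≤ a * b := by
  refine (Real.sum_mul_le_sqrt_mul_sqrt s f g).trans ?_
  gcongr
  · exact Real.sqrt_le_left ha |>.mpr hf
  · exact Real.sqrt_le_left hb |>.mpr hg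

/-- Young's inequality `‖p * q‖₂ ≤ ‖p‖₁ ‖q‖₂`. -/
theorem young_le {N : ℕ} {p q : ℤ → ℝ} (hp : ∀ n, 0 ≤ p n)
    (hq0 : ∀ n, n ∉ box N → q n = 0) :
    ∑ k ∈ box (2 * N), (∑ n ∈ box N, p n * q (k - n)) ^ 2 ≤
      (∑ n ∈ box N, p n) ^ 2 * ∑ n ∈ box N, q n ^ 2 := by
  -- Cauchy–Schwarz with respect to the weight `p`.
  have h1 : ∀ k, (∑ n ∈ box N, p n * q (k - n)) ^ 2 ≤
      (∑ n ∈ box N, p n) * ∑ n ∈ box N, p n * q (k - n) ^ 2 := by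
    intro k
    refine Finset.sum_sq_le_sum_mul_sum_of_sq_le_mul _ (fun n _ => hp n)
      (fun n _ => mul_nonneg (hp n) (sq_nonneg _)) fun n _ => le_of_eq ?_
    ring
  calc ∑ k ∈ box (2 * N), (∑ n ∈ box N, p n * q (k - n)) ^ 2
      ≤ ∑ k ∈ box (2 * N), (∑ n ∈ box N, p n) * ∑ n ∈ box N, p n * q (k - n) ^ 2 :=
        Finset.sum_le_sum fun k _ => h1 k
    _ = (∑ n ∈ box N, p n) * ∑ n ∈ box N, p n * ∑ k ∈ box (2 * N), q (k - n) ^ 2 := by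
        rw [← Finset.mul_sum, Finset.sum_comm]
        simp only [Finset.mul_sum]
    _ = (∑ n ∈ box N, p n) * ∑ n ∈ box N, p n * ∑ k ∈ box N, q k ^ 2 := by
        congr 1
        refine Finset.sum_congr rfl fun n hn => ?_
        rw [sum_box_sub (φ := fun m => q m ^ 2) (fun m hm => by simp [hq0 m hm]) hn]
    _ = _ := by rw [← Finset.sum_mul]; ring

/-- The convolution of two sequences supported in `box N`. -/
def conv (N : ℕ) (a b : ℤ → ℂ) (k : ℤ) : ℂ := ∑ n ∈ box N, a n * b (k - n)

/-- The correlation of two sequences supported in `box N`. -/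
def corr (N : ℕ) (a b : ℤ → ℂ) (j : ℤ) : ℂ := ∑ n ∈ box N, a n * starRingEnd ℂ (b (n - j))

/-- The Fourier multiplier of `-i ∂ₓ`. -/
def deriv1 (a : ℤ → ℂ) (n : ℤ) : ℂ := n * a n

/-- The energy `∑ k |(v * v)(k)|²`. -/
def energy (N : ℕ) (v : ℤ → ℂ) : ℝ := ∑ k ∈ box (2 * N), (k : ℝ) * ‖conv N v v k‖ ^ 2

variable {N : ℕ}

theorem deriv1_support {a : ℤ → ℂ} (ha : ∀ n, n ∉ box N → a n = 0) :
    ∀ n, n ∉ box N → deriv1 a n = 0 := fun n hn => by simp [deriv1, ha n hn]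

theorem conv_comm {a b : ℤ → ℂ} (ha : ∀ n, n ∉ box N → a n = 0)
    (hb : ∀ n, n ∉ box N → b n = 0) (k : ℤ) : conv N a b k = conv N b a k := by
  unfold conv
  rw [← sum_box_reflect (φ := fun n => a n * b (k - n)) k]
  · exact Finset.sum_congr rfl fun n _ => by rw [sub_sub_cancel, mul_comm]
  · intro n hn; simp [hb _ hn]
  · intro n hn; simp [ha _ hn]

theorem conv_add_self {a b : ℤ → ℂ} (ha : ∀ n, n ∉ box N → a n = 0)
    (hb : ∀ n, n ∉ box N → b n = 0) (k : ℤ) :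
    conv N (fun n => a n + b n) (fun n => a n + b n) k =
      conv N a a k + 2 * conv N a b k + conv N b b k := by
  have h : conv N (fun n => a n + b n) (fun n => a n + b n) k =
      conv N a a k + conv N a b k + (conv N b a k + conv N b b k) := by
    simp only [conv, ← Finset.sum_add_distrib]
    exact Finset.sum_congr rfl fun n _ => by ring
  rw [h, conv_comm hb ha]
  ring

/-- The Leibniz rule, from `k = n + (k - n)`. -/
theorem mul_conv (a b : ℤ → ℂ) (k : ℤ) :
    (k : ℂ) * conv N a b k = conv N (deriv1 a) b k + conv N a (deriv1 b) k := by
  simp only [conv, deriv1, ← Finset.sum_add_distrib, Finset.mul_sum]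
  refine Finset.sum_congr rfl fun n _ => ?_
  push_cast
  ring

/-- By Parseval both sides are `∫ A B conj(C D)`, read once as the pairing of `A B` with `C D` and
once as that of `A conj(C)` with `B conj(D)`. It regroups rough and smooth factors in the energy. -/
theorem sum_conv_mul_conj_conv {a b c d : ℤ → ℂ}
    (hb : ∀ n, n ∉ box N → b n = 0) (hc : ∀ n, n ∉ box N → c n = 0) :
    ∑ k ∈ box (2 * N), conv N a b k * starRingEnd ℂ (conv N c d k) =
      ∑ j ∈ box (2 * N), corr N a c j * corr N b d (-j) := by
  have h1 : ∑ k ∈ box (2 * N), conv N a b k * starRingEnd ℂ (conv N c d k) =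
      ∑ n ∈ box N, ∑ l ∈ box N, ∑ m ∈ box N,
        a n * starRingEnd ℂ (c l) * (b m * starRingEnd ℂ (d (m + n - l))) := by
    simp only [conv, map_sum, Finset.sum_mul_sum, map_mul]
    rw [Finset.sum_comm]
    refine Finset.sum_congr rfl fun n hn => ?_
    rw [Finset.sum_comm]
    refine Finset.sum_congr rfl fun l _ => ?_
    rw [← sum_box_sub (s := n) _ hn]
    · refine Finset.sum_congr rfl fun k _ => ?_
      rw [sub_add_cancel]
      ring
    · intro m hm; simp [hb m hm]
  have h2 : ∑ j ∈ box (2 * N), corr N a c j * corr N b d (-j) =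
      ∑ n ∈ box N, ∑ l ∈ box N, ∑ m ∈ box N,
        a n * starRingEnd ℂ (c l) * (b m * starRingEnd ℂ (d (m + n - l))) := by
    simp only [corr, Finset.sum_mul_sum]
    rw [Finset.sum_comm]
    refine Finset.sum_congr rfl fun n hn => ?_
    rw [Finset.sum_comm]
    conv_rhs => rw [Finset.sum_comm]
    refine Finset.sum_congr rfl fun m _ => ?_
    rw [← sum_box_sub_left (s := n) _ hn]
    · refine Finset.sum_congr rfl fun j _ => ?_
      rw [show m + n - (n - j) = m - -j by ring]
    · intro l hl; simp [hc l hl]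
  rw [h1, h2]

/-- The momentum density `Re (ȳ · (-i ∂ₓ y))` on the Fourier side. -/
def momentum (N : ℕ) (a : ℤ → ℂ) (j : ℤ) : ℂ :=
  (corr N (deriv1 a) a j + corr N a (deriv1 a) j) / 2

/-- The cubic expression `ȳ · (-i ∂ₓ)(y²)` on the Fourier side. -/
def cubic (N : ℕ) (a : ℤ → ℂ) (m : ℤ) : ℂ :=
  ∑ n ∈ box N, ((m : ℂ) + n) * conv N a a (m + n) * starRingEnd ℂ (a n)

/-- The momentum density of a product is `J(AB) = J(A) |B|² + |A|² J(B)`, integrated over the torus.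
To get the symmetric `J`, the factor `k` is put half on the convolution and half on its conjugate.
The derivative of the rough `a` then appears only in its momentum density, paired with `|B|²`. -/
theorem sum_mul_sq_conv {a b : ℤ → ℂ} (ha : ∀ n, n ∉ box N → a n = 0)
    (hb : ∀ n, n ∉ box N → b n = 0) :
    ((∑ k ∈ box (2 * N), (k : ℝ) * ‖conv N a b k‖ ^ 2 : ℝ) : ℂ) =
      ∑ j ∈ box (2 * N), momentum N a j * corr N b b (-j) +
      ∑ j ∈ box (2 * N), corr N a a j * momentum N b (-j) := by
  have h1 : ∑ k ∈ box (2 * N), ((k : ℂ) * conv N a b k) * starRingEnd ℂ (conv N a b k) =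
      ∑ j ∈ box (2 * N), corr N (deriv1 a) a j * corr N b b (-j) +
      ∑ j ∈ box (2 * N), corr N a a j * corr N (deriv1 b) b (-j) := by
    simp only [mul_conv, add_mul, Finset.sum_add_distrib]
    rw [sum_conv_mul_conj_conv hb ha, sum_conv_mul_conj_conv (deriv1_support hb) ha]
  have h2 : ∑ k ∈ box (2 * N), conv N a b k * starRingEnd ℂ ((k : ℂ) * conv N a b k) =
      ∑ j ∈ box (2 * N), corr N a (deriv1 a) j * corr N b b (-j) +
      ∑ j ∈ box (2 * N), corr N a a j * corr N b (deriv1 b) (-j) := by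
    simp only [mul_conv, map_add, mul_add, Finset.sum_add_distrib]
    rw [sum_conv_mul_conj_conv hb (deriv1_support ha), sum_conv_mul_conj_conv hb ha]
  have h3 : ((∑ k ∈ box (2 * N), (k : ℝ) * ‖conv N a b k‖ ^ 2 : ℝ) : ℂ) =
      (∑ k ∈ box (2 * N), ((k : ℂ) * conv N a b k) * starRingEnd ℂ (conv N a b k) +
        ∑ k ∈ box (2 * N), conv N a b k * starRingEnd ℂ ((k : ℂ) * conv N a b k)) / 2 := by
    rw [← Finset.sum_add_distrib, Finset.sum_div]
    push_cast
    refine Finset.sum_congr rfl fun k _ => ?_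
    rw [← Complex.mul_conj']
    simp only [map_mul, map_intCast]
    ring
  rw [h3, h1, h2]
  simp only [momentum, ← Finset.sum_add_distrib, Finset.sum_div]
  refine Finset.sum_congr rfl fun j _ => ?_
  ring

/-- The term linear in `b`: in `∫ (-i ∂ₓ)(A²) conj(A B)` the factor `conj(A)` is moved to the first
function, which leaves the cubic expression tested against `b`. -/
theorem sum_mul_conv_self_mul_conj_conv {a b : ℤ → ℂ} (hb : ∀ n, n ∉ box N → b n = 0) :
    ∑ k ∈ box (2 * N), (k : ℂ) * conv N a a k * starRingEnd ℂ (conv N a b k) =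
      ∑ m ∈ box N, cubic N a m * starRingEnd ℂ (b m) := by
  conv_lhs => enter [2, k, 2, 2]; rw [conv]
  simp only [map_sum, Finset.mul_sum, cubic, Finset.sum_mul, map_mul]
  rw [Finset.sum_comm]
  conv_rhs => rw [Finset.sum_comm]
  refine Finset.sum_congr rfl fun n hn => ?_
  rw [← sum_box_sub (s := n) _ hn]
  · refine Finset.sum_congr rfl fun k _ => ?_
    rw [sub_add_cancel]
    push_cast
    ring
  · intro m hm; simp [hb m hm]

theorem corr_self_neg {a : ℤ → ℂ} (ha : ∀ n, n ∉ box N → a n = 0) (j : ℤ) :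
    corr N a a (-j) = starRingEnd ℂ (corr N a a j) := by
  simp only [corr, map_sum, map_mul, Complex.conj_conj]
  have h : ∀ s : ℤ, ∑ n ∈ box N, starRingEnd ℂ (a (n - s)) * a n =
      ∑ n ∈ box N, starRingEnd ℂ (a n) * a (n + s) := by
    intro s
    refine Finset.sum_bij_ne_zero (fun n _ _ => n - s) ?_ ?_ ?_ ?_
    · intro n _ hne
      exact by_contra fun hh => hne (by simp [ha _ hh])
    · intro x _ _ y _ _ h; simpa using h
    · intro n _ hn
      refine ⟨n + s, by_contra fun hh => hn (by simp [ha _ hh]), by simpa using hn, by simp⟩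
    · intro n _ _; simp
  have hj := h (-j)
  simp only [← sub_eq_add_neg] at hj
  rw [← hj]
  exact Finset.sum_congr rfl fun n _ => mul_comm _ _

/-- Both sides are `∫ |A|⁴`, computed from `|A|²` and from `A²`. -/
theorem sum_sq_corr_self {a : ℤ → ℂ} (ha : ∀ n, n ∉ box N → a n = 0) :
    ∑ j ∈ box (2 * N), ‖corr N a a j‖ ^ 2 = ∑ k ∈ box (2 * N), ‖conv N a a k‖ ^ 2 := by
  have h := sum_conv_mul_conj_conv (a := a) (d := a) ha ha
  simp only [corr_self_neg ha, Complex.mul_conj'] at h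
  exact_mod_cast h.symm

end Sequences

/-! ### Deterministic bounds for the energy of a sum -/

section Deterministic

/-- The `ℓ¹` norm of the Fourier coefficients. -/
def wienerNorm (N : ℕ) (a : ℤ → ℂ) : ℝ := ∑ n ∈ box N, ‖a n‖

/-- The square of the `L²` norm. -/
def mass (N : ℕ) (a : ℤ → ℂ) : ℝ := ∑ n ∈ box N, ‖a n‖ ^ 2

/-- The square of the `H¹` norm. -/
def sobolevSq (N : ℕ) (a : ℤ → ℂ) : ℝ := ∑ n ∈ box N, (bracket n * ‖a n‖) ^ 2

variable {N : ℕ}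

theorem mass_nonneg (a : ℤ → ℂ) : 0 ≤ mass N a := Finset.sum_nonneg fun _ _ => sq_nonneg _

theorem sobolevSq_nonneg (a : ℤ → ℂ) : 0 ≤ sobolevSq N a :=
  Finset.sum_nonneg fun _ _ => sq_nonneg _

theorem wienerNorm_nonneg (a : ℤ → ℂ) : 0 ≤ wienerNorm N a :=
  Finset.sum_nonneg fun _ _ => norm_nonneg _

theorem bracket_sq (n : ℤ) : bracket n ^ 2 = 1 + (n : ℝ) ^ 2 := Real.sq_sqrt (by positivity)

theorem abs_le_bracket (n : ℤ) : |(n : ℝ)| ≤ bracket n :=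
  Real.abs_le_sqrt (by linarith)

theorem one_le_bracket (n : ℤ) : 1 ≤ bracket n := by
  rw [bracket, Real.one_le_sqrt]; nlinarith [sq_nonneg (n : ℝ)]

theorem bracket_neg (n : ℤ) : bracket (-n) = bracket n := by simp [bracket]

theorem bracket_le_add (m n : ℤ) : bracket (m + n) ≤ bracket m + bracket n := by
  refine Real.sqrt_le_iff.mpr ⟨by linarith [bracket_pos m, bracket_pos n], ?_⟩
  have h : |(m : ℝ)| * |(n : ℝ)| ≤ bracket m * bracket n :=
    mul_le_mul (abs_le_bracket m) (abs_le_bracket n) (abs_nonneg _) (bracket_pos m).le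
  rw [← abs_mul] at h
  push_cast
  nlinarith [le_abs_self ((m : ℝ) * n), bracket_sq m, bracket_sq n]

theorem mass_le_sobolevSq (a : ℤ → ℂ) : mass N a ≤ sobolevSq N a := by
  refine Finset.sum_le_sum fun n _ => ?_
  gcongr
  exact le_mul_of_one_le_left (norm_nonneg _) (one_le_bracket n)

theorem box_succ (N : ℕ) : box (N + 1) =
    insert ((N : ℤ) + 1) (insert (-((N : ℤ) + 1)) (box N)) := by
  ext n
  simp only [Finset.mem_insert, mem_box]
  push_cast
  omega

theorem sum_inv_sq_add_sq_le {A : ℝ} (hA : 1 ≤ A) (N : ℕ) :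
    ∑ n ∈ box N, (A ^ 2 + (n : ℝ) ^ 2)⁻¹ ≤ 5 / A := by
  have hA0 : 0 < A := by linarith
  -- Strengthened for induction. Passing to `N + 1` adds two equal terms, each at most `2 / (A + N)
  -- - 2 / (A + N + 1)`, since `(A + N)(A + N + 1) ≤ 2 (A² + (N + 1)²)`.
  have h : ∑ n ∈ box N, (A ^ 2 + (n : ℝ) ^ 2)⁻¹ ≤ 5 / A - 4 / (A + N) := by
    induction N with
    | zero =>
      have : box 0 = {0} := by ext n; simp only [mem_box, Finset.mem_singleton]; push_cast; omega
      rw [this, Finset.sum_singleton]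
      have e : 5 / A - 4 / (A + (0 : ℕ)) = A⁻¹ := by push_cast; field_simp; ring
      rw [e]
      refine inv_anti₀ hA0 ?_
      push_cast
      nlinarith
    | succ N ih =>
      rw [box_succ, Finset.sum_insert, Finset.sum_insert]
      · have hN : (0 : ℝ) ≤ N := Nat.cast_nonneg _
        have h1 : (A ^ 2 + ((N : ℝ) + 1) ^ 2)⁻¹ ≤ 2 / (A + N) - 2 / (A + (N + 1)) := by
          have e : 2 / (A + N) - 2 / (A + (N + 1)) = (((A + N) * (A + (N + 1))) / 2)⁻¹ := by
            field_simp
            ring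
          rw [e]
          refine inv_anti₀ (by positivity) ?_
          nlinarith [sq_nonneg (A - (N + 1))]
        push_cast
        rw [neg_sq]
        have e4 : 4 / (A + (N : ℝ)) = 2 / (A + N) + 2 / (A + N) := by ring
        have e5 : 4 / (A + ((N : ℝ) + 1)) = 2 / (A + (N + 1)) + 2 / (A + (N + 1)) := by ring
        linarith
      · rw [mem_box]; omega
      · rw [Finset.mem_insert, mem_box]; omega
  have : 0 ≤ 4 / (A + N) := by positivity
  linarith

/-- The Gagliardo–Nirenberg type inequality `‖a‖₁² ≤ 10 ‖a‖_{L²} ‖a‖_{H¹}`. -/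
theorem wienerNorm_sq_le (a : ℤ → ℂ) :
    wienerNorm N a ^ 2 ≤ 10 * (Real.sqrt (mass N a) * Real.sqrt (sobolevSq N a)) := by
  have hm := mass_nonneg (N := N) a
  have hms := mass_le_sobolevSq (N := N) a
  rcases hm.eq_or_lt with h0 | hpos
  · have hz : ∀ n ∈ box N, ‖a n‖ ^ 2 = 0 :=
      (Finset.sum_eq_zero_iff_of_nonneg fun _ _ => sq_nonneg _).mp h0.symm
    have : wienerNorm N a = 0 := Finset.sum_eq_zero fun n hn => by simpa using hz n hn
    rw [this]
    simp only [ne_eq, OfNat.ofNat_ne_zero, not_false_eq_true, zero_pow]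
    positivity
  set h := Real.sqrt (mass N a)
  set X := Real.sqrt (sobolevSq N a)
  have hh : 0 < h := Real.sqrt_pos.mpr hpos
  have hhX : h ≤ X := Real.sqrt_le_sqrt hms
  have hX : 0 < X := hh.trans_le hhX
  -- This choice balances the two contributions `A² h²` and `X²` after Cauchy–Schwarz with weight
  -- `A² + n²`.
  set A := X / h with hA
  have hA1 : 1 ≤ A := (one_le_div hh).mpr hhX
  have hcs : wienerNorm N a ^ 2 ≤ (∑ n ∈ box N, (A ^ 2 + (n : ℝ) ^ 2)⁻¹) *
      ∑ n ∈ box N, (A ^ 2 + (n : ℝ) ^ 2) * ‖a n‖ ^ 2 := by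
    refine Finset.sum_sq_le_sum_mul_sum_of_sq_le_mul _ (fun n _ => by positivity)
      (fun n _ => by positivity) fun n _ => le_of_eq ?_
    have : A ^ 2 + (n : ℝ) ^ 2 ≠ 0 := by positivity
    field_simp
  have h2 : ∑ n ∈ box N, (A ^ 2 + (n : ℝ) ^ 2) * ‖a n‖ ^ 2 ≤ A ^ 2 * h ^ 2 + X ^ 2 := by
    rw [Real.sq_sqrt hm, Real.sq_sqrt (sobolevSq_nonneg a), mass, sobolevSq, Finset.mul_sum,
      ← Finset.sum_add_distrib]
    refine Finset.sum_le_sum fun n _ => ?_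
    rw [mul_pow, bracket_sq]
    nlinarith [sq_nonneg ‖a n‖]
  calc wienerNorm N a ^ 2 ≤ 5 / A * (A ^ 2 * h ^ 2 + X ^ 2) :=
        hcs.trans (mul_le_mul (sum_inv_sq_add_sq_le hA1 N) h2
          (Finset.sum_nonneg fun n _ => by positivity) (by positivity))
    _ = 10 * (h * X) := by rw [hA]; field_simp; ring

variable {a b : ℤ → ℂ}

theorem sum_sq_conv_le (hb : ∀ n, n ∉ box N → b n = 0) :
    ∑ k ∈ box (2 * N), ‖conv N a b k‖ ^ 2 ≤ wienerNorm N a ^ 2 * mass N b := by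
  refine le_trans (Finset.sum_le_sum fun k _ => ?_)
    (young_le (p := fun n => ‖a n‖) (q := fun n => ‖b n‖) (fun n => norm_nonneg _)
      fun n hn => by simp [hb n hn])
  gcongr
  refine (norm_sum_le _ _).trans (le_of_eq ?_)
  simp

/-- The weight falls on one of the two factors; Young's inequality takes that factor in `ℓ²` and the
other in `ℓ¹`. Two sequences `p`, `r` are allowed so that correlations, which are convolutions with
a reflected sequence, are covered too. -/
theorem sum_sq_weighted_le {p r : ℤ → ℝ} (hp : ∀ n, 0 ≤ p n) (hr : ∀ n, 0 ≤ r n)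
    (hp0 : ∀ n, n ∉ box N → p n = 0) (hr0 : ∀ n, n ∉ box N → r n = 0) {l X : ℝ}
    (hpl : ∑ n ∈ box N, p n = l) (hrl : ∑ n ∈ box N, r n = l)
    (hpX : ∑ n ∈ box N, (bracket n * p n) ^ 2 = X ^ 2)
    (hrX : ∑ n ∈ box N, (bracket n * r n) ^ 2 = X ^ 2) :
    ∑ k ∈ box (2 * N), (∑ n ∈ box N, (bracket n + bracket (k - n)) * (p n * r (k - n))) ^ 2 ≤
      (2 * (l * X)) ^ 2 := by
  have h1 : ∀ k, ∑ n ∈ box N, (bracket n + bracket (k - n)) * (p n * r (k - n)) =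
      ∑ n ∈ box N, r n * (bracket (k - n) * p (k - n)) +
      ∑ n ∈ box N, p n * (bracket (k - n) * r (k - n)) := by
    intro k
    have h := sum_box_reflect (N := N) (φ := fun n => r n * (bracket (k - n) * p (k - n))) k
      (fun n hn => by simp [hp0 _ hn]) (fun n hn => by simp [hr0 _ hn])
    simp only [sub_sub_cancel] at h
    rw [← h, ← Finset.sum_add_distrib]
    exact Finset.sum_congr rfl fun n _ => by ring
  have h2 := young_le (N := N) (p := p) (q := fun n => bracket n * r n) hp
    fun n hn => by simp [hr0 n hn]
  have h3 := young_le (N := N) (p := r) (q := fun n => bracket n * p n) hr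
    fun n hn => by simp [hp0 n hn]
  rw [hpl, hrX] at h2
  rw [hrl, hpX] at h3
  calc _ ≤ ∑ k ∈ box (2 * N), (2 * (∑ n ∈ box N, p n * (bracket (k - n) * r (k - n))) ^ 2 +
          2 * (∑ n ∈ box N, r n * (bracket (k - n) * p (k - n))) ^ 2) := by
        refine Finset.sum_le_sum fun k _ => ?_
        rw [h1]
        nlinarith [sq_nonneg (∑ n ∈ box N, p n * (bracket (k - n) * r (k - n)) -
          ∑ n ∈ box N, r n * (bracket (k - n) * p (k - n)))]
    _ ≤ _ := by
        rw [Finset.sum_add_distrib, ← Finset.mul_sum, ← Finset.mul_sum]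
        linarith

theorem sum_sq_mul_conv_self_le (hb : ∀ n, n ∉ box N → b n = 0) :
    ∑ k ∈ box (2 * N), (|(k : ℝ)| * ‖conv N b b k‖) ^ 2 ≤
      (2 * (wienerNorm N b * Real.sqrt (sobolevSq N b))) ^ 2 := by
  refine le_trans (Finset.sum_le_sum fun k _ => ?_)
    (sum_sq_weighted_le (p := fun n => ‖b n‖) (r := fun n => ‖b n‖) (fun _ => norm_nonneg _)
      (fun _ => norm_nonneg _) (fun n hn => by simp [hb n hn]) (fun n hn => by simp [hb n hn])
      rfl rfl (Real.sq_sqrt (sobolevSq_nonneg b)).symm (Real.sq_sqrt (sobolevSq_nonneg b)).symm)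
  gcongr
  have hk : |(k : ℝ)| = ‖(k : ℂ)‖ := by simp
  rw [hk, ← norm_mul, conv, Finset.mul_sum]
  refine (norm_sum_le _ _).trans (Finset.sum_le_sum fun n _ => ?_)
  rw [norm_mul, norm_mul]
  gcongr
  rw [← hk]
  refine (abs_le_bracket k).trans ?_
  simpa using bracket_le_add n (k - n)

/-- Correlation with `b` is convolution with the reflected sequence, and reflection changes neither
the `ℓ¹` nor the `H¹` norm. It serves both the `H¹` norm of `|b|²` and the `L²` norm of the momentum
density of `b`. -/
theorem sum_sq_le_of_le_weighted_corr (hb : ∀ n, n ∉ box N → b n = 0) {f : ℤ → ℝ}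
    (hf0 : ∀ j, 0 ≤ f j)
    (hf : ∀ j, f j ≤ ∑ n ∈ box N, (bracket n + bracket (n - j)) * (‖b n‖ * ‖b (n - j)‖)) :
    ∑ j ∈ box (2 * N), f j ^ 2 ≤ (2 * (wienerNorm N b * Real.sqrt (sobolevSq N b))) ^ 2 := by
  have hneg : ∀ n, n ∉ box N → -n ∉ box N := fun n hn h => hn (by rw [mem_box] at *; omega)
  refine le_trans (Finset.sum_le_sum fun j _ => ?_)
    (sum_sq_weighted_le (p := fun n => ‖b n‖) (r := fun n => ‖b (-n)‖) (fun _ => norm_nonneg _)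
      (fun _ => norm_nonneg _) (fun n hn => by simp [hb n hn])
      (fun n hn => by simp [hb _ (hneg n hn)]) rfl (sum_box_neg N fun n => ‖b n‖)
      (Real.sq_sqrt (sobolevSq_nonneg b)).symm ?_)
  · refine pow_le_pow_left₀ (hf0 j) ((hf j).trans (le_of_eq ?_)) 2
    refine Finset.sum_congr rfl fun n _ => ?_
    rw [neg_sub, ← bracket_neg (n - j), neg_sub]
  · rw [Real.sq_sqrt (sobolevSq_nonneg b), sobolevSq,
      ← sum_box_neg N fun n => (bracket n * ‖b n‖) ^ 2]
    simp only [bracket_neg]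

theorem sum_sq_bracket_corr_self_le (hb : ∀ n, n ∉ box N → b n = 0) :
    ∑ j ∈ box (2 * N), (bracket j * ‖corr N b b (-j)‖) ^ 2 ≤
      (2 * (wienerNorm N b * Real.sqrt (sobolevSq N b))) ^ 2 := by
  simp only [corr_self_neg hb, RCLike.norm_conj]
  refine sum_sq_le_of_le_weighted_corr hb
    (fun j => mul_nonneg (bracket_pos j).le (norm_nonneg _)) fun j => ?_
  have h : ‖corr N b b j‖ ≤ ∑ n ∈ box N, ‖b n‖ * ‖b (n - j)‖ :=
    (norm_sum_le _ _).trans (le_of_eq (by simp))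
  refine (mul_le_mul_of_nonneg_left h (bracket_pos j).le).trans ?_
  rw [Finset.mul_sum]
  refine Finset.sum_le_sum fun n _ => ?_
  gcongr
  have := bracket_le_add n (-(n - j))
  rw [bracket_neg] at this
  simpa using this

theorem sum_sq_momentum_le (hb : ∀ n, n ∉ box N → b n = 0) :
    ∑ j ∈ box (2 * N), ‖momentum N b (-j)‖ ^ 2 ≤
      (wienerNorm N b * Real.sqrt (sobolevSq N b)) ^ 2 := by
  rw [sum_box_neg (2 * N) fun j => ‖momentum N b j‖ ^ 2]
  have h := sum_sq_le_of_le_weighted_corr (f := fun j => 2 * ‖momentum N b j‖) hb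
    (fun j => by positivity) fun j => ?_
  · simp only [mul_pow, ← Finset.mul_sum] at h ⊢
    linarith
  · have e : 2 * ‖momentum N b j‖ = ‖corr N (deriv1 b) b j + corr N b (deriv1 b) j‖ := by
      rw [momentum, norm_div, Complex.norm_ofNat]; ring
    rw [e, corr, corr, ← Finset.sum_add_distrib]
    refine (norm_sum_le _ _).trans (Finset.sum_le_sum fun n _ => ?_)
    simp only [deriv1]
    refine (norm_add_le _ _).trans ?_
    simp only [norm_mul, map_mul, RCLike.norm_conj, Complex.norm_intCast]
    have h1 := mul_le_mul_of_nonneg_right (abs_le_bracket n)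
      (mul_nonneg (norm_nonneg (b n)) (norm_nonneg (b (n - j))))
    have h2 := mul_le_mul_of_nonneg_right (abs_le_bracket (n - j))
      (mul_nonneg (norm_nonneg (b n)) (norm_nonneg (b (n - j))))
    nlinarith

/-- The square of the `H⁻¹` norm of the momentum density. -/
def momentumSq (N : ℕ) (a : ℤ → ℂ) : ℝ :=
  ∑ j ∈ box (2 * N), ((bracket j)⁻¹ * ‖momentum N a j‖) ^ 2

/-- The square of the `H⁻¹` norm of the cubic term. -/
def cubicSq (N : ℕ) (a : ℤ → ℂ) : ℝ :=
  ∑ m ∈ box N, ((bracket m)⁻¹ * ‖cubic N a m‖) ^ 2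

/-- The square of the `L²` norm of the square. -/
def squareSq (N : ℕ) (a : ℤ → ℂ) : ℝ := ∑ k ∈ box (2 * N), ‖conv N a a k‖ ^ 2

theorem momentumSq_nonneg (a : ℤ → ℂ) : 0 ≤ momentumSq N a :=
  Finset.sum_nonneg fun _ _ => sq_nonneg _

theorem cubicSq_nonneg (a : ℤ → ℂ) : 0 ≤ cubicSq N a :=
  Finset.sum_nonneg fun _ _ => sq_nonneg _

theorem squareSq_nonneg (a : ℤ → ℂ) : 0 ≤ squareSq N a :=
  Finset.sum_nonneg fun _ _ => sq_nonneg _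

theorem norm_add_two_mul_add_sq (z w u : ℂ) :
    ‖z + 2 * w + u‖ ^ 2 = ‖z‖ ^ 2 + 4 * ‖w‖ ^ 2 + ‖u‖ ^ 2 + 4 * (z * starRingEnd ℂ w).re +
      2 * (z * starRingEnd ℂ u).re + 4 * (w * starRingEnd ℂ u).re := by
  simp only [Complex.sq_norm, Complex.normSq_apply, Complex.add_re, Complex.add_im,
    Complex.mul_re, Complex.mul_im, Complex.conj_re, Complex.conj_im, Complex.re_ofNat,
    Complex.im_ofNat]
  ring

/-- The energy of `a + b`, for `b` in `H¹`. -/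
theorem energy_add_le (ha : ∀ n, n ∉ box N → a n = 0) (hb : ∀ n, n ∉ box N → b n = 0) :
    energy N (fun n => a n + b n) ≤ energy N a +
      wienerNorm N b * Real.sqrt (sobolevSq N b) *
        (8 * Real.sqrt (momentumSq N a) + 8 * Real.sqrt (squareSq N a)) +
      wienerNorm N b ^ 2 * Real.sqrt (sobolevSq N b) *
        (2 * Real.sqrt (mass N b) + 8 * Real.sqrt (mass N a)) +
      4 * Real.sqrt (cubicSq N a) * Real.sqrt (sobolevSq N b) := by
  set l := wienerNorm N b
  set X := Real.sqrt (sobolevSq N b)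
  have hl : 0 ≤ l := wienerNorm_nonneg b
  have hX : 0 ≤ X := Real.sqrt_nonneg _
  have hkb : ∑ k ∈ box (2 * N), (|(k : ℝ)| * ‖conv N b b k‖) ^ 2 ≤ (2 * (l * X)) ^ 2 :=
    sum_sq_mul_conv_self_le hb
  -- Expansion of `|A² + 2AB + B²|²` mode by mode. The five terms containing `b` are treated
  -- separately, always so that no derivative of `a` is measured in a norm stronger than `H⁻¹`.
  have hexp : energy N (fun n => a n + b n) = energy N a +
      4 * ∑ k ∈ box (2 * N), (k : ℝ) * ‖conv N a b k‖ ^ 2 +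
      ∑ k ∈ box (2 * N), (k : ℝ) * ‖conv N b b k‖ ^ 2 +
      4 * ∑ k ∈ box (2 * N), (k : ℝ) * (conv N a a k * starRingEnd ℂ (conv N a b k)).re +
      2 * ∑ k ∈ box (2 * N), (k : ℝ) * (conv N a a k * starRingEnd ℂ (conv N b b k)).re +
      4 * ∑ k ∈ box (2 * N), (k : ℝ) * (conv N a b k * starRingEnd ℂ (conv N b b k)).re := by
    simp only [energy, Finset.mul_sum, ← Finset.sum_add_distrib]
    refine Finset.sum_congr rfl fun k _ => ?_
    rw [conv_add_self ha hb, norm_add_two_mul_add_sq]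
    ring
  -- Two `H⁻¹`–`H¹` and `L²`–`L²` pairings: the momentum of `a` against `|b|²`, and `|a|²` against
  -- the momentum of `b`.
  have t1 : ∑ k ∈ box (2 * N), (k : ℝ) * ‖conv N a b k‖ ^ 2 ≤
      Real.sqrt (momentumSq N a) * (2 * (l * X)) + Real.sqrt (squareSq N a) * (l * X) := by
    have h := sum_mul_sq_conv ha hb
    have h1 : ∑ k ∈ box (2 * N), (k : ℝ) * ‖conv N a b k‖ ^ 2 ≤
        ‖((∑ k ∈ box (2 * N), (k : ℝ) * ‖conv N a b k‖ ^ 2 : ℝ) : ℂ)‖ := by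
      rw [Complex.norm_real]; exact le_abs_self _
    refine h1.trans ?_
    rw [h]
    refine (norm_add_le _ _).trans (add_le_add ?_ ?_)
    · refine (norm_sum_le _ _).trans ?_
      refine le_trans (le_of_eq (Finset.sum_congr rfl fun j _ => ?_)) (sum_mul_le_of_sq_le
        (f := fun j => (bracket j)⁻¹ * ‖momentum N a j‖)
        (g := fun j => bracket j * ‖corr N b b (-j)‖) (Real.sqrt_nonneg _) (by positivity)
        (Real.sq_sqrt (momentumSq_nonneg a)).symm.le (sum_sq_bracket_corr_self_le hb))
      have := (bracket_pos j).ne'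
      rw [norm_mul]
      field_simp
    · refine (norm_sum_le _ _).trans ?_
      simp only [norm_mul]
      refine sum_mul_le_of_sq_le (Real.sqrt_nonneg _) (by positivity) ?_ (sum_sq_momentum_le hb)
      rw [Real.sq_sqrt (squareSq_nonneg a), sum_sq_corr_self ha]
      exact le_rfl
  have t2 : ∑ k ∈ box (2 * N), (k : ℝ) * ‖conv N b b k‖ ^ 2 ≤
      2 * (l * X) * (l * Real.sqrt (mass N b)) := by
    refine le_trans (Finset.sum_le_sum fun k _ => ?_) (sum_mul_le_of_sq_le
      (g := fun k => ‖conv N b b k‖) (by positivity) (by positivity) hkb ?_)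
    · rw [sq, ← mul_assoc]
      gcongr
      exact le_abs_self _
    · rw [mul_pow, Real.sq_sqrt (mass_nonneg b)]
      exact sum_sq_conv_le hb
  -- Duality between `H⁻¹` and `H¹`, after the cubic expression in `a` has been isolated.
  have t3 : ∑ k ∈ box (2 * N), (k : ℝ) * (conv N a a k * starRingEnd ℂ (conv N a b k)).re ≤
      Real.sqrt (cubicSq N a) * X := by
    have h := congrArg Complex.re (sum_mul_conv_self_mul_conj_conv (N := N) (a := a) hb)
    have e : ∑ k ∈ box (2 * N), (k : ℝ) * (conv N a a k * starRingEnd ℂ (conv N a b k)).re =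
        (∑ k ∈ box (2 * N), (k : ℂ) * conv N a a k * starRingEnd ℂ (conv N a b k)).re := by
      rw [Complex.re_sum]
      refine Finset.sum_congr rfl fun k _ => ?_
      rw [mul_assoc, ← Complex.ofReal_intCast, Complex.re_ofReal_mul]
    rw [e, h]
    refine (Complex.re_le_norm _).trans ((norm_sum_le _ _).trans ?_)
    refine le_trans (le_of_eq (Finset.sum_congr rfl fun m _ => ?_)) (sum_mul_le_of_sq_le
        (f := fun m => (bracket m)⁻¹ * ‖cubic N a m‖)
        (g := fun m => bracket m * ‖b m‖) (Real.sqrt_nonneg _) hX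
        (Real.sq_sqrt (cubicSq_nonneg a)).symm.le (Real.sq_sqrt (sobolevSq_nonneg b)).symm.le)
    have := (bracket_pos m).ne'
    rw [norm_mul, RCLike.norm_conj]
    field_simp
  -- When the second factor is `B²`, the multiplier `k` is put on it, so any `L²` bound for the
  -- first factor suffices. It is applied with `A²` and with `A B`.
  have cross : ∀ (z : ℤ → ℂ) (B : ℝ), 0 ≤ B → ∑ k ∈ box (2 * N), ‖z k‖ ^ 2 ≤ B ^ 2 →
      ∑ k ∈ box (2 * N), (k : ℝ) * (z k * starRingEnd ℂ (conv N b b k)).re ≤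
        B * (2 * (l * X)) := by
    intro z B hB hz
    refine le_trans (Finset.sum_le_sum fun k _ => ?_)
      (sum_mul_le_of_sq_le (f := fun k => ‖z k‖) hB (by positivity) hz hkb)
    refine (le_abs_self _).trans ?_
    rw [abs_mul, mul_left_comm]
    gcongr
    refine (Complex.abs_re_le_norm _).trans (le_of_eq ?_)
    simp
  have t4 := cross (conv N a a) (Real.sqrt (squareSq N a)) (Real.sqrt_nonneg _)
    (Real.sq_sqrt (squareSq_nonneg a)).symm.le
  have t5 := cross (conv N a b) (l * Real.sqrt (mass N a)) (by positivity) (by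
    rw [mul_pow, Real.sq_sqrt (mass_nonneg a)]
    simp only [conv_comm ha hb]
    exact sum_sq_conv_le ha)
  rw [hexp]
  nlinarith [t1, t2, t3, t4, t5]

/-- The part of the cubic term without pairings of frequencies. -/
def cubicNonres (N : ℕ) (a : ℤ → ℂ) (m : ℤ) : ℂ :=
  ∑ n ∈ box N, ∑ l ∈ box N, if l ≠ n ∧ l ≠ m then
    ((m : ℂ) + n) * (a l * a (m + n - l) * starRingEnd ℂ (a n)) else 0

theorem momentum_zero (a : ℤ → ℂ) :
    momentum N a 0 = ∑ n ∈ box N, (n : ℂ) * (‖a n‖ : ℂ) ^ 2 := by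
  simp only [momentum, corr, deriv1, ← Finset.sum_add_distrib, Finset.sum_div]
  refine Finset.sum_congr rfl fun n _ => ?_
  rw [← Complex.mul_conj']
  simp
  ring

/-- In `a(l) a(m + n - l) conj(a(n))` a pairing occurs when `l = n` or `l = m`. Each produces `(m +
n) |a(n)|² a(m)`, and the overlap `l = n = m` is counted twice. Only the remaining sum is suitable
for an orthogonality argument. -/
theorem cubic_eq (a : ℤ → ℂ) {m : ℤ} (hm : m ∈ box N) :
    cubic N a m = cubicNonres N a m +
      (2 * a m * (m * (mass N a : ℂ) + momentum N a 0) - 2 * m * (‖a m‖ : ℂ) ^ 2 * a m) := by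
  let t : ℤ → ℤ → ℂ := fun n l => ((m : ℂ) + n) * (a l * a (m + n - l) * starRingEnd ℂ (a n))
  have h1 : cubic N a m = ∑ n ∈ box N, ∑ l ∈ box N, t n l := by
    simp only [cubic, conv, t, Finset.mul_sum, Finset.sum_mul]
    refine Finset.sum_congr rfl fun n _ => Finset.sum_congr rfl fun l _ => ?_
    ring
  have h2 : ∀ n ∈ box N, ∑ l ∈ box N, t n l = (∑ l ∈ box N, if l ≠ n ∧ l ≠ m then t n l else 0) +
      (2 * a m * ((m + n) * (‖a n‖ : ℂ) ^ 2) -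
        if n = m then 2 * m * (‖a m‖ : ℂ) ^ 2 * a m else 0) := by
    intro n hn
    -- Inclusion–exclusion over the two pairings `l = n` and `l = m`.
    have e : ∀ l, t n l = (if l ≠ n ∧ l ≠ m then t n l else 0) +
        ((if l = n then t n n else 0) + (if l = m then t n m else 0) -
          if l = m then (if n = m then t m m else 0) else 0) := by
      intro l
      by_cases h1 : l = n <;> by_cases h2 : l = m <;> by_cases h3 : n = m <;> simp_all
    rw [Finset.sum_congr rfl fun l _ => e l, Finset.sum_add_distrib, Finset.sum_sub_distrib,
      Finset.sum_add_distrib, Finset.sum_ite_eq' _ n, Finset.sum_ite_eq' _ m,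
      Finset.sum_ite_eq' _ m, if_pos hn, if_pos hm, if_pos hm]
    congr 2
    · simp only [t, add_sub_cancel_left, add_sub_cancel_right, ← Complex.mul_conj']
      ring
    · split_ifs with h
      · simp only [t, add_sub_cancel_left, ← Complex.mul_conj']
        ring
      · rfl
  rw [h1, Finset.sum_congr rfl h2, Finset.sum_add_distrib, Finset.sum_sub_distrib,
    Finset.sum_ite_eq' _ m, if_pos hm, momentum_zero, mass]
  congr 3
  push_cast
  rw [← Finset.mul_sum]
  congr 1
  rw [Finset.mul_sum, ← Finset.sum_add_distrib]
  exact Finset.sum_congr rfl fun n _ => by ring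

/-- The square of the `H⁻¹` norm of the non-resonant cubic term. -/
def cubicNonresSq (N : ℕ) (a : ℤ → ℂ) : ℝ :=
  ∑ m ∈ box N, ((bracket m)⁻¹ * ‖cubicNonres N a m‖) ^ 2

/-- The paired part is `a(m)` times a factor of size at most `2 |P| + 4 |m| ρ`, where `P` is the
total momentum and `ρ` the mass. The weight `1/⟨m⟩` absorbs `|m|`, and `|P|²` is the zero mode of
`momentumSq`, where the bracket is `1`. -/
theorem cubicSq_le (a : ℤ → ℂ) : cubicSq N a ≤
    2 * cubicNonresSq N a + 16 * momentumSq N a * mass N a + 64 * mass N a ^ 3 := by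
  set ρ := mass N a
  have hρ : 0 ≤ ρ := mass_nonneg a
  have hP : ‖momentum N a 0‖ ^ 2 ≤ momentumSq N a := by
    have h := Finset.single_le_sum (f := fun j => ((bracket j)⁻¹ * ‖momentum N a j‖) ^ 2)
      (fun _ _ => sq_nonneg _) (show (0 : ℤ) ∈ box (2 * N) by rw [mem_box]; omega)
    refine le_trans (le_of_eq ?_) h
    simp [bracket]
  have hm : ∀ m ∈ box N, ((bracket m)⁻¹ * ‖cubic N a m‖) ^ 2 ≤
      2 * ((bracket m)⁻¹ * ‖cubicNonres N a m‖) ^ 2 +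
        (16 * momentumSq N a + 64 * ρ ^ 2) * ‖a m‖ ^ 2 := by
    intro m hm
    have hb := bracket_pos m
    have ham : ‖a m‖ ^ 2 ≤ ρ :=
      Finset.single_le_sum (f := fun n => ‖a n‖ ^ 2) (fun _ _ => sq_nonneg _) hm
    have hres : ‖2 * a m * (m * (ρ : ℂ) + momentum N a 0) - 2 * m * (‖a m‖ : ℂ) ^ 2 * a m‖ ≤
        (2 * ‖momentum N a 0‖ + 4 * |(m : ℝ)| * ρ) * ‖a m‖ := by
      have hr : ‖(ρ : ℂ)‖ = ρ := by rw [Complex.norm_real, Real.norm_of_nonneg hρ]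
      refine (norm_sub_le _ _).trans ?_
      have h1 : ‖2 * a m * (m * (ρ : ℂ) + momentum N a 0)‖ ≤
          2 * ‖a m‖ * (|(m : ℝ)| * ρ + ‖momentum N a 0‖) := by
        rw [norm_mul, norm_mul, Complex.norm_ofNat]
        gcongr
        refine (norm_add_le _ _).trans (le_of_eq ?_)
        rw [norm_mul, hr, Complex.norm_intCast]
      have h2 : ‖2 * m * (‖a m‖ : ℂ) ^ 2 * a m‖ ≤ 2 * |(m : ℝ)| * ρ * ‖a m‖ := by
        rw [norm_mul, norm_mul, norm_mul, Complex.norm_ofNat, Complex.norm_intCast, norm_pow,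
          Complex.norm_real, norm_norm]
        gcongr
      linarith
    have hsplit : (bracket m)⁻¹ * ‖cubic N a m‖ ≤ (bracket m)⁻¹ * ‖cubicNonres N a m‖ +
        (2 * ‖momentum N a 0‖ + 4 * ρ) * ‖a m‖ := by
      have h1 : ‖cubic N a m‖ ≤ ‖cubicNonres N a m‖ +
          (2 * ‖momentum N a 0‖ + 4 * |(m : ℝ)| * ρ) * ‖a m‖ := by
        rw [cubic_eq a hm]
        exact (norm_add_le _ _).trans (by gcongr)
      have h2 : 2 * ‖momentum N a 0‖ + 4 * |(m : ℝ)| * ρ ≤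
          bracket m * (2 * ‖momentum N a 0‖ + 4 * ρ) := by
        nlinarith [norm_nonneg (momentum N a 0), one_le_bracket m, abs_le_bracket m]
      calc (bracket m)⁻¹ * ‖cubic N a m‖
          ≤ (bracket m)⁻¹ * (‖cubicNonres N a m‖ +
            bracket m * (2 * ‖momentum N a 0‖ + 4 * ρ) * ‖a m‖) := by
            gcongr
            exact h1.trans (by gcongr)
        _ = _ := by field_simp
    set u := (bracket m)⁻¹ * ‖cubicNonres N a m‖
    set q := ‖momentum N a 0‖
    have hnn : 0 ≤ (bracket m)⁻¹ * ‖cubic N a m‖ := by positivity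
    calc ((bracket m)⁻¹ * ‖cubic N a m‖) ^ 2 ≤ (u + (2 * q + 4 * ρ) * ‖a m‖) ^ 2 := by gcongr
      _ ≤ 2 * u ^ 2 + 2 * ((2 * q + 4 * ρ) ^ 2 * ‖a m‖ ^ 2) := by
          nlinarith [sq_nonneg (u - (2 * q + 4 * ρ) * ‖a m‖)]
      _ ≤ 2 * u ^ 2 + (16 * momentumSq N a + 64 * ρ ^ 2) * ‖a m‖ ^ 2 := by
          have : 2 * (2 * q + 4 * ρ) ^ 2 ≤ 16 * momentumSq N a + 64 * ρ ^ 2 := by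
            nlinarith [sq_nonneg (2 * q - 4 * ρ)]
          nlinarith [sq_nonneg ‖a m‖]
  refine (Finset.sum_le_sum hm).trans (le_of_eq ?_)
  rw [Finset.sum_add_distrib, ← Finset.mul_sum, ← Finset.mul_sum]
  change 2 * cubicNonresSq N a + _ * ρ = _
  ring

/-- If `a` has small mass, nonpositive energy and bounded quadratic and cubic terms, then adding
`b` of small mass costs only a small multiple of the `H¹` norm of `b`. -/
theorem energy_add_le_of_small {δ R : ℝ} (hδ : 0 < δ) (hδ1 : δ ≤ 1)
    (ha : ∀ n, n ∉ box N → a n = 0) (hb : ∀ n, n ∉ box N → b n = 0)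
    (hma : mass N a ≤ δ) (hmb : mass N b ≤ δ) (hE : energy N a ≤ 0)
    (hJ : momentumSq N a ≤ R) (hS : squareSq N a ≤ R) (hC : cubicNonresSq N a ≤ R) :
    energy N (fun n => a n + b n) ≤ 102 * δ * sobolevSq N b +
      (640 * R / δ + 4 * Real.sqrt (18 * R + 64)) ^ 2 / (4 * δ) := by
  have hR : 0 ≤ R := (momentumSq_nonneg a).trans hJ
  have hma0 := mass_nonneg (N := N) a
  have hcub : cubicSq N a ≤ 18 * R + 64 := by
    refine (cubicSq_le a).trans ?_
    have h1 : momentumSq N a * mass N a ≤ R * 1 :=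
      mul_le_mul hJ (hma.trans hδ1) hma0 hR
    have h2 : mass N a ^ 3 ≤ 1 := pow_le_one₀ hma0 (hma.trans hδ1)
    linarith
  have h := energy_add_le ha hb
  have hl2 := wienerNorm_sq_le (N := N) b
  set l := wienerNorm N b
  have hXX := Real.sq_sqrt (sobolevSq_nonneg (N := N) b)
  set X := Real.sqrt (sobolevSq N b)
  set d := Real.sqrt δ with hd
  set r := Real.sqrt R with hr
  have hl : 0 ≤ l := wienerNorm_nonneg b
  have hX : 0 ≤ X := Real.sqrt_nonneg _
  have hd0 : 0 ≤ d := Real.sqrt_nonneg _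
  have hdd : d ^ 2 = δ := Real.sq_sqrt hδ.le
  have hrr : r ^ 2 = R := Real.sq_sqrt hR
  have hd1 : d ≤ 1 := Real.sqrt_le_iff.mpr ⟨zero_le_one, by linarith⟩
  have g1 : Real.sqrt (momentumSq N a) ≤ r := Real.sqrt_le_sqrt hJ
  have g2 : Real.sqrt (squareSq N a) ≤ r := Real.sqrt_le_sqrt hS
  have g3 : Real.sqrt (mass N a) ≤ d := Real.sqrt_le_sqrt hma
  have g4 : Real.sqrt (mass N b) ≤ d := Real.sqrt_le_sqrt hmb
  have g5 : Real.sqrt (cubicSq N a) ≤ Real.sqrt (18 * R + 64) := Real.sqrt_le_sqrt hcub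
  set D := Real.sqrt (18 * R + 64)
  have hl3 : l ^ 2 ≤ 10 * (d * X) := hl2.trans (by gcongr)
  -- Not small by itself: AM–GM with weight `δ` leaves `R / δ` times `l²`, and `l² ≤ 10 X` makes
  -- that only linear in `X`.
  have u1 : l * X * (8 * Real.sqrt (momentumSq N a) + 8 * Real.sqrt (squareSq N a)) ≤
      δ * X ^ 2 + 640 * R / δ * X := by
    have v1 : l * X * (8 * Real.sqrt (momentumSq N a) + 8 * Real.sqrt (squareSq N a)) ≤
        l * X * (16 * r) := by gcongr; linarith
    have v2 : l * X * (16 * r) ≤ δ * X ^ 2 + 64 * R / δ * l ^ 2 := by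
      have e : δ * X ^ 2 + 64 * R / δ * l ^ 2 - l * X * (16 * r) = (δ * X - 8 * r * l) ^ 2 / δ := by
        rw [← hrr]; field_simp; ring
      have : 0 ≤ (δ * X - 8 * r * l) ^ 2 / δ := by positivity
      linarith
    have v3 : 64 * R / δ * l ^ 2 ≤ 64 * R / δ * (10 * X) := by
      gcongr
      refine hl3.trans ?_
      nlinarith
    have e : 64 * R / δ * (10 * X) = 640 * R / δ * X := by ring
    linarith
  -- The critical term, quadratic in `X` with no free constant. Small mass helps twice: once through
  -- `l² ≤ 10 d X`, once through the mass factors, giving `d² = δ`. Together with one `δ X²` from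
  -- each of `u1` and `u4`, this makes `102 δ X²`.
  have u2 : l ^ 2 * X * (2 * Real.sqrt (mass N b) + 8 * Real.sqrt (mass N a)) ≤
      100 * δ * X ^ 2 := by
    calc l ^ 2 * X * (2 * Real.sqrt (mass N b) + 8 * Real.sqrt (mass N a))
        ≤ 10 * (d * X) * X * (10 * d) := by
          gcongr
          linarith
      _ = 100 * d ^ 2 * X ^ 2 := by ring
      _ = _ := by rw [hdd]
  have u3 : 4 * Real.sqrt (cubicSq N a) * X ≤ 4 * D * X := by gcongr
  have u4 : (640 * R / δ + 4 * D) * X ≤ δ * X ^ 2 + (640 * R / δ + 4 * D) ^ 2 / (4 * δ) := by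
    set G := 640 * R / δ + 4 * D
    have e : δ * X ^ 2 + G ^ 2 / (4 * δ) - G * X = (2 * δ * X - G) ^ 2 / (4 * δ) := by
      field_simp; ring
    have : 0 ≤ (2 * δ * X - G) ^ 2 / (4 * δ) := by positivity
    linarith
  rw [← hXX]
  linarith

end Deterministic

/-! ### Independent complex Gaussians and concentration for them -/

section ProductMeasure

theorem measurable_toComplex :
    Measurable fun z : ℝ × ℝ => (z.1 : ℂ) + (z.2 : ℂ) * Complex.I := by fun_prop

/-- On the real and imaginary parts this is `(x, y) ↦ (-y, x)`. It is the symmetry from which most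
of the orthogonality relations are derived. -/
theorem measurePreserving_I_mul :
    MeasurePreserving (fun z : ℂ => Complex.I * z) stdComplexGaussian stdComplexGaussian := by
  refine ⟨by fun_prop, ?_⟩
  set γ : Measure ℝ := gaussianReal 0 (1 / 2)
  have hneg : γ.map (fun x => -x) = γ := by simp [γ, gaussianReal_map_neg]
  have h1 : (γ.prod γ).map (fun z : ℝ × ℝ => (-z.2, z.1)) = γ.prod γ := by
    have e : (fun z : ℝ × ℝ => (-z.2, z.1)) = (Prod.map (fun x => -x) id) ∘ Prod.swap := rfl
    rw [e, ← Measure.map_map (by fun_prop) measurable_swap, Measure.prod_swap]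
    rw [← Measure.map_prod_map _ _ (by fun_prop) measurable_id, hneg, Measure.map_id]
  unfold stdComplexGaussian
  rw [Measure.map_map (by fun_prop) measurable_toComplex]
  have e : (fun z : ℂ => Complex.I * z) ∘ (fun z : ℝ × ℝ => (z.1 : ℂ) + (z.2 : ℂ) * Complex.I) =
      (fun z : ℝ × ℝ => (z.1 : ℂ) + (z.2 : ℂ) * Complex.I) ∘ fun z : ℝ × ℝ => (-z.2, z.1) := by
    ext z
    simp only [Function.comp]
    push_cast
    linear_combination (z.2 : ℂ) * Complex.I_mul_I
  rw [e, ← Measure.map_map measurable_toComplex (by fun_prop), h1]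

/-- Sixth moments are what second moments of cubic monomials require. -/
theorem integrable_norm_pow_stdComplexGaussian :
    Integrable (fun z : ℂ => ‖z‖ ^ 6) stdComplexGaussian := by
  have hm : ∀ k : ℕ, Integrable (fun x : ℝ => x ^ k) (gaussianReal 0 (1 / 2)) := fun k => by
    have := (memLp_id_gaussianReal (μ := 0) (v := 1 / 2) k).integrable_norm_pow'
    refine (integrable_norm_iff (by fun_prop)).mp ?_
    simpa using this
  unfold stdComplexGaussian
  rw [integrable_map_measure (by fun_prop) (by fun_prop)]
  have hi : Integrable (fun z : ℝ × ℝ => 4 * z.1 ^ 6 + 4 * z.2 ^ 6)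
      ((gaussianReal 0 (1 / 2)).prod (gaussianReal 0 (1 / 2))) :=
    (((hm 6).comp_fst _).const_mul 4).add (((hm 6).comp_snd _).const_mul 4)
  refine hi.mono' (by fun_prop) (ae_of_all _ fun z => ?_)
  have e : ‖(z.1 : ℂ) + (z.2 : ℂ) * Complex.I‖ ^ 6 = (z.1 ^ 2 + z.2 ^ 2) ^ 3 := by
    rw [show (6 : ℕ) = 2 * 3 by norm_num, pow_mul, Complex.sq_norm, Complex.normSq_apply]
    simp [pow_two]
  simp only [Function.comp, e, norm_pow, Real.norm_eq_abs]
  rw [abs_of_nonneg (by positivity)]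
  have h1 := sq_nonneg z.1
  have h2 := sq_nonneg z.2
  nlinarith [mul_nonneg (add_nonneg h1 h2) (sq_nonneg (z.1 ^ 2 - z.2 ^ 2))]

theorem charFun_stdComplexGaussian (t : ℂ) :
    charFun stdComplexGaussian t = Complex.exp (-(‖t‖ ^ 2 / 4 : ℝ)) := by
  have h1 : ∀ s : ℝ, ∫ x, Complex.exp (s * x * Complex.I) ∂(gaussianReal 0 (1 / 2)) =
      Complex.exp (-(s ^ 2 / 4 : ℝ)) := by
    intro s
    rw [← charFun_apply_real, charFun_gaussianReal]
    congr 1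
    push_cast
    ring
  rw [charFun_apply, stdComplexGaussian, integral_map (by fun_prop) (by fun_prop)]
  have e : ∀ z : ℝ × ℝ, Complex.exp (inner ℝ ((z.1 : ℂ) + (z.2 : ℂ) * Complex.I) t * Complex.I) =
      Complex.exp (t.re * z.1 * Complex.I) * Complex.exp (t.im * z.2 * Complex.I) := by
    intro z
    rw [← Complex.exp_add]
    congr 1
    rw [Complex.inner]
    simp
    ring
  simp only [e]
  rw [integral_prod_mul (fun x : ℝ => Complex.exp (t.re * x * Complex.I))
    (fun x : ℝ => Complex.exp (t.im * x * Complex.I)), h1, h1, ← Complex.exp_add]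
  congr 1
  rw [Complex.sq_norm, Complex.normSq_apply]
  push_cast
  ring

variable {ι : Type*} [Fintype ι]

/-- The law of finitely many independent complex Gaussians. -/
def gaussPi (ι : Type*) [Fintype ι] : Measure (ι → ℂ) :=
  Measure.pi fun _ : ι => stdComplexGaussian

instance : IsProbabilityMeasure (gaussPi ι) := by unfold gaussPi; infer_instance

/-- The characteristic functions agree. The factor `1/√2` appears because the real and imaginary
parts of a coordinate have variance `1/2` instead of `1`. -/
theorem map_stdGaussian_eq_gaussPi :
    (stdGaussian (EuclideanSpace ℂ ι)).map
      (fun z => (WithLp.ofLp ((Real.sqrt 2)⁻¹ • z) : ι → ℂ)) = gaussPi ι := by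
  have h : (stdGaussian (EuclideanSpace ℂ ι)).map (fun z => (Real.sqrt 2)⁻¹ • z) =
      (gaussPi ι).map (WithLp.toLp 2) := by
    apply Measure.ext_of_charFun (E := EuclideanSpace ℂ ι)
    ext t
    rw [charFun_map_smul, charFun_stdGaussian]
    unfold gaussPi
    rw [charFun_pi]
    simp only [charFun_stdComplexGaussian]
    rw [← Complex.exp_sum]
    congr 1
    rw [norm_smul, ← Complex.ofReal_pow, mul_pow, norm_inv,
      Real.norm_of_nonneg (Real.sqrt_nonneg _), inv_pow,
      Real.sq_sqrt (by norm_num), EuclideanSpace.norm_sq_eq, Finset.sum_neg_distrib]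
    push_cast
    rw [← Finset.sum_div]
    ring
  have e : (fun z : EuclideanSpace ℂ ι => (WithLp.ofLp ((Real.sqrt 2)⁻¹ • z) : ι → ℂ)) =
      WithLp.ofLp ∘ fun z => (Real.sqrt 2)⁻¹ • z := rfl
  rw [e, ← Measure.map_map (by fun_prop) (by fun_prop), h, Measure.map_map (by fun_prop)
    (by fun_prop)]
  exact Measure.map_id

/-- Gaussian concentration for independent complex Gaussians: if `F(x) ≤ C + |x - y|² / 20` for
all `y` in a set of measure at least `1/4`, then `exp F` is integrable, with a bound that depends
only on `C`. -/
theorem lintegral_exp_le_of_le_dist {A D : Set (ι → ℂ)} (hA : 1 / 4 ≤ gaussPi ι A)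
    (hAm : MeasurableSet A) {F : (ι → ℂ) → ℝ} (hF : Measurable F) (hD : MeasurableSet D) {C : ℝ}
    (h : ∀ x ∈ D, ∀ y ∈ A, F x ≤ C + (∑ i, ‖x i - y i‖ ^ 2) / 20) :
    ∫⁻ x, D.indicator (fun x => ENNReal.ofReal (Real.exp (F x))) x ∂(gaussPi ι) ≤
      4 * ENNReal.ofReal (Real.exp (C + 1)) * expSqConst := by
  set γ := stdGaussian (EuclideanSpace ℂ ι)
  let T : EuclideanSpace ℂ ι → ι → ℂ := fun z => WithLp.ofLp ((Real.sqrt 2)⁻¹ • z)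
  have hT : Measurable T := by fun_prop
  have hmap : γ.map T = gaussPi ι := map_stdGaussian_eq_gaussPi
  set B := T ⁻¹' A
  have hB : γ B = gaussPi ι A := by rw [← hmap, Measure.map_apply hT hAm]
  have hBne : B.Nonempty := by
    rw [Set.nonempty_iff_ne_empty]
    intro he
    rw [← hB, he, measure_empty] at hA
    exact absurd hA (by norm_num)
  have hpt : ∀ z, D.indicator (fun x => ENNReal.ofReal (Real.exp (F x))) (T z) ≤
      ENNReal.ofReal (Real.exp (C + 1)) *
        ENNReal.ofReal (Real.exp (Metric.infDist z B ^ 2 / 20)) := by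
    intro z
    by_cases hz : T z ∈ D
    · rw [Set.indicator_of_mem hz, ← ENNReal.ofReal_mul (Real.exp_nonneg _), ← Real.exp_add]
      refine ENNReal.ofReal_le_ofReal (Real.exp_le_exp.mpr ?_)
      -- A point of `B` within `infDist + 1` of `z`, as the infimum need not be attained. The loss
      -- is affordable: the scaling by `1/√2` halves squared distances, and `(s + 1)² / 40 ≤ s² / 20
      -- + 1 / 20`.
      obtain ⟨w, hw, hd⟩ := (Metric.infDist_lt_iff hBne).mp (lt_add_one (Metric.infDist z B))
      have h1 := h _ hz _ hw
      have h2 : ∑ i, ‖T z i - T w i‖ ^ 2 = dist z w ^ 2 / 2 := by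
        rw [dist_eq_norm, EuclideanSpace.norm_sq_eq, Finset.sum_div]
        refine Finset.sum_congr rfl fun i _ => ?_
        have e : T z i - T w i = (Real.sqrt 2)⁻¹ • (z - w) i := by simp [T, mul_sub]
        rw [e, norm_smul, mul_pow, norm_inv, Real.norm_of_nonneg (Real.sqrt_nonneg _), inv_pow,
          Real.sq_sqrt (by norm_num)]
        ring
      rw [h2] at h1
      have h3 : dist z w ^ 2 ≤ (Metric.infDist z B + 1) ^ 2 := by gcongr
      nlinarith [sq_nonneg (Metric.infDist z B - 1)]
    · rw [Set.indicator_of_notMem hz]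
      exact zero_le
  have hconc := lintegral_exp_infDist_sq_le B
  rw [hB] at hconc
  have h4 : ∫⁻ z, ENNReal.ofReal (Real.exp (Metric.infDist z B ^ 2 / 20)) ∂γ ≤ 4 * expSqConst := by
    calc ∫⁻ z, ENNReal.ofReal (Real.exp (Metric.infDist z B ^ 2 / 20)) ∂γ
        = 4 * (1 / 4 * ∫⁻ z, ENNReal.ofReal (Real.exp (Metric.infDist z B ^ 2 / 20)) ∂γ) := by
          rw [← mul_assoc, one_div, ENNReal.mul_inv_cancel (by norm_num) (by norm_num), one_mul]
      _ ≤ 4 * expSqConst := by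
          gcongr
          exact le_trans (by gcongr) hconc
  rw [← hmap, lintegral_map _ hT]
  · refine (lintegral_mono hpt).trans ?_
    rw [lintegral_const_mul' _ _ ENNReal.ofReal_ne_top]
    calc _ ≤ ENNReal.ofReal (Real.exp (C + 1)) * (4 * expSqConst) := by gcongr
      _ = _ := by ring
  · exact Measurable.indicator (by fun_prop) hD

end ProductMeasure

/-! ### Second moments of sums of nearly orthogonal random variables -/

section SecondMoments

/-- A weighted sum of random variables that are orthogonal unless their indices agree or are
exchanged by `σ`. -/
theorem second_moment_le {Ω κ : Type*} [MeasurableSpace Ω] {μ : Measure Ω}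
    [DecidableEq κ] (S : Finset κ) {X : κ → Ω → ℂ} (α : κ → ℂ) {σ : κ → κ}
    (hσ : Function.Injective σ) {B : ℝ} (hB : 0 ≤ B)
    (hX : ∀ i ∈ S, AEStronglyMeasurable (X i) μ)
    (hinteg : ∀ i ∈ S, Integrable (fun ω => ‖X i ω‖ ^ 2) μ)
    (hle : ∀ i ∈ S, ∫ ω, ‖X i ω‖ ^ 2 ∂μ ≤ B)
    (horth : ∀ i ∈ S, ∀ j ∈ S, j ≠ i → j ≠ σ i → ∫ ω, X i ω * starRingEnd ℂ (X j ω) ∂μ = 0) :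
    Integrable (fun ω => ‖∑ i ∈ S, α i * X i ω‖ ^ 2) μ ∧
      ∫ ω, ‖∑ i ∈ S, α i * X i ω‖ ^ 2 ∂μ ≤ 2 * B * ∑ i ∈ S, ‖α i‖ ^ 2 := by
  have hpair : ∀ i ∈ S, ∀ j ∈ S, Integrable (fun ω => X i ω * starRingEnd ℂ (X j ω)) μ := by
    intro i hi j hj
    refine ((hinteg i hi).add (hinteg j hj)).mono'
      ((hX i hi).mul (Complex.continuous_conj.comp_aestronglyMeasurable (hX j hj)))
      (ae_of_all _ fun ω => ?_)
    simp only [norm_mul, RCLike.norm_conj, Pi.add_apply]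
    nlinarith [sq_nonneg (‖X i ω‖ - ‖X j ω‖), sq_nonneg (‖X i ω‖ + ‖X j ω‖)]
  have hexp : ∀ ω, ((‖∑ i ∈ S, α i * X i ω‖ ^ 2 : ℝ) : ℂ) =
      ∑ i ∈ S, ∑ j ∈ S, α i * starRingEnd ℂ (α j) * (X i ω * starRingEnd ℂ (X j ω)) := by
    intro ω
    push_cast
    rw [← Complex.mul_conj', map_sum, Finset.sum_mul_sum]
    refine Finset.sum_congr rfl fun i _ => Finset.sum_congr rfl fun j _ => ?_
    rw [map_mul]
    ring
  have hintc : Integrable (fun ω => ((‖∑ i ∈ S, α i * X i ω‖ ^ 2 : ℝ) : ℂ)) μ := by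
    simp only [hexp]
    exact integrable_finsetSum _ fun i hi => integrable_finsetSum _ fun j hj =>
      (hpair i hi j hj).const_mul _
  have hintr : Integrable (fun ω => ‖∑ i ∈ S, α i * X i ω‖ ^ 2) μ := by
    have h := hintc.re
    simpa only [RCLike.re_to_complex, Complex.ofReal_re] using h
  refine ⟨hintr, ?_⟩
  have hval : ((∫ ω, ‖∑ i ∈ S, α i * X i ω‖ ^ 2 ∂μ : ℝ) : ℂ) =
      ∑ i ∈ S, ∑ j ∈ S, α i * starRingEnd ℂ (α j) *
        ∫ ω, X i ω * starRingEnd ℂ (X j ω) ∂μ := by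
    rw [← integral_complex_ofReal]
    simp only [hexp]
    rw [integral_finsetSum _ fun i hi => integrable_finsetSum _ fun j hj =>
      (hpair i hi j hj).const_mul _]
    refine Finset.sum_congr rfl fun i hi => ?_
    rw [integral_finsetSum _ fun j hj => (hpair i hi j hj).const_mul _]
    exact Finset.sum_congr rfl fun j hj => integral_const_mul _ _
  have hcov : ∀ i ∈ S, ∀ j ∈ S, ‖∫ ω, X i ω * starRingEnd ℂ (X j ω) ∂μ‖ ≤ B := by
    intro i hi j hj
    calc ‖∫ ω, X i ω * starRingEnd ℂ (X j ω) ∂μ‖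
        ≤ ∫ ω, ‖X i ω * starRingEnd ℂ (X j ω)‖ ∂μ := norm_integral_le_integral_norm _
      _ ≤ ∫ ω, (1 / 2 * ‖X i ω‖ ^ 2 + 1 / 2 * ‖X j ω‖ ^ 2) ∂μ := by
          refine integral_mono (hpair i hi j hj).norm
            (((hinteg i hi).const_mul _).add ((hinteg j hj).const_mul _)) fun ω => ?_
          simp only [norm_mul, RCLike.norm_conj]
          nlinarith [sq_nonneg (‖X i ω‖ - ‖X j ω‖)]
      _ ≤ B := by
          rw [integral_add ((hinteg i hi).const_mul _) ((hinteg j hj).const_mul _),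
            integral_const_mul, integral_const_mul]
          linarith [hle i hi, hle j hj]
  -- Only the diagonal `j = i` and the partner `j = σ i` survive. The partner is split by AM–GM, so
  -- that summation gives `B + B/2 + B/2 = 2 B`.
  have hterm : ∀ i ∈ S, ∀ j ∈ S, ‖α i * starRingEnd ℂ (α j) *
      ∫ ω, X i ω * starRingEnd ℂ (X j ω) ∂μ‖ ≤
      (if j = i then B * ‖α i‖ ^ 2 else 0) +
        if j = σ i then B / 2 * (‖α i‖ ^ 2 + ‖α (σ i)‖ ^ 2) else 0 := by
    intro i hi j hj
    have hn : ‖α i * starRingEnd ℂ (α j) * ∫ ω, X i ω * starRingEnd ℂ (X j ω) ∂μ‖ ≤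
        ‖α i‖ * ‖α j‖ * B := by
      rw [norm_mul, norm_mul, RCLike.norm_conj]
      gcongr
      exact hcov i hi j hj
    have hnn : 0 ≤ if j = σ i then B / 2 * (‖α i‖ ^ 2 + ‖α (σ i)‖ ^ 2) else 0 := by
      split_ifs <;> positivity
    by_cases h1 : j = i
    · rw [if_pos h1]
      refine hn.trans ?_
      rw [h1] at hnn ⊢
      nlinarith
    · rw [if_neg h1, zero_add]
      by_cases h2 : j = σ i
      · rw [if_pos h2]
        refine hn.trans ?_
        rw [h2]
        nlinarith [mul_nonneg hB (sq_nonneg (‖α i‖ - ‖α (σ i)‖))]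
      · rw [horth i hi j hj h1 h2]
        simp [h2]
  -- Injectivity of `σ` means that each coefficient is met at most once as a partner.
  have hsigma : ∑ i ∈ S, (if σ i ∈ S then ‖α (σ i)‖ ^ 2 else 0) ≤ ∑ i ∈ S, ‖α i‖ ^ 2 := by
    rw [← Finset.sum_filter, ← Finset.sum_image (f := fun i => ‖α i‖ ^ 2) (hσ.injOn)]
    refine Finset.sum_le_sum_of_subset_of_nonneg ?_ fun _ _ _ => sq_nonneg _
    intro j hj
    obtain ⟨i, hi, rfl⟩ := Finset.mem_image.mp hj
    exact (Finset.mem_filter.mp hi).2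
  calc ∫ ω, ‖∑ i ∈ S, α i * X i ω‖ ^ 2 ∂μ
      ≤ ‖((∫ ω, ‖∑ i ∈ S, α i * X i ω‖ ^ 2 ∂μ : ℝ) : ℂ)‖ := by
        rw [Complex.norm_real]; exact le_abs_self _
    _ ≤ ∑ i ∈ S, ∑ j ∈ S, ((if j = i then B * ‖α i‖ ^ 2 else 0) +
        if j = σ i then B / 2 * (‖α i‖ ^ 2 + ‖α (σ i)‖ ^ 2) else 0) := by
        rw [hval]
        exact (norm_sum_le _ _).trans (Finset.sum_le_sum fun i hi =>
          (norm_sum_le _ _).trans (Finset.sum_le_sum fun j hj => hterm i hi j hj))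
    _ ≤ ∑ i ∈ S, (B * ‖α i‖ ^ 2 + (B / 2 * ‖α i‖ ^ 2 +
        B / 2 * if σ i ∈ S then ‖α (σ i)‖ ^ 2 else 0)) := by
        refine Finset.sum_le_sum fun i hi => ?_
        rw [Finset.sum_add_distrib, Finset.sum_ite_eq', if_pos hi, Finset.sum_ite_eq']
        gcongr
        split_ifs
        · linarith
        · have : 0 ≤ B / 2 * ‖α i‖ ^ 2 := by positivity
          linarith
    _ ≤ 2 * B * ∑ i ∈ S, ‖α i‖ ^ 2 := by
        rw [Finset.sum_add_distrib, Finset.sum_add_distrib, ← Finset.mul_sum, ← Finset.mul_sum,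
          ← Finset.mul_sum]
        nlinarith

/-- Invariance gives `∫ F = c ∫ F`. It is used with `τ` multiplying one coordinate by `i`, or
exchanging the coordinates `n` and `-n`. -/
theorem integral_eq_zero_of_comp_eq_mul {Ω : Type*} [MeasurableSpace Ω] {μ : Measure Ω} {τ : Ω → Ω}
    (hτ : MeasurePreserving τ μ μ) {F : Ω → ℂ} (hF : AEStronglyMeasurable F μ) {c : ℂ} (hc : c ≠ 1)
    (h : ∀ ω, F (τ ω) = c * F ω) : ∫ ω, F ω ∂μ = 0 := by
  have h1 : ∫ ω, F ω ∂μ = c * ∫ ω, F ω ∂μ := by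
    have h2 : ∫ ω, F ω ∂(μ.map τ) = ∫ ω, F (τ ω) ∂μ :=
      integral_map hτ.measurable.aemeasurable (by rw [hτ.map_eq]; exact hF)
    rw [hτ.map_eq] at h2
    simp only [h] at h2
    rw [integral_const_mul] at h2
    exact h2
  have h3 : (1 - c) * ∫ ω, F ω ∂μ = 0 := by linear_combination h1
  exact (mul_eq_zero.mp h3).resolve_left (sub_ne_zero.mpr hc.symm)

variable {N : ℕ}

/-- Extension by zero of a family indexed by the frequencies `|n| ≤ N`. -/
def extend (x : box N → ℂ) (n : ℤ) : ℂ := if h : n ∈ box N then x ⟨n, h⟩ else 0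

theorem extend_of_notMem (x : box N → ℂ) {n : ℤ} (h : n ∉ box N) : extend x n = 0 := dif_neg h

@[fun_prop]
theorem measurable_extend (n : ℤ) : Measurable fun x : box N → ℂ => extend x n := by
  unfold extend
  split_ifs <;> fun_prop

/-- Multiplication of the coordinate `j` by `i`. -/
def rotateAt (j : ℤ) (x : box N → ℂ) : box N → ℂ :=
  fun i => if (i : ℤ) = j then Complex.I * x i else x i

theorem measurePreserving_rotateAt (j : ℤ) :
    MeasurePreserving (rotateAt (N := N) j) (gaussPi (box N)) (gaussPi (box N)) := by
  refine measurePreserving_pi (f := fun (i : box N) z => if (i : ℤ) = j then Complex.I * z else z) _ _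
    fun i => ?_
  by_cases h : (i : ℤ) = j
  · simpa [h] using measurePreserving_I_mul
  · simp only [h, if_false]
    exact MeasurePreserving.id stdComplexGaussian

theorem extend_rotateAt (j : ℤ) (x : box N → ℂ) (n : ℤ) :
    extend (rotateAt j x) n = (if n = j then Complex.I else 1) * extend x n := by
  unfold extend rotateAt
  split_ifs <;> simp

/-- The involution of the frequencies with `n ↦ -n` where `p |n|` and the identity elsewhere. -/
def flipPerm (N : ℕ) (p : ℕ → Prop) [DecidablePred p] : box N ≃ box N :=
  Function.Involutive.toPerm (fun n => ⟨if p (n : ℤ).natAbs then -n else n, by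
    have := n.2
    rw [mem_box] at *
    split_ifs <;> omega⟩) fun n => by
      ext
      simp only
      split_ifs <;> simp_all

theorem measurePreserving_flip (p : ℕ → Prop) [DecidablePred p] :
    MeasurePreserving (fun (x : box N → ℂ) i => x (flipPerm N p i)) (gaussPi (box N))
      (gaussPi (box N)) := by
  have h := measurePreserving_piCongrLeft (fun _ : box N => stdComplexGaussian)
    (flipPerm N p).symm
  have e : ⇑(MeasurableEquiv.piCongrLeft (fun _ => ℂ) (flipPerm N p).symm) =
      fun (x : box N → ℂ) i => x (flipPerm N p i) := by
    ext x i
    have := Equiv.piCongrLeft_apply_apply (fun _ : box N => ℂ) (flipPerm N p).symm x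
      (flipPerm N p i)
    rw [MeasurableEquiv.coe_piCongrLeft]
    simpa using this
  rw [e] at h
  exact h

theorem extend_flip (p : ℕ → Prop) [DecidablePred p] (x : box N → ℂ) (n : ℤ) :
    extend (fun i => x (flipPerm N p i)) n = extend x (if p n.natAbs then -n else n) := by
  have hmem : (if p n.natAbs then -n else n) ∈ box N ↔ n ∈ box N := by
    rw [mem_box, mem_box]
    split_ifs <;> omega
  unfold extend
  by_cases h : n ∈ box N
  · rw [dif_pos h, dif_pos (hmem.mpr h)]
    rfl
  · rw [dif_neg h, dif_neg (fun h₁ => h (hmem.mp h₁))]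

/-- A bound for the second moments of all monomials that occur. -/
def momentConst : ℝ := 4 + 6 * ∫ z, ‖z‖ ^ 6 ∂stdComplexGaussian

theorem momentConst_nonneg : 0 ≤ momentConst := by
  unfold momentConst
  positivity

theorem integrable_extend_pow (n : ℤ) :
    Integrable (fun x : box N → ℂ => ‖extend x n‖ ^ 6) (gaussPi (box N)) ∧
      ∫ x : box N → ℂ, ‖extend x n‖ ^ 6 ∂(gaussPi (box N)) ≤
        ∫ z, ‖z‖ ^ 6 ∂stdComplexGaussian := by
  by_cases h : n ∈ box N
  · have hm : MeasurePreserving (fun x : box N → ℂ => x ⟨n, h⟩) (gaussPi (box N))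
      stdComplexGaussian := measurePreserving_eval (fun _ : box N => stdComplexGaussian) ⟨n, h⟩
    simp only [extend, dif_pos h]
    constructor
    · exact hm.integrable_comp_of_integrable integrable_norm_pow_stdComplexGaussian
    · have h2 := integral_map (f := fun z : ℂ => ‖z‖ ^ 6) (μ := gaussPi (box N))
        hm.measurable.aemeasurable (by fun_prop)
      rw [hm.map_eq] at h2
      exact h2.symm.le
  · simp only [extend, dif_neg h, norm_zero]
    constructor
    · simp
    · simp only [ne_eq, OfNat.ofNat_ne_zero, not_false_eq_true, zero_pow, integral_zero]
      positivity

/-- A common majorant for monomials of degree at most three and for differences of squares; those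
with fewer than three frequencies repeat one of them. Its integral is at most `4 + 6 E|z|⁶`. -/
theorem second_moment_monomial_le {X : (box N → ℂ) → ℂ} (hX : Measurable X) (a b c : ℤ)
    (h : ∀ x, ‖X x‖ ^ 2 ≤
      4 + 2 * ‖extend x a‖ ^ 6 + 2 * ‖extend x b‖ ^ 6 + 2 * ‖extend x c‖ ^ 6) :
    Integrable (fun x => ‖X x‖ ^ 2) (gaussPi (box N)) ∧
      ∫ x, ‖X x‖ ^ 2 ∂(gaussPi (box N)) ≤ momentConst := by
  have ha := integrable_extend_pow (N := N) a
  have hb := integrable_extend_pow (N := N) b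
  have hc := integrable_extend_pow (N := N) c
  have hi : Integrable (fun x : box N → ℂ => 4 + 2 * ‖extend x a‖ ^ 6 + 2 * ‖extend x b‖ ^ 6 +
      2 * ‖extend x c‖ ^ 6) (gaussPi (box N)) :=
    (((integrable_const _).add (ha.1.const_mul 2)).add (hb.1.const_mul 2)).add (hc.1.const_mul 2)
  have hinteg : Integrable (fun x => ‖X x‖ ^ 2) (gaussPi (box N)) :=
    hi.mono' (by fun_prop) (ae_of_all _ fun x => by
      rw [Real.norm_of_nonneg (sq_nonneg _)]; exact h x)
  refine ⟨hinteg, (integral_mono hinteg hi h).trans ?_⟩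
  have hab := (integrable_const (μ := gaussPi (box N)) (4 : ℝ)).fun_add (ha.1.const_mul 2)
  rw [integral_add (hab.fun_add (hb.1.const_mul 2)) (hc.1.const_mul 2),
    integral_add hab (hb.1.const_mul 2), integral_add (integrable_const _) (ha.1.const_mul 2),
    integral_const_mul, integral_const_mul, integral_const_mul]
  simp only [integral_const, probReal_univ, smul_eq_mul, one_mul, momentConst]
  linarith [ha.2, hb.2, hc.2]

theorem sq_le_one_add_cube {s : ℝ} (hs : 0 ≤ s) : s ^ 2 ≤ 1 + s ^ 3 := by
  nlinarith [mul_nonneg hs (sq_nonneg (s - 1)), sq_nonneg (s - 1)]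

theorem sq_mul_le_pow_six (a b : ℝ) :
    (a * b) ^ 2 ≤ 4 + 2 * a ^ 6 + 2 * b ^ 6 + 2 * a ^ 6 := by
  have h1 := sq_le_one_add_cube (sq_nonneg a)
  have h2 := sq_le_one_add_cube (sq_nonneg b)
  have e1 : (a ^ 2) ^ 3 = a ^ 6 := by ring
  have e2 : (b ^ 2) ^ 3 = b ^ 6 := by ring
  have h3 : 0 ≤ a ^ 6 := by positivity
  have h4 : 0 ≤ b ^ 6 := by positivity
  rw [e1] at h1
  rw [e2] at h2
  nlinarith [sq_nonneg (a ^ 2 - b ^ 2)]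

theorem sq_mul_mul_le_pow_six (a b c : ℝ) :
    (a * b * c) ^ 2 ≤ 4 + 2 * a ^ 6 + 2 * b ^ 6 + 2 * c ^ 6 := by
  have e1 : a ^ 6 = (a ^ 2) ^ 3 := by ring
  have e2 : b ^ 6 = (b ^ 2) ^ 3 := by ring
  have e3 : c ^ 6 = (c ^ 2) ^ 3 := by ring
  have e4 : (a * b * c) ^ 2 = a ^ 2 * b ^ 2 * c ^ 2 := by ring
  rw [e1, e2, e3, e4]
  have hs := sq_nonneg a
  have ht := sq_nonneg b
  have hu := sq_nonneg c
  generalize a ^ 2 = s at *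
  generalize b ^ 2 = t at *
  generalize c ^ 2 = u at *
  have : 0 ≤ (s + t + u) * ((s - t) ^ 2 + (t - u) ^ 2 + (s - u) ^ 2) := by positivity
  have h3 : 0 ≤ s ^ 3 + t ^ 3 + u ^ 3 := by positivity
  nlinarith

theorem sq_sub_le_pow_six (a b : ℝ) :
    (a ^ 2 - b ^ 2) ^ 2 ≤ 4 + 2 * a ^ 6 + 2 * b ^ 6 + 2 * a ^ 6 := by
  have h1 := sq_le_one_add_cube (sq_nonneg a)
  have h2 := sq_le_one_add_cube (sq_nonneg b)
  have e1 : (a ^ 2) ^ 3 = a ^ 6 := by ring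
  have e2 : (b ^ 2) ^ 3 = b ^ 6 := by ring
  have h3 : 0 ≤ a ^ 6 := by positivity
  rw [e1] at h1
  rw [e2] at h2
  nlinarith [sq_nonneg (a ^ 2 + b ^ 2)]

theorem ite_I_ne_one (p : Prop) [Decidable p] : Complex.I * (if p then Complex.I else 1) ≠ 1 := by
  split_ifs <;> norm_num [Complex.ext_iff]

/-- The product is `(-i)^k` with `1 ≤ k ≤ 3`. A rotation by `-1` would fail at `k = 2`, which is why
coordinates are rotated by `i`. -/
theorem neg_I_mul_ite_ne_one (p q : Prop) [Decidable p] [Decidable q] :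
    -Complex.I * (if p then -Complex.I else 1) * (if q then -Complex.I else 1) ≠ 1 := by
  split_ifs <;> norm_num [Complex.ext_iff]

end SecondMoments

/-! ### Mean bounds for the random quadratic and cubic expressions, and the sign symmetry of the
energy -/

section RandomTerms

theorem sum_inv_bracket_sq_le (s : Finset ℤ) : ∑ n ∈ s, (1 + (n : ℝ) ^ 2)⁻¹ ≤ 5 := by
  have hsub : s ⊆ box (s.sup Int.natAbs) := by
    intro n hn
    have : n.natAbs ≤ s.sup Int.natAbs := Finset.le_sup (f := Int.natAbs) hn
    rw [mem_box]
    omega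
  refine (Finset.sum_le_sum_of_subset_of_nonneg hsub fun _ _ _ => by positivity).trans ?_
  have := sum_inv_sq_add_sq_le le_rfl (s.sup Int.natAbs)
  simpa using this

theorem sum_inv_bracket_sq_comp_le (s : Finset ℤ) {g : ℤ → ℤ} (hg : Function.Injective g) :
    ∑ n ∈ s, (1 + (g n : ℝ) ^ 2)⁻¹ ≤ 5 := by
  rw [← Finset.sum_image (f := fun n : ℤ => (1 + (n : ℝ) ^ 2)⁻¹) hg.injOn]
  exact sum_inv_bracket_sq_le _

variable {N : ℕ} {α : ℤ → ℝ} {Q : ℝ}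

/-- The random sequence `α(n) z(n)`. -/
def signal (α : ℤ → ℝ) (x : box N → ℂ) (n : ℤ) : ℂ := α n * extend x n

@[fun_prop]
theorem measurable_signal (α : ℤ → ℝ) (n : ℤ) :
    Measurable fun x : box N → ℂ => signal α x n := by
  unfold signal; fun_prop

theorem signal_of_notMem (α : ℤ → ℝ) (x : box N → ℂ) (n : ℤ) (h : n ∉ box N) :
    signal α x n = 0 := by
  rw [signal, extend_of_notMem x h, mul_zero]

theorem sq_le_of_weight (hα : ∀ n, α n ^ 2 * (1 + (n : ℝ) ^ 2) ≤ Q) (n : ℤ) :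
    α n ^ 2 ≤ Q * (1 + (n : ℝ) ^ 2)⁻¹ := by
  rw [← div_eq_mul_inv, le_div_iff₀ (by positivity)]
  exact hα n

theorem mul_sq_le_of_weight (hα : ∀ n, α n ^ 2 * (1 + (n : ℝ) ^ 2) ≤ Q) (n : ℤ) :
    (n : ℝ) ^ 2 * α n ^ 2 ≤ Q := by
  nlinarith [hα n, sq_nonneg (α n)]

theorem nonneg_of_weight (hα : ∀ n, α n ^ 2 * (1 + (n : ℝ) ^ 2) ≤ Q) : 0 ≤ Q :=
  le_trans (by positivity) (hα 0)

/-- The monomials `z(n) z(k - n)` are orthogonal except for the coincidence of `n` with `k - n`,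
hence the choice of `σ`. -/
theorem second_moment_conv_le (hα : ∀ n, α n ^ 2 * (1 + (n : ℝ) ^ 2) ≤ Q) (k : ℤ) :
    Integrable (fun x : box N → ℂ => ‖conv N (signal α x) (signal α x) k‖ ^ 2) (gaussPi (box N)) ∧
      ∫ x : box N → ℂ, ‖conv N (signal α x) (signal α x) k‖ ^ 2 ∂(gaussPi (box N)) ≤
        2 * momentConst * ∑ n ∈ box N,
          Q ^ 2 * ((1 + (n : ℝ) ^ 2)⁻¹ * (1 + ((k - n : ℤ) : ℝ) ^ 2)⁻¹) := by
  let X : ℤ → (box N → ℂ) → ℂ := fun n x => extend x n * extend x (k - n)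
  have hX : ∀ n, Measurable (X n) := fun n => by fun_prop
  have hmom : ∀ n, Integrable (fun x => ‖X n x‖ ^ 2) (gaussPi (box N)) ∧
      ∫ x, ‖X n x‖ ^ 2 ∂(gaussPi (box N)) ≤ momentConst := fun n =>
    second_moment_monomial_le (hX n) n (k - n) n fun x => by
      rw [norm_mul]; exact sq_mul_le_pow_six _ _
  have h := second_moment_le (μ := gaussPi (box N)) (box N) (X := X)
    (fun n => ((α n * α (k - n) : ℝ) : ℂ)) (σ := fun n => k - n)
    (fun a b h => by simpa using h) momentConst_nonneg
    (fun n _ => (hX n).aestronglyMeasurable) (fun n _ => (hmom n).1) (fun n _ => (hmom n).2) ?_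
  · have e : ∀ x : box N → ℂ, conv N (signal α x) (signal α x) k =
        ∑ n ∈ box N, ((α n * α (k - n) : ℝ) : ℂ) * X n x := by
      intro x
      refine Finset.sum_congr rfl fun n _ => ?_
      simp only [signal, X]
      push_cast
      ring
    simp only [e]
    refine ⟨h.1, h.2.trans ?_⟩
    have := momentConst_nonneg
    gcongr with n
    rw [Complex.norm_real, Real.norm_eq_abs, sq_abs, mul_pow]
    calc α n ^ 2 * α (k - n) ^ 2
        ≤ (Q * (1 + (n : ℝ) ^ 2)⁻¹) * (Q * (1 + ((k - n : ℤ) : ℝ) ^ 2)⁻¹) :=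
          mul_le_mul (sq_le_of_weight hα n) (sq_le_of_weight hα (k - n)) (sq_nonneg _)
            (mul_nonneg (nonneg_of_weight hα) (by positivity))
      _ = _ := by ring
  · intro n _ n' _ h1 h2
    -- Neither `n'` nor `k - n'` equals `n`, so the conjugated monomial is unchanged. The other
    -- acquires `i`, or `i²` if `k - n = n`.
    refine integral_eq_zero_of_comp_eq_mul (measurePreserving_rotateAt n)
      (by fun_prop) (ite_I_ne_one (k - n = n)) fun x => ?_
    have h3 : k - n' ≠ n := fun h => h2 (by rw [← h]; ring)
    simp only [X, extend_rotateAt, if_neg h1, if_neg h3, if_true, one_mul]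
    ring

theorem second_moment_squareSq_le (hα : ∀ n, α n ^ 2 * (1 + (n : ℝ) ^ 2) ≤ Q) :
    Integrable (fun x : box N → ℂ => squareSq N (signal α x)) (gaussPi (box N)) ∧
      ∫ x : box N → ℂ, squareSq N (signal α x) ∂(gaussPi (box N)) ≤
        50 * momentConst * Q ^ 2 := by
  have h := fun k => second_moment_conv_le (N := N) hα k
  refine ⟨integrable_finsetSum _ fun k _ => (h k).1, ?_⟩
  simp only [squareSq]
  rw [integral_finsetSum _ fun k _ => (h k).1]
  refine (Finset.sum_le_sum fun k _ => (h k).2).trans ?_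
  rw [← Finset.mul_sum, Finset.sum_comm]
  have hB := momentConst_nonneg
  have hs : ∑ n ∈ box N, ∑ k ∈ box (2 * N),
      Q ^ 2 * ((1 + (n : ℝ) ^ 2)⁻¹ * (1 + ((k - n : ℤ) : ℝ) ^ 2)⁻¹) ≤ Q ^ 2 * 25 := by
    simp only [← Finset.mul_sum]
    gcongr
    calc ∑ n ∈ box N, (1 + (n : ℝ) ^ 2)⁻¹ * ∑ k ∈ box (2 * N), (1 + ((k - n : ℤ) : ℝ) ^ 2)⁻¹
        ≤ ∑ n ∈ box N, (1 + (n : ℝ) ^ 2)⁻¹ * 5 := by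
          gcongr with n
          exact sum_inv_bracket_sq_comp_le _ (g := fun k => k - n) fun a b h => by simpa using h
      _ ≤ 5 * 5 := by
          rw [← Finset.sum_mul]
          gcongr
          exact sum_inv_bracket_sq_le _
      _ = 25 := by norm_num
  calc _ ≤ 2 * momentConst * (Q ^ 2 * 25) := by gcongr
    _ = _ := by ring

/-- The total momentum is `∑ n α(n)² |z(n)|²`. As `α` is even, pairing `n` with `-n` replaces
`|z(n)|²` by half the difference `|z(n)|² - |z(-n)|²`. This removes the mean and leaves the summable
variances `n² α(n)⁴ ≤ Q² / ⟨n⟩²`. -/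
theorem second_moment_momentum_zero_le (hα : ∀ n, α n ^ 2 * (1 + (n : ℝ) ^ 2) ≤ Q)
    (heven : ∀ n, α (-n) = α n) :
    Integrable (fun x : box N → ℂ => ‖momentum N (signal α x) 0‖ ^ 2) (gaussPi (box N)) ∧
      ∫ x : box N → ℂ, ‖momentum N (signal α x) 0‖ ^ 2 ∂(gaussPi (box N)) ≤
        10 * momentConst * Q ^ 2 := by
  let X : ℤ → (box N → ℂ) → ℂ := fun n x => ((‖extend x n‖ ^ 2 - ‖extend x (-n)‖ ^ 2 : ℝ) : ℂ)
  have hX : ∀ n, Measurable (X n) := fun n => by fun_prop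
  have hmom : ∀ n, Integrable (fun x => ‖X n x‖ ^ 2) (gaussPi (box N)) ∧
      ∫ x, ‖X n x‖ ^ 2 ∂(gaussPi (box N)) ≤ momentConst := fun n =>
    second_moment_monomial_le (hX n) n (-n) n fun x => by
      rw [Complex.norm_real, Real.norm_eq_abs, sq_abs]; exact sq_sub_le_pow_six _ _
  have h := second_moment_le (μ := gaussPi (box N)) (box N) (X := X)
    (fun n => ((n * α n ^ 2 / 2 : ℝ) : ℂ)) (σ := fun n => -n)
    (fun a b h => by simpa using h) momentConst_nonneg
    (fun n _ => (hX n).aestronglyMeasurable) (fun n _ => (hmom n).1) (fun n _ => (hmom n).2) ?_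
  · have e : ∀ x : box N → ℂ, momentum N (signal α x) 0 =
        ∑ n ∈ box N, ((n * α n ^ 2 / 2 : ℝ) : ℂ) * X n x := by
      intro x
      rw [momentum_zero]
      have hs : ∀ n : ℤ, ((n : ℂ) * (‖signal α x n‖ : ℂ) ^ 2) =
          ((n * α n ^ 2 * ‖extend x n‖ ^ 2 : ℝ) : ℂ) := by
        intro n
        have : ‖signal α x n‖ ^ 2 = α n ^ 2 * ‖extend x n‖ ^ 2 := by
          rw [signal, norm_mul, Complex.norm_real, mul_pow, Real.norm_eq_abs, sq_abs]
        rw [← Complex.ofReal_pow, this]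
        push_cast
        ring
      simp only [hs, X, ← Complex.ofReal_sum, ← Complex.ofReal_mul]
      congr 1
      have h1 := sum_box_neg N fun n : ℤ => (n : ℝ) * α n ^ 2 * ‖extend x n‖ ^ 2
      have h2 : ∑ n ∈ box N, (n : ℝ) * α n ^ 2 / 2 * (‖extend x n‖ ^ 2 - ‖extend x (-n)‖ ^ 2) =
          (∑ n ∈ box N, (n : ℝ) * α n ^ 2 * ‖extend x n‖ ^ 2 +
            ∑ n ∈ box N, ((-n : ℤ) : ℝ) * α (-n) ^ 2 * ‖extend x (-n)‖ ^ 2) / 2 := by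
        rw [← Finset.sum_add_distrib, Finset.sum_div]
        refine Finset.sum_congr rfl fun n _ => ?_
        rw [heven]
        push_cast
        ring
      rw [h2, h1]
      ring
    simp only [e]
    refine ⟨h.1, h.2.trans ?_⟩
    have hB := momentConst_nonneg
    have hs : ∑ n ∈ box N, ‖((n * α n ^ 2 / 2 : ℝ) : ℂ)‖ ^ 2 ≤ Q ^ 2 * 5 := by
      refine le_trans (Finset.sum_le_sum fun n _ => ?_)
        ((Finset.mul_sum _ _ _).symm.le.trans (mul_le_mul_of_nonneg_left
          (sum_inv_bracket_sq_le (box N)) (sq_nonneg Q)))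
      rw [Complex.norm_real, Real.norm_eq_abs, sq_abs]
      have h1 : ((n : ℝ) ^ 2 * α n ^ 2) * α n ^ 2 ≤ Q * (Q * (1 + (n : ℝ) ^ 2)⁻¹) :=
        mul_le_mul (mul_sq_le_of_weight hα n) (sq_le_of_weight hα n) (sq_nonneg _)
          (nonneg_of_weight hα)
      have h2 : 0 ≤ ((n : ℝ) ^ 2 * α n ^ 2) * α n ^ 2 := by positivity
      nlinarith
    calc _ ≤ 2 * momentConst * (Q ^ 2 * 5) := by gcongr
      _ = _ := by ring
  · intro n _ n' _ h1 h2
    -- Exchanging `n` and `-n` reverses the sign of `X n` and fixes `X n'` when `|n'| ≠ |n|`.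
    refine integral_eq_zero_of_comp_eq_mul
      (measurePreserving_flip (N := N) fun k => k = n.natAbs) (by fun_prop)
      (show (-1 : ℂ) ≠ 1 by norm_num) fun x => ?_
    have h3 : n'.natAbs ≠ n.natAbs := by omega
    simp only [X, extend_flip, Int.natAbs_neg, if_neg h3, if_true, neg_neg]
    push_cast
    ring

/-- For `j ≠ 0` distinct monomials `z(n) conj(z(n - j))` are orthogonal without exception, so `σ =
id`. The derivative uses up the decay of one factor, while that of the other is summed. The bound is
uniform in `j` but does not decay, so the weight `⟨j⟩⁻²` in `momentumSq` is needed to sum it. -/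
theorem second_moment_momentum_le_of_ne (hα : ∀ n, α n ^ 2 * (1 + (n : ℝ) ^ 2) ≤ Q) {j : ℤ}
    (hj : j ≠ 0) :
    Integrable (fun x : box N → ℂ => ‖momentum N (signal α x) j‖ ^ 2) (gaussPi (box N)) ∧
      ∫ x : box N → ℂ, ‖momentum N (signal α x) j‖ ^ 2 ∂(gaussPi (box N)) ≤
        10 * momentConst * Q ^ 2 := by
  let X : ℤ → (box N → ℂ) → ℂ := fun n x => extend x n * starRingEnd ℂ (extend x (n - j))
  have hX : ∀ n, Measurable (X n) := fun n =>
    (measurable_extend n).mul (Complex.continuous_conj.measurable.comp (measurable_extend _))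
  have hmom : ∀ n, Integrable (fun x => ‖X n x‖ ^ 2) (gaussPi (box N)) ∧
      ∫ x, ‖X n x‖ ^ 2 ∂(gaussPi (box N)) ≤ momentConst := fun n =>
    second_moment_monomial_le (hX n) n (n - j) n fun x => by
      rw [norm_mul, RCLike.norm_conj]; exact sq_mul_le_pow_six _ _
  have h := second_moment_le (μ := gaussPi (box N)) (box N) (X := X)
    (fun n => (((n + (n - j : ℤ)) / 2 * (α n * α (n - j)) : ℝ) : ℂ)) (σ := id)
    Function.injective_id momentConst_nonneg
    (fun n _ => (hX n).aestronglyMeasurable) (fun n _ => (hmom n).1) (fun n _ => (hmom n).2) ?_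
  · have e : ∀ x : box N → ℂ, momentum N (signal α x) j =
        ∑ n ∈ box N, (((n + (n - j : ℤ)) / 2 * (α n * α (n - j)) : ℝ) : ℂ) * X n x := by
      intro x
      simp only [momentum, corr, deriv1, signal, X, ← Finset.sum_add_distrib, Finset.sum_div,
        map_mul, Complex.conj_ofReal, map_intCast]
      refine Finset.sum_congr rfl fun n _ => ?_
      push_cast
      ring
    simp only [e]
    refine ⟨h.1, h.2.trans ?_⟩
    have hB := momentConst_nonneg
    have hs : ∑ n ∈ box N, ‖(((n + (n - j : ℤ)) / 2 * (α n * α (n - j)) : ℝ) : ℂ)‖ ^ 2 ≤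
        Q ^ 2 * 5 := by
      have hs1 := sum_inv_bracket_sq_le (box N)
      have hs2 := sum_inv_bracket_sq_comp_le (box N) (g := fun n => n - j)
        fun a b h => by simpa using h
      have hs3 : ∑ n ∈ box N, Q ^ 2 / 2 * ((1 + ((n - j : ℤ) : ℝ) ^ 2)⁻¹ + (1 + (n : ℝ) ^ 2)⁻¹) ≤
          Q ^ 2 * 5 := by
        rw [← Finset.mul_sum, Finset.sum_add_distrib]
        nlinarith [sq_nonneg Q]
      refine le_trans (Finset.sum_le_sum fun n _ => ?_) hs3
      rw [Complex.norm_real, Real.norm_eq_abs, sq_abs]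
      have hQ := nonneg_of_weight hα
      have h1 : ((n : ℝ) ^ 2 * α n ^ 2) * α (n - j) ^ 2 ≤
          Q * (Q * (1 + ((n - j : ℤ) : ℝ) ^ 2)⁻¹) :=
        mul_le_mul (mul_sq_le_of_weight hα n) (sq_le_of_weight hα (n - j)) (sq_nonneg _) hQ
      have h2 : (((n - j : ℤ) : ℝ) ^ 2 * α (n - j) ^ 2) * α n ^ 2 ≤
          Q * (Q * (1 + (n : ℝ) ^ 2)⁻¹) :=
        mul_le_mul (mul_sq_le_of_weight hα (n - j)) (sq_le_of_weight hα n) (sq_nonneg _) hQ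
      generalize ((n - j : ℤ) : ℝ) = r at *
      have h3 : ((n : ℝ) + r) ^ 2 ≤ 2 * (n : ℝ) ^ 2 + 2 * r ^ 2 := by
        nlinarith [sq_nonneg ((n : ℝ) - r)]
      have h4 : (((n : ℝ) + r) / 2 * (α n * α (n - j))) ^ 2 =
          ((n : ℝ) + r) ^ 2 * (α n ^ 2 * α (n - j) ^ 2) / 4 := by ring
      have h5 : ((n : ℝ) + r) ^ 2 * (α n ^ 2 * α (n - j) ^ 2) ≤
          (2 * (n : ℝ) ^ 2 + 2 * r ^ 2) * (α n ^ 2 * α (n - j) ^ 2) := by gcongr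
      rw [h4]
      linarith
    calc _ ≤ 2 * momentConst * (Q ^ 2 * 5) := by gcongr
      _ = _ := by ring
  · intro n _ n' _ h1 _
    refine integral_eq_zero_of_comp_eq_mul (measurePreserving_rotateAt n)
      ((hX n).mul (Complex.continuous_conj.measurable.comp (hX n'))).aestronglyMeasurable
      (ite_I_ne_one (n' - j = n)) fun x => ?_
    have h3 : n - j ≠ n := fun h => hj (by linarith)
    simp only [X, extend_rotateAt, if_neg h1, if_neg h3, if_true, one_mul, map_mul,
      Complex.conj_conj]
    ring

theorem second_moment_momentumSq_le (hα : ∀ n, α n ^ 2 * (1 + (n : ℝ) ^ 2) ≤ Q)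
    (heven : ∀ n, α (-n) = α n) :
    Integrable (fun x : box N → ℂ => momentumSq N (signal α x)) (gaussPi (box N)) ∧
      ∫ x : box N → ℂ, momentumSq N (signal α x) ∂(gaussPi (box N)) ≤
        50 * momentConst * Q ^ 2 := by
  have h : ∀ j, Integrable (fun x : box N → ℂ => ‖momentum N (signal α x) j‖ ^ 2)
      (gaussPi (box N)) ∧ ∫ x : box N → ℂ, ‖momentum N (signal α x) j‖ ^ 2 ∂(gaussPi (box N)) ≤
        10 * momentConst * Q ^ 2 := by
    intro j
    rcases eq_or_ne j 0 with rfl | hj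
    · exact second_moment_momentum_zero_le hα heven
    · exact second_moment_momentum_le_of_ne hα hj
  simp only [momentumSq, mul_pow, inv_pow, bracket_sq]
  refine ⟨integrable_finsetSum _ fun j _ => (h j).1.const_mul _, ?_⟩
  rw [integral_finsetSum _ fun j _ => (h j).1.const_mul _]
  simp only [integral_const_mul]
  have hB := momentConst_nonneg
  calc _ ≤ ∑ j ∈ box (2 * N), (1 + (j : ℝ) ^ 2)⁻¹ * (10 * momentConst * Q ^ 2) := by
        gcongr with j
        exact (h j).2
    _ ≤ 5 * (10 * momentConst * Q ^ 2) := by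
        rw [← Finset.sum_mul]
        gcongr
        exact sum_inv_bracket_sq_le _
    _ = _ := by ring

/-- Writing `m + n = l + (m + n - l)`, the derivative costs the decay of one factor, and the other
two give a convergent double sum. The only coincidence of monomials is `l ↔ m + n - l`, since the
paired frequencies have been removed. -/
theorem second_moment_cubicNonres_le (hα : ∀ n, α n ^ 2 * (1 + (n : ℝ) ^ 2) ≤ Q) (m : ℤ) :
    Integrable (fun x : box N → ℂ => ‖cubicNonres N (signal α x) m‖ ^ 2) (gaussPi (box N)) ∧
      ∫ x : box N → ℂ, ‖cubicNonres N (signal α x) m‖ ^ 2 ∂(gaussPi (box N)) ≤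
        200 * momentConst * Q ^ 3 := by
  let X : ℤ × ℤ → (box N → ℂ) → ℂ := fun q x =>
    extend x q.2 * extend x (m + q.1 - q.2) * starRingEnd ℂ (extend x q.1)
  have hX : ∀ q, Measurable (X q) := fun q => ((measurable_extend _).mul (measurable_extend _)).mul
    (Complex.continuous_conj.measurable.comp (measurable_extend _))
  have hmom : ∀ q, Integrable (fun x => ‖X q x‖ ^ 2) (gaussPi (box N)) ∧
      ∫ x, ‖X q x‖ ^ 2 ∂(gaussPi (box N)) ≤ momentConst := fun q =>
    second_moment_monomial_le (hX q) q.2 (m + q.1 - q.2) q.1 fun x => by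
      rw [norm_mul, norm_mul, RCLike.norm_conj]; exact sq_mul_mul_le_pow_six _ _ _
  let S := (box N ×ˢ box N).filter fun q => q.2 ≠ q.1 ∧ q.2 ≠ m
  let β : ℤ × ℤ → ℝ := fun q => (m + q.1) * (α q.2 * α (m + q.1 - q.2) * α q.1)
  have h := second_moment_le (μ := gaussPi (box N)) S (X := X)
    (fun q => (β q : ℂ)) (σ := fun q => (q.1, m + q.1 - q.2))
    (fun a b h => by
      simp only [Prod.mk.injEq] at h
      ext
      · exact h.1
      · linarith [h.1, h.2]) momentConst_nonneg
    (fun n _ => (hX n).aestronglyMeasurable) (fun n _ => (hmom n).1) (fun n _ => (hmom n).2) ?_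
  · have e : ∀ x : box N → ℂ, cubicNonres N (signal α x) m = ∑ q ∈ S, (β q : ℂ) * X q x := by
      intro x
      simp only [S, Finset.sum_filter, Finset.sum_product, cubicNonres]
      refine Finset.sum_congr rfl fun n _ => Finset.sum_congr rfl fun l _ => ?_
      split_ifs
      · simp only [signal, β, X, map_mul, Complex.conj_ofReal]
        push_cast
        ring
      · rfl
    simp only [e]
    refine ⟨h.1, h.2.trans ?_⟩
    have hB := momentConst_nonneg
    have hQ := nonneg_of_weight hα
    have hs : ∑ q ∈ S, ‖(β q : ℂ)‖ ^ 2 ≤ Q ^ 3 * 100 := by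
      have hs1 : ∑ q ∈ S, ‖(β q : ℂ)‖ ^ 2 ≤ ∑ q ∈ box N ×ˢ box N, β q ^ 2 := by
        have hSsub : S ⊆ box N ×ˢ box N := Finset.filter_subset _ _
        refine le_trans (le_of_eq ?_) (Finset.sum_le_sum_of_subset_of_nonneg
          hSsub fun _ _ _ => sq_nonneg _)
        exact Finset.sum_congr rfl fun q _ => by
          rw [Complex.norm_real, Real.norm_eq_abs, sq_abs]
      refine hs1.trans ?_
      rw [Finset.sum_product]
      have hterm : ∀ n l : ℤ, β (n, l) ^ 2 ≤ 2 * Q ^ 3 * ((1 + (n : ℝ) ^ 2)⁻¹ *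
          ((1 + ((m + n - l : ℤ) : ℝ) ^ 2)⁻¹ + (1 + (l : ℝ) ^ 2)⁻¹)) := by
        intro n l
        have hr : (m : ℝ) + n = l + ((m + n - l : ℤ) : ℝ) := by push_cast; ring
        have a1 := sq_le_of_weight hα n
        have h1 : ((l : ℝ) ^ 2 * α l ^ 2) * α (m + n - l) ^ 2 ≤
            Q * (Q * (1 + ((m + n - l : ℤ) : ℝ) ^ 2)⁻¹) :=
          mul_le_mul (mul_sq_le_of_weight hα l) (sq_le_of_weight hα _) (sq_nonneg _) hQ
        have h2 : (((m + n - l : ℤ) : ℝ) ^ 2 * α (m + n - l) ^ 2) * α l ^ 2 ≤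
            Q * (Q * (1 + (l : ℝ) ^ 2)⁻¹) :=
          mul_le_mul (mul_sq_le_of_weight hα _) (sq_le_of_weight hα l) (sq_nonneg _) hQ
        simp only [β]
        rw [hr]
        generalize ((m + n - l : ℤ) : ℝ) = r at *
        have h3 : ((l : ℝ) + r) ^ 2 ≤ 2 * (l : ℝ) ^ 2 + 2 * r ^ 2 := by
          nlinarith [sq_nonneg ((l : ℝ) - r)]
        have h5 : ((l : ℝ) + r) ^ 2 * (α l ^ 2 * α (m + n - l) ^ 2) ≤
            2 * Q ^ 2 * ((1 + r ^ 2)⁻¹ + (1 + (l : ℝ) ^ 2)⁻¹) := by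
          have h6 : ((l : ℝ) + r) ^ 2 * (α l ^ 2 * α (m + n - l) ^ 2) ≤
            (2 * (l : ℝ) ^ 2 + 2 * r ^ 2) * (α l ^ 2 * α (m + n - l) ^ 2) := by gcongr
          linarith
        calc (((l : ℝ) + r) * (α l * α (m + n - l) * α n)) ^ 2
            = (((l : ℝ) + r) ^ 2 * (α l ^ 2 * α (m + n - l) ^ 2)) * α n ^ 2 := by ring
          _ ≤ (2 * Q ^ 2 * ((1 + r ^ 2)⁻¹ + (1 + (l : ℝ) ^ 2)⁻¹)) * (Q * (1 + (n : ℝ) ^ 2)⁻¹) :=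
              mul_le_mul h5 a1 (sq_nonneg _) (by positivity)
          _ = _ := by ring
      calc ∑ n ∈ box N, ∑ l ∈ box N, β (n, l) ^ 2
          ≤ ∑ n ∈ box N, ∑ l ∈ box N, 2 * Q ^ 3 * ((1 + (n : ℝ) ^ 2)⁻¹ *
            ((1 + ((m + n - l : ℤ) : ℝ) ^ 2)⁻¹ + (1 + (l : ℝ) ^ 2)⁻¹)) :=
            Finset.sum_le_sum fun n _ => Finset.sum_le_sum fun l _ => hterm n l
        _ = 2 * Q ^ 3 * ∑ n ∈ box N, (1 + (n : ℝ) ^ 2)⁻¹ *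
            (∑ l ∈ box N, (1 + ((m + n - l : ℤ) : ℝ) ^ 2)⁻¹ +
              ∑ l ∈ box N, (1 + (l : ℝ) ^ 2)⁻¹) := by
            simp only [← Finset.mul_sum, Finset.sum_add_distrib]
        _ ≤ 2 * Q ^ 3 * ∑ n ∈ box N, (1 + (n : ℝ) ^ 2)⁻¹ * (5 + 5) := by
            gcongr with n
            · exact sum_inv_bracket_sq_comp_le _ (g := fun l => m + n - l)
                fun a b h => by simpa using h
            · exact sum_inv_bracket_sq_le _
        _ ≤ 2 * Q ^ 3 * (5 * (5 + 5)) := by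
            rw [← Finset.sum_mul]
            gcongr
            exact sum_inv_bracket_sq_le _
        _ = _ := by ring
    calc _ ≤ 2 * momentConst * (Q ^ 3 * 100) := by gcongr
      _ = _ := by ring
  · rintro ⟨n, l⟩ hq ⟨n', l'⟩ hq' h1 h2
    have hF : AEStronglyMeasurable (fun x => X (n, l) x * starRingEnd ℂ (X (n', l') x))
        (gaussPi (box N)) :=
      ((hX _).mul (Complex.continuous_conj.measurable.comp (hX _))).aestronglyMeasurable
    obtain ⟨hln, hlm⟩ := (Finset.mem_filter.mp hq).2
    simp only at hln hlm
    -- If the conjugated frequencies agree, rotate coordinate `l`, which differs from `n`, `l'` and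
    -- `m + n - l'`. Otherwise rotate coordinate `n`. As `n` differs from `l` and `m + n - l`, the
    -- first monomial gives `-i`, and the second contributes at most two more factors `-i`.
    by_cases hn : n' = n
    · subst hn
      have hll : l' ≠ l := fun h => h1 (by rw [h])
      have hll2 : m + n' - l' ≠ l := fun h => h2 (by rw [← h]; simp)
      refine integral_eq_zero_of_comp_eq_mul (measurePreserving_rotateAt l) hF
        (ite_I_ne_one (m + n' - l = l)) fun x => ?_
      simp only [X, extend_rotateAt, if_neg hln.symm, if_neg hll, if_neg hll2, if_true, one_mul,
        map_mul, Complex.conj_conj]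
      ring
    · have hm : m + n - l ≠ n := fun h => hlm (by linarith)
      refine integral_eq_zero_of_comp_eq_mul (measurePreserving_rotateAt n) hF
        (neg_I_mul_ite_ne_one (l' = n) (m + n' - l' = n)) fun x => ?_
      simp only [X, extend_rotateAt, if_neg hln, if_neg hn, if_neg hm, if_true, one_mul,
        map_mul, Complex.conj_conj, apply_ite (starRingEnd ℂ), Complex.conj_I, map_one]
      ring

theorem second_moment_cubicNonresSq_le (hα : ∀ n, α n ^ 2 * (1 + (n : ℝ) ^ 2) ≤ Q) :
    Integrable (fun x : box N → ℂ => cubicNonresSq N (signal α x)) (gaussPi (box N)) ∧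
      ∫ x : box N → ℂ, cubicNonresSq N (signal α x) ∂(gaussPi (box N)) ≤
        1000 * momentConst * Q ^ 3 := by
  have h := fun m => second_moment_cubicNonres_le (N := N) hα m
  simp only [cubicNonresSq, mul_pow, inv_pow, bracket_sq]
  refine ⟨integrable_finsetSum _ fun j _ => (h j).1.const_mul _, ?_⟩
  rw [integral_finsetSum _ fun j _ => (h j).1.const_mul _]
  simp only [integral_const_mul]
  have hB := momentConst_nonneg
  have hQ := nonneg_of_weight hα
  calc _ ≤ ∑ m ∈ box N, (1 + (m : ℝ) ^ 2)⁻¹ * (200 * momentConst * Q ^ 3) := by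
        gcongr with m
        exact (h m).2
    _ ≤ 5 * (200 * momentConst * Q ^ 3) := by
        rw [← Finset.sum_mul]
        gcongr
        exact sum_inv_bracket_sq_le _
    _ = _ := by ring

/-- Reflection of the frequencies changes the sign of the energy. -/
theorem half_le_measure_energy_nonpos (heven : ∀ n, α (-n) = α n) :
    1 / 2 ≤ gaussPi (box N) {x | energy N (signal α x) ≤ 0} := by
  have hmeas : Measurable fun x : box N → ℂ => energy N (signal α x) := by
    unfold energy conv
    fun_prop
  set A := {x : box N → ℂ | energy N (signal α x) ≤ 0}
  set A' := {x : box N → ℂ | 0 ≤ energy N (signal α x)}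
  let τ : (box N → ℂ) → box N → ℂ := fun x i => x (flipPerm N (fun _ => True) i)
  have hτ : MeasurePreserving τ (gaussPi (box N)) (gaussPi (box N)) := measurePreserving_flip _
  have henergy : ∀ x, energy N (signal α (τ x)) = -energy N (signal α x) := by
    intro x
    have h1 : signal α (τ x) = fun n => signal α x (-n) := by
      ext n
      simp only [signal, τ, extend_flip, if_true, heven]
    have h2 : ∀ k, conv N (signal α (τ x)) (signal α (τ x)) k =
        conv N (signal α x) (signal α x) (-k) := by
      intro k
      rw [h1, conv, conv, ← sum_box_neg]
      refine Finset.sum_congr rfl fun n _ => ?_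
      rw [neg_neg, sub_neg_eq_add, neg_add, ← sub_eq_add_neg]
    rw [energy, energy, ← sum_box_neg, ← Finset.sum_neg_distrib]
    refine Finset.sum_congr rfl fun k _ => ?_
    rw [h2, neg_neg]
    push_cast
    ring
  -- The sets where the energy is `≤ 0` and `≥ 0` are exchanged by the reflection and cover
  -- everything, so each has measure at least `1/2`.
  have hA' : gaussPi (box N) A' = gaussPi (box N) A := by
    have hpre : τ ⁻¹' A = A' := by
      ext x
      simp [A, A', henergy]
    rw [← hpre]
    exact hτ.measure_preimage (measurableSet_le hmeas measurable_const).nullMeasurableSet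
  have hcover : (1 : ℝ≥0∞) ≤ gaussPi (box N) A + gaussPi (box N) A := by
    calc (1 : ℝ≥0∞) = gaussPi (box N) Set.univ := measure_univ.symm
      _ ≤ gaussPi (box N) (A ∪ A') := measure_mono fun x _ => le_total (energy N (signal α x)) 0
      _ ≤ gaussPi (box N) A + gaussPi (box N) A' := measure_union_le _ _
      _ = _ := by rw [hA']
  rw [← two_mul] at hcover
  rw [ENNReal.div_le_iff' (by norm_num) (by norm_num)]
  exact hcover

end RandomTerms

/-! ### Typical high frequencies and the uniform exponential bound -/

section MainEstimate

variable {N : ℕ}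

/-- The weights `c(n) / ⟨n⟩`. -/
def weight (c : ℤ → ℝ) (n : ℤ) : ℝ := c n / bracket n

/-- Restriction of weights to the frequencies `|n| > L`. -/
def highWeight (L : ℕ) (α : ℤ → ℝ) (n : ℤ) : ℝ := if L < n.natAbs then α n else 0

theorem highWeight_weight_sq_le {c : ℤ → ℝ} {M : ℝ} (hc : ∀ n, |c n| ≤ M) (L : ℕ) (n : ℤ) :
    highWeight L (weight c) n ^ 2 * (1 + (n : ℝ) ^ 2) ≤ M ^ 2 := by
  unfold highWeight weight
  split_ifs
  · rw [← bracket_sq, div_pow, div_mul_cancel₀ _ (pow_ne_zero 2 (bracket_pos n).ne')]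
    exact sq_le_sq' (by linarith [abs_le.mp (hc n)]) (abs_le.mp (hc n)).2
  · simp only [ne_eq, OfNat.ofNat_ne_zero, not_false_eq_true, zero_pow, zero_mul]
    positivity

theorem highWeight_weight_even {c : ℤ → ℝ} (hc : ∀ n, c (-n) = c n) (L : ℕ) (n : ℤ) :
    highWeight L (weight c) (-n) = highWeight L (weight c) n := by
  simp only [highWeight, weight, Int.natAbs_neg, hc, bracket_neg]

theorem measure_gt_le_of_integral_le {Ω : Type*} [MeasurableSpace Ω] {μ : Measure Ω}
    [IsProbabilityMeasure μ] {h : Ω → ℝ} (hh : ∀ ω, 0 ≤ h ω) (hi : Integrable h μ) {K R : ℝ}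
    (hK : ∫ ω, h ω ∂μ ≤ K) (hR : 0 < R) (hKR : 16 * K ≤ R) : μ.real {ω | R < h ω} ≤ 1 / 16 := by
  have h1 := mul_meas_ge_le_integral_of_nonneg (ae_of_all _ hh) hi R
  have h2 : μ.real {ω | R < h ω} ≤ μ.real {ω | R ≤ h ω} :=
    measureReal_mono fun ω (hω : R < h ω) => hω.le
  have h3 : R * μ.real {ω | R ≤ h ω} ≤ R * (1 / 16) := by linarith
  exact h2.trans (le_of_mul_le_mul_left h3 hR)

/-- The tail `∑_{|n| > L} ⟨n⟩⁻²` is `O(1/L)`, uniformly in `N`. This is why the reference vector is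
truncated to high frequencies. -/
theorem integral_highMass_le {L : ℕ} (hL : 1 ≤ L) :
    Integrable (fun x : box N → ℂ => mass N (signal (highWeight L (weight 1)) x))
      (gaussPi (box N)) ∧
    ∫ x : box N → ℂ, mass N (signal (highWeight L (weight 1)) x) ∂(gaussPi (box N)) ≤
      10 * momentConst / L := by
  have hmom : ∀ n : ℤ, Integrable (fun x : box N → ℂ => ‖extend x n‖ ^ 2) (gaussPi (box N)) ∧
      ∫ x : box N → ℂ, ‖extend x n‖ ^ 2 ∂(gaussPi (box N)) ≤ momentConst := fun n =>
    second_moment_monomial_le (measurable_extend n) n n n fun x => by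
      have h1 := sq_le_one_add_cube (sq_nonneg ‖extend x n‖)
      have e : (‖extend x n‖ ^ 2) ^ 3 = ‖extend x n‖ ^ 6 := by ring
      rw [e] at h1
      nlinarith [sq_nonneg (‖extend x n‖ ^ 2 - 1), pow_nonneg (norm_nonneg (extend x n)) 6]
  have e : ∀ (x : box N → ℂ), mass N (signal (highWeight L (weight 1)) x) =
      ∑ n ∈ box N, highWeight L (weight 1) n ^ 2 * ‖extend x n‖ ^ 2 := by
    intro x
    refine Finset.sum_congr rfl fun n _ => ?_
    rw [signal, norm_mul, mul_pow, Complex.norm_real, Real.norm_eq_abs, sq_abs]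
  simp only [e]
  refine ⟨integrable_finsetSum _ fun n _ => (hmom n).1.const_mul _, ?_⟩
  rw [integral_finsetSum _ fun n _ => (hmom n).1.const_mul _]
  simp only [integral_const_mul]
  have hB := momentConst_nonneg
  have hL' : (1 : ℝ) ≤ L := by exact_mod_cast hL
  -- For `|n| > L` one has `L² + n² ≤ 2 ⟨n⟩²`, which reduces the tail to the full sum bounded by `5
  -- / L`.
  have hw : ∀ n : ℤ, highWeight L (weight 1) n ^ 2 ≤ 2 * ((L : ℝ) ^ 2 + (n : ℝ) ^ 2)⁻¹ := by
    intro n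
    unfold highWeight weight
    split_ifs with hn
    · rw [div_pow, bracket_sq, Pi.one_apply, one_pow, ← div_eq_mul_inv,
        div_le_div_iff₀ (by positivity) (by positivity)]
      have h1 : (L : ℝ) ≤ |(n : ℝ)| := by
        have : (L : ℤ) ≤ |n| := by rw [Int.abs_eq_natAbs]; omega
        exact_mod_cast this
      have h2 : (L : ℝ) ^ 2 ≤ (n : ℝ) ^ 2 := by
        rw [← sq_abs (n : ℝ)]; gcongr
      linarith
    · simp only [ne_eq, OfNat.ofNat_ne_zero, not_false_eq_true, zero_pow]
      positivity
  calc ∑ n ∈ box N, highWeight L (weight 1) n ^ 2 *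
        ∫ x : box N → ℂ, ‖extend x n‖ ^ 2 ∂(gaussPi (box N))
      ≤ ∑ n ∈ box N, 2 * ((L : ℝ) ^ 2 + (n : ℝ) ^ 2)⁻¹ * momentConst := by
        refine Finset.sum_le_sum fun n _ => mul_le_mul (hw n) (hmom n).2
          (integral_nonneg fun _ => sq_nonneg _) (by positivity)
    _ ≤ 2 * (5 / L) * momentConst := by
        rw [← Finset.sum_mul, ← Finset.mul_sum]
        gcongr
        exact sum_inv_sq_add_sq_le hL' N
    _ = _ := by ring

/-- The typical high frequency parts: small mass, nonpositive energy, bounded quadratic and cubic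
expressions. -/
def typicalSet (N L : ℕ) (c : ℤ → ℝ) (m R : ℝ) : Set (box N → ℂ) :=
  {x | energy N (signal (highWeight L (weight c)) x) ≤ 0 ∧
    mass N (signal (highWeight L (weight 1)) x) ≤ m ∧
    squareSq N (signal (highWeight L (weight c)) x) ≤ R ∧
    momentumSq N (signal (highWeight L (weight c)) x) ≤ R ∧
    cubicNonresSq N (signal (highWeight L (weight c)) x) ≤ R}

@[fun_prop]
theorem measurable_conj : Measurable (starRingEnd ℂ) := Complex.continuous_conj.measurable

theorem measurable_energy_signal (α : ℤ → ℝ) :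
    Measurable fun x : box N → ℂ => energy N (signal α x) := by
  unfold energy conv
  fun_prop

theorem measurable_mass_signal (α : ℤ → ℝ) :
    Measurable fun x : box N → ℂ => mass N (signal α x) := by
  unfold mass
  fun_prop

theorem measurableSet_typicalSet (L : ℕ) (c : ℤ → ℝ) (m R : ℝ) :
    MeasurableSet (typicalSet N L c m R) := by
  have h3 : Measurable fun x : box N → ℂ => squareSq N (signal (highWeight L (weight c)) x) := by
    unfold squareSq conv
    fun_prop
  have h4 : Measurable fun x : box N → ℂ => momentumSq N (signal (highWeight L (weight c)) x) := by
    unfold momentumSq momentum corr deriv1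
    fun_prop
  have h5 : Measurable fun x : box N → ℂ =>
      cubicNonresSq N (signal (highWeight L (weight c)) x) := by
    unfold cubicNonresSq cubicNonres
    refine Finset.measurable_sum _ fun m _ => ((Measurable.norm ?_).const_mul _).pow_const _
    refine Finset.measurable_sum _ fun n _ => Finset.measurable_sum _ fun l _ => ?_
    split_ifs <;> fun_prop
  exact (measurableSet_le (measurable_energy_signal _) measurable_const).inter
    ((measurableSet_le (measurable_mass_signal _) measurable_const).inter
    ((measurableSet_le h3 measurable_const).inter
    ((measurableSet_le h4 measurable_const).inter (measurableSet_le h5 measurable_const))))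

theorem quarter_le_measure_typicalSet {c : ℤ → ℝ} {M : ℝ} (hc : ∀ n, |c n| ≤ M)
    (heven : ∀ n, c (-n) = c n) {m : ℝ} (hm : 0 < m) {L : ℕ} (hL : 1 ≤ L)
    (hLm : 160 * momentConst / m ≤ L) :
    1 / 4 ≤ gaussPi (box N)
      (typicalSet N L c m (16000 * momentConst * (1 + M ^ 2) ^ 3 + 1)) := by
  -- `16` times the largest of the mean bounds, `1000 * momentConst * Q³` with `Q = M² ≤ 1 + M²`, so
  -- that Markov leaves probability at most `1/16`. The added `1` makes `R` positive.
  set R := 16000 * momentConst * (1 + M ^ 2) ^ 3 + 1 with hR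
  set μ := gaussPi (box N)
  set α := highWeight L (weight c)
  have hB := momentConst_nonneg
  have hRpos : 0 < R := by positivity
  have hα := highWeight_weight_sq_le hc L
  have hαe := highWeight_weight_even heven L
  have hM2 : 0 ≤ M ^ 2 := sq_nonneg M
  have hQ2 : (M ^ 2) ^ 2 ≤ (1 + M ^ 2) ^ 3 := by nlinarith [pow_nonneg hM2 2, pow_nonneg hM2 3]
  have hQ3 : (M ^ 2) ^ 3 ≤ (1 + M ^ 2) ^ 3 := by gcongr; linarith
  have b1 : μ.real {x | m < mass N (signal (highWeight L (weight 1)) x)} ≤ 1 / 16 := by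
    have h := integral_highMass_le (N := N) hL
    refine measure_gt_le_of_integral_le (fun _ => mass_nonneg _) h.1 h.2 hm ?_
    have hL0 : (0 : ℝ) < L := by exact_mod_cast hL
    rw [div_le_iff₀ hm] at hLm
    have e : 16 * (10 * momentConst / L) = 160 * momentConst / L := by ring
    rw [e, div_le_iff₀ hL0]
    linarith
  have b2 : μ.real {x | R < squareSq N (signal α x)} ≤ 1 / 16 := by
    have h := second_moment_squareSq_le (N := N) hα
    refine measure_gt_le_of_integral_le (fun _ => squareSq_nonneg _) h.1 h.2 hRpos ?_
    nlinarith [mul_le_mul_of_nonneg_left hQ2 hB, mul_nonneg hB (by positivity : 0 ≤ (1 + M ^ 2) ^ 3)]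
  have b3 : μ.real {x | R < momentumSq N (signal α x)} ≤ 1 / 16 := by
    have h := second_moment_momentumSq_le (N := N) hα hαe
    refine measure_gt_le_of_integral_le (fun _ => momentumSq_nonneg _) h.1 h.2 hRpos ?_
    nlinarith [mul_le_mul_of_nonneg_left hQ2 hB, mul_nonneg hB (by positivity : 0 ≤ (1 + M ^ 2) ^ 3)]
  have b4 : μ.real {x | R < cubicNonresSq N (signal α x)} ≤ 1 / 16 := by
    have h := second_moment_cubicNonresSq_le (N := N) hα
    refine measure_gt_le_of_integral_le
      (fun _ => Finset.sum_nonneg fun _ _ => sq_nonneg _) h.1 h.2 hRpos ?_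
    nlinarith [mul_le_mul_of_nonneg_left hQ3 hB]
  have b0 : 1 / 2 ≤ μ.real {x | energy N (signal α x) ≤ 0} := by
    have h := half_le_measure_energy_nonpos (N := N) hαe
    have := ENNReal.toReal_mono (measure_ne_top _ _) h
    simpa [Measure.real] using this
  have hcover : {x | energy N (signal α x) ≤ 0} ⊆ typicalSet N L c m R ∪
      ({x | m < mass N (signal (highWeight L (weight 1)) x)} ∪
      ({x | R < squareSq N (signal α x)} ∪ ({x | R < momentumSq N (signal α x)} ∪
        {x | R < cubicNonresSq N (signal α x)}))) := by
    intro x hx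
    by_contra hcon
    simp only [Set.mem_union, Set.mem_ofPred_eq, not_or, not_lt] at hcon
    exact hcon.1 ⟨hx, hcon.2.1, hcon.2.2.1, hcon.2.2.2.1, hcon.2.2.2.2⟩
  -- `1/2 ≤ μ(typical) + 4 · 1/16`.
  have hsum := (measureReal_mono (μ := μ) hcover).trans ((measureReal_union_le _ _).trans
    (add_le_add le_rfl ((measureReal_union_le _ _).trans (add_le_add le_rfl
      ((measureReal_union_le _ _).trans (add_le_add le_rfl (measureReal_union_le _ _)))))))
  have hreal : 1 / 4 ≤ μ.real (typicalSet N L c m R) := by linarith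
  have := (ENNReal.ofReal_le_iff_le_toReal (measure_ne_top μ (typicalSet N L c m R))).mpr hreal
  refine le_trans (le_of_eq ?_) this
  rw [ENNReal.ofReal_div_of_pos (by norm_num)]
  simp

/-- Take `a` to be the high part of `y` and `b` the signal of `x` minus `a`. For `|n| > L`, `b(n) =
c(n) (x(n) - y(n)) / ⟨n⟩`, so its `H¹` norm is a Euclidean distance. For `|n| ≤ L`, `a` vanishes and
`⟨n⟩² ≤ 1 + L²` is multiplied by the small mass of `x`. Both masses `a` and `b` are at most `4 M² m
≤ δ`. -/
theorem energy_le_of_typical {c : ℤ → ℝ} {M : ℝ} (hc : ∀ n, |c n| ≤ M) {L : ℕ} {δ m R : ℝ}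
    (hδ : 0 < δ) (hδ1 : δ ≤ 1) (hmδ : 4 * M ^ 2 * m ≤ δ) {x y : box N → ℂ}
    (hx : mass N (signal (weight 1) x) < m) (hy : y ∈ typicalSet N L c m R) :
    energy N (signal (weight c) x) ≤
      102 * δ * (M ^ 2 * (∑ i, ‖x i - y i‖ ^ 2 + (1 + (L : ℝ) ^ 2) * m)) +
        (640 * R / δ + 4 * Real.sqrt (18 * R + 64)) ^ 2 / (4 * δ) := by
  obtain ⟨hE, hmy, hS, hJ, hC⟩ := hy
  set a := signal (highWeight L (weight c)) y with ha
  set b : ℤ → ℂ := fun n => signal (weight c) x n - a n with hb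
  set u := signal (weight 1) x with hu
  set v := signal (highWeight L (weight 1)) y with hv
  have ha0 : ∀ n, n ∉ box N → a n = 0 := signal_of_notMem _ _
  have hb0 : ∀ n, n ∉ box N → b n = 0 := fun n hn => by
    simp [hb, ha0 n hn, signal_of_notMem _ _ _ hn]
  have hcM : ∀ n, ‖(c n : ℂ)‖ ^ 2 ≤ M ^ 2 := fun n => by
    rw [Complex.norm_real, Real.norm_eq_abs]
    exact pow_le_pow_left₀ (abs_nonneg _) (hc n) 2
  have hav : ∀ n, a n = c n * v n := fun n => by
    simp only [ha, hv, signal, highWeight, weight, Pi.one_apply]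
    split_ifs <;> push_cast <;> ring
  have hbuv : ∀ n, b n = c n * (u n - v n) := fun n => by
    simp only [hb, hav, hu, signal, weight, Pi.one_apply]
    push_cast
    ring
  have hma : mass N a ≤ δ := by
    have h1 : mass N a ≤ M ^ 2 * mass N v := by
      rw [mass, mass, Finset.mul_sum]
      refine Finset.sum_le_sum fun n _ => ?_
      rw [hav, norm_mul, mul_pow]
      exact mul_le_mul_of_nonneg_right (hcM n) (sq_nonneg _)
    nlinarith [mul_le_mul_of_nonneg_left hmy (sq_nonneg M)]
  have hmb : mass N b ≤ δ := by
    have h1 : mass N b ≤ M ^ 2 * (2 * mass N u + 2 * mass N v) := by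
      rw [mass, mass, mass, Finset.mul_sum, Finset.mul_sum, ← Finset.sum_add_distrib,
        Finset.mul_sum]
      refine Finset.sum_le_sum fun n _ => ?_
      rw [hbuv, norm_mul, mul_pow]
      refine mul_le_mul (hcM n) ?_ (sq_nonneg _) (sq_nonneg _)
      have h := norm_sub_le (u n) (v n)
      nlinarith [norm_nonneg (u n - v n), sq_nonneg (‖u n‖ - ‖v n‖)]
    nlinarith [mul_le_mul_of_nonneg_left hmy (sq_nonneg M),
      mul_le_mul_of_nonneg_left hx.le (sq_nonneg M)]
  have hsob : sobolevSq N b ≤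
      M ^ 2 * (∑ i, ‖x i - y i‖ ^ 2 + (1 + (L : ℝ) ^ 2) * m) := by
    have hsum : ∑ i, ‖x i - y i‖ ^ 2 = ∑ n ∈ box N, ‖extend x n - extend y n‖ ^ 2 := by
      rw [← Finset.sum_coe_sort (box N)]
      refine Finset.sum_congr rfl fun i _ => ?_
      simp [extend]
    have h1 : sobolevSq N b ≤ M ^ 2 * (∑ n ∈ box N, ‖extend x n - extend y n‖ ^ 2 +
        (1 + (L : ℝ) ^ 2) * mass N u) := by
      rw [sobolevSq, mass, Finset.mul_sum (a := 1 + (L : ℝ) ^ 2), ← Finset.sum_add_distrib,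
        Finset.mul_sum]
      refine Finset.sum_le_sum fun n _ => ?_
      rw [hbuv, norm_mul, mul_pow, mul_pow, mul_left_comm]
      refine mul_le_mul (hcM n) ?_ (by positivity) (sq_nonneg _)
      have hbr := bracket_pos n
      by_cases hn : L < n.natAbs
      · have e : bracket n ^ 2 * ‖u n - v n‖ ^ 2 = ‖extend x n - extend y n‖ ^ 2 := by
          have : u n - v n = ((bracket n)⁻¹ : ℝ) * (extend x n - extend y n) := by
            simp only [hu, hv, signal, highWeight, weight, if_pos hn, Pi.one_apply, one_div]
            ring
          rw [this, norm_mul, Complex.norm_real, Real.norm_of_nonneg (by positivity), mul_pow,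
            ← mul_assoc, ← mul_pow, mul_inv_cancel₀ hbr.ne']
          ring
        rw [e]
        have : 0 ≤ (1 + (L : ℝ) ^ 2) * ‖u n‖ ^ 2 := by positivity
        linarith
      · have hv0 : v n = 0 := by simp [hv, signal, highWeight, hn]
        rw [hv0, sub_zero, bracket_sq]
        have h2 : (n : ℝ) ^ 2 ≤ (L : ℝ) ^ 2 := by
          rw [← sq_abs (n : ℝ)]
          have h3 : |n| ≤ (L : ℤ) := by rw [Int.abs_eq_natAbs]; omega
          have h4 : |(n : ℝ)| ≤ L := by exact_mod_cast h3
          gcongr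
        have h5 : (1 + (n : ℝ) ^ 2) * ‖u n‖ ^ 2 ≤ (1 + (L : ℝ) ^ 2) * ‖u n‖ ^ 2 := by gcongr
        have : 0 ≤ ‖extend x n - extend y n‖ ^ 2 := sq_nonneg _
        linarith
    rw [hsum]
    refine h1.trans ?_
    gcongr
  have hmain := energy_add_le_of_small hδ hδ1 ha0 hb0 hma hmb hE hJ hS hC
  have e : (fun n => a n + b n) = signal (weight c) x := by
    ext n
    simp [hb]
  rw [e] at hmain
  refine hmain.trans ?_
  gcongr

/-- Exponential integrability of the energy on a small ball of `L²`, uniformly in the number of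
frequencies and in the weights. -/
theorem exists_lintegral_exp_energy_le (M p : ℝ) (hp : 1 ≤ p) :
    ∃ m : ℝ, 0 < m ∧ ∃ C : ℝ, 0 ≤ C ∧ ∀ c : ℤ → ℝ, (∀ n, |c n| ≤ M) → (∀ n, c (-n) = c n) →
      ∀ N : ℕ, ∫⁻ x, {x : box N → ℂ | mass N (signal (weight 1) x) < m}.indicator
        (fun x => ENNReal.ofReal (Real.exp (p * (3 / 4 * energy N (signal (weight c) x))))) x
        ∂(gaussPi (box N)) ≤ ENNReal.ofReal C := by
  have hp0 : 0 < p := by linarith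
  set q := 1 + M ^ 2 with hq
  have hq1 : 1 ≤ q := by nlinarith [sq_nonneg M]
  have hMq : M ^ 2 ≤ q := by linarith
  -- Chosen so that `p · (3/4) · 102 δ M² ≤ 1/20`, the rate allowed by concentration. The radius `m
  -- = δ / (4 q)` then gives `4 M² m ≤ δ`. Neither depends on `c` or `N`.
  set δ := 1 / (2000 * p * q) with hδ
  have hδ0 : 0 < δ := by positivity
  have hpq : δ * (p * q) = 1 / 2000 := by rw [hδ]; field_simp
  have hpq1 : 1 ≤ p * q := by nlinarith
  have hδ1 : δ ≤ 1 := by nlinarith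
  set m := δ / (4 * q) with hm
  have hm0 : 0 < m := by positivity
  have hmδ : 4 * M ^ 2 * m ≤ δ := by
    have : 4 * q * m = δ := by rw [hm]; field_simp
    nlinarith
  obtain ⟨L, hLm⟩ := exists_nat_ge (max 1 (160 * momentConst / m))
  have hL : 1 ≤ L := by exact_mod_cast (le_max_left _ _).trans hLm
  set R := 16000 * momentConst * (1 + M ^ 2) ^ 3 + 1
  set K := (640 * R / δ + 4 * Real.sqrt (18 * R + 64)) ^ 2 / (4 * δ)
  set C := p * (3 / 4) * (102 * δ * (M ^ 2 * ((1 + (L : ℝ) ^ 2) * m)) + K)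
  have hfin : 4 * ENNReal.ofReal (Real.exp (C + 1)) * expSqConst ≠ ⊤ :=
    ENNReal.mul_ne_top (ENNReal.mul_ne_top (by norm_num) ENNReal.ofReal_ne_top)
      expSqConst_lt_top.ne
  refine ⟨m, hm0, (4 * ENNReal.ofReal (Real.exp (C + 1)) * expSqConst).toReal,
    ENNReal.toReal_nonneg, fun c hc heven N => ?_⟩
  rw [ENNReal.ofReal_toReal hfin]
  refine lintegral_exp_le_of_le_dist
    (quarter_le_measure_typicalSet hc heven hm0 hL ((le_max_right _ _).trans hLm))
    (measurableSet_typicalSet _ _ _ _)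
    (((measurable_energy_signal _).const_mul _).const_mul _)
    (measurableSet_lt (measurable_mass_signal _) measurable_const) fun x hx y hy => ?_
  have h := energy_le_of_typical hc hδ0 hδ1 hmδ hx hy
  set d := ∑ i, ‖x i - y i‖ ^ 2
  have hd : 0 ≤ d := Finset.sum_nonneg fun _ _ => sq_nonneg _
  have h1 : p * (3 / 4) * (102 * δ * (M ^ 2 * d)) ≤ d / 20 := by
    have : δ * (p * M ^ 2) ≤ 1 / 2000 := by rw [← hpq]; gcongr
    nlinarith [mul_le_mul_of_nonneg_right this hd]
  calc p * (3 / 4 * energy N (signal (weight c) x))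
      ≤ p * (3 / 4 * (102 * δ * (M ^ 2 * (d + (1 + (L : ℝ) ^ 2) * m)) + K)) := by gcongr
    _ = C + p * (3 / 4) * (102 * δ * (M ^ 2 * d)) := by ring
    _ ≤ C + d / 20 := by linarith

end MainEstimate

/-! ### Identification of the integrals and sums with the energy -/

section Torus

theorem torusIntegral_exp (k : ℤ) :
    torusIntegral (fun x : ℝ => Complex.exp (Complex.I * k * x)) = if k = 0 then 1 else 0 := by
  unfold torusIntegral
  split_ifs with hk
  · subst hk
    have hpi : (Real.pi : ℂ) ≠ 0 := by exact_mod_cast Real.pi_ne_zero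
    simp
    field_simp
  · have hc : Complex.I * (k : ℂ) ≠ 0 := mul_ne_zero Complex.I_ne_zero (by exact_mod_cast hk)
    rw [integral_exp_mul_complex hc]
    have e : Complex.I * k * ((2 * Real.pi : ℝ) : ℂ) = k * (2 * Real.pi * Complex.I) := by
      push_cast; ring
    rw [e, Complex.exp_int_mul_two_pi_mul_I]
    simp

/-- The trigonometric polynomial with coefficients `w`. -/
def trig (s : Finset ℤ) (w : ℤ → ℂ) (x : ℝ) : ℂ :=
  ∑ k ∈ s, w k * Complex.exp (Complex.I * k * x)

theorem torusIntegral_conj_trig_mul_trig (s : Finset ℤ) (w v : ℤ → ℂ) :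
    torusIntegral (fun x => starRingEnd ℂ (trig s w x) * trig s v x) =
      ∑ k ∈ s, starRingEnd ℂ (w k) * v k := by
  have e : ∀ x : ℝ, starRingEnd ℂ (trig s w x) * trig s v x =
      ∑ k ∈ s, ∑ l ∈ s, (starRingEnd ℂ (w k) * v l) *
        Complex.exp (Complex.I * ((l - k : ℤ) : ℂ) * x) := by
    intro x
    simp only [trig, map_sum, Finset.sum_mul_sum, map_mul]
    refine Finset.sum_congr rfl fun k _ => Finset.sum_congr rfl fun l _ => ?_
    have h : Complex.exp (Complex.I * ((l - k : ℤ) : ℂ) * x) =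
        starRingEnd ℂ (Complex.exp (Complex.I * k * x)) * Complex.exp (Complex.I * l * x) := by
      rw [← Complex.exp_conj, ← Complex.exp_add]
      congr 1
      simp only [map_mul, Complex.conj_I, Complex.conj_ofReal, map_intCast]
      push_cast
      ring
    rw [h]
    ring
  have hcont : ∀ k : ℤ, Continuous fun x : ℝ => Complex.exp (Complex.I * k * x) := fun k => by
    fun_prop
  unfold torusIntegral
  simp only [e]
  rw [intervalIntegral.integral_finsetSum fun k _ =>
    (continuous_finsetSum _ fun l _ => ((hcont (l - k)).const_mul _)).intervalIntegrable _ _,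
    Finset.smul_sum]
  refine Finset.sum_congr rfl fun k hk => ?_
  rw [intervalIntegral.integral_finsetSum fun l _ =>
    ((hcont (l - k)).const_mul _).intervalIntegrable _ _, Finset.smul_sum]
  have h1 : ∀ l ∈ s, (2 * Real.pi)⁻¹ • ∫ x in (0 : ℝ)..(2 * Real.pi), (starRingEnd ℂ (w k) * v l) *
      Complex.exp (Complex.I * ((l - k : ℤ) : ℂ) * x) =
      if l = k then starRingEnd ℂ (w k) * v l else 0 := by
    intro l _
    have h2 := torusIntegral_exp (l - k)
    unfold torusIntegral at h2
    rw [intervalIntegral.integral_const_mul, ← mul_smul_comm, h2]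
    simp only [sub_eq_zero, mul_ite, mul_one, mul_zero]
  rw [Finset.sum_congr rfl h1, Finset.sum_ite_eq' s k, if_pos hk]

theorem lowFreq_eq_trig (N : ℕ) (u : L2T) : lowFreq N u = trig (box N) (coeff u) := rfl

theorem trig_congr {s : Finset ℤ} {w v : ℤ → ℂ} (h : ∀ k ∈ s, w k = v k) : trig s w = trig s v := by
  ext x
  exact Finset.sum_congr rfl fun k hk => by rw [h k hk]

/-- The square of a polynomial of degree `N` has frequencies up to `2 N`, so `box (2 * N)` captures
all of them. -/
theorem trig_sq {N : ℕ} {v : ℤ → ℂ} (hv : ∀ n, n ∉ box N → v n = 0) (x : ℝ) :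
    trig (box N) v x ^ 2 = trig (box (2 * N)) (conv N v v) x := by
  have hr : trig (box (2 * N)) (conv N v v) x = ∑ n ∈ box N, ∑ k ∈ box (2 * N),
      v n * v (k - n) * Complex.exp (Complex.I * k * x) := by
    simp only [trig, conv, Finset.sum_mul]
    exact Finset.sum_comm
  rw [hr, sq, trig, Finset.sum_mul_sum]
  refine Finset.sum_congr rfl fun n hn => ?_
  rw [← sum_box_sub (s := n) _ hn]
  · refine Finset.sum_congr rfl fun k _ => ?_
    have h : Complex.exp (Complex.I * k * x) = Complex.exp (Complex.I * n * x) *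
        Complex.exp (Complex.I * ((k - n : ℤ) : ℂ) * x) := by
      rw [← Complex.exp_add]
      congr 1
      push_cast
      ring
    rw [h]
    ring
  · intro m hm; simp [hv m hm]

theorem deriv_trig (s : Finset ℤ) (w : ℤ → ℂ) (x : ℝ) :
    deriv (trig s w) x = trig s (fun k => Complex.I * k * w k) x := by
  have h : HasDerivAt (trig s w) (∑ k ∈ s, w k * (Complex.exp (Complex.I * k * x) *
      (Complex.I * k))) x := by
    refine HasDerivAt.fun_sum fun k _ => HasDerivAt.const_mul _ ?_
    have h1 : HasDerivAt (fun y : ℝ => Complex.I * k * (y : ℂ)) (Complex.I * k) x := by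
      simpa using (Complex.ofRealCLM.hasDerivAt (x := x)).const_mul (Complex.I * k)
    exact h1.cexp
  rw [h.deriv]
  exact Finset.sum_congr rfl fun k _ => by ring

/-- The Gaussian variables `g_n = ⟨n⟩ û(n)`, `|n| ≤ N`. -/
def modes (N : ℕ) (u : L2T) : box N → ℂ := fun i => bracket i * coeff u i

theorem signal_weight_of_mem {N : ℕ} (c : ℤ → ℝ) (g : ℤ → ℂ) {n : ℤ} (hn : n ∈ box N) :
    signal (weight c) (fun i : box N => g i) n = c n * g n / bracket n := by
  simp only [signal, weight, extend, dif_pos hn]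
  push_cast
  ring

theorem signal_weight_modes {N : ℕ} (u : L2T) {n : ℤ} (hn : n ∈ box N) :
    signal (weight 1) (modes N u) n = coeff u n := by
  have h : (bracket n : ℂ) ≠ 0 := by exact_mod_cast (bracket_pos n).ne'
  have h' : signal (weight 1) (modes N u) n = _ :=
    signal_weight_of_mem (N := N) 1 (fun n => bracket n * coeff u n) hn
  rw [h', Pi.one_apply]
  field_simp
  simp

theorem lowFreq_eq (N : ℕ) (u : L2T) :
    lowFreq N u = trig (box N) (signal (weight 1) (modes N u)) := by
  rw [lowFreq_eq_trig]
  exact trig_congr fun n hn => (signal_weight_modes u hn).symm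

theorem lowMass_eq (N : ℕ) (u : L2T) : lowMass N u = mass N (signal (weight 1) (modes N u)) := by
  set v := signal (weight 1) (modes N u)
  have h := torusIntegral_conj_trig_mul_trig (box N) v v
  have h1 : ((lowMass N u : ℝ) : ℂ) = torusIntegral (fun x =>
      starRingEnd ℂ (trig (box N) v x) * trig (box N) v x) := by
    rw [lowMass, lowFreq_eq]
    simp only [torusIntegral, Complex.conj_mul', Complex.real_smul, smul_eq_mul]
    rw [Complex.ofReal_mul, ← intervalIntegral.integral_ofReal]
    push_cast
    rfl
  rw [h] at h1
  simp only [Complex.conj_mul'] at h1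
  unfold mass
  exact_mod_cast h1

/-- Parseval for `(P_{≤N} u)²`: the derivative contributes `i k`, and `(-3i/4) · i = 3/4`. -/
theorem f_eq (N : ℕ) (u : L2T) : f N u = 3 / 4 * energy N (signal (weight 1) (modes N u)) := by
  set v := signal (weight 1) (modes N u) with hv
  have hv0 : ∀ n, n ∉ box N → v n = 0 := signal_of_notMem _ _
  have hsq : (fun y : ℝ => lowFreq N u y ^ 2) = trig (box (2 * N)) (conv N v v) := by
    ext y
    rw [lowFreq_eq, trig_sq hv0]
  have h1 : fComplex N u = (-3 * Complex.I / 4) *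
      ∑ k ∈ box (2 * N), starRingEnd ℂ (conv N v v k) * (Complex.I * k * conv N v v k) := by
    rw [fComplex, ← torusIntegral_conj_trig_mul_trig, hsq]
    congr 2
    ext x
    rw [deriv_trig, ← map_pow, show lowFreq N u x ^ 2 = trig (box (2 * N)) (conv N v v) x from
      congrFun hsq x]
  have h2 : fComplex N u = ((3 / 4 * energy N v : ℝ) : ℂ) := by
    rw [h1, energy, Finset.mul_sum, Finset.mul_sum]
    push_cast
    refine Finset.sum_congr rfl fun k _ => ?_
    rw [← Complex.conj_mul']
    linear_combination (-3 / 4 * k * starRingEnd ℂ (conv N v v k) * conv N v v k) * Complex.I_mul_I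
  rw [f, h2, Complex.ofReal_re]

/-- With `k = n₁ + n₂`, exchanging `n₁` and `n₂` turns the weight `k` into `2 n₁`, which accounts
for `3/2` against `3/4`. -/
theorem chaos_eq (c : ℤ → ℝ) (N : ℕ) (g : ℤ → ℂ) :
    chaos c N g = 3 / 4 * energy N (signal (weight c) fun i : box N => g i) := by
  set v := signal (weight c) fun i : box N => g i with hv
  have hv0 : ∀ n, n ∉ box N → v n = 0 := signal_of_notMem _ _
  have h1 : ((energy N v : ℝ) : ℂ) =
      2 * ∑ n₁ ∈ box N, ∑ n₂ ∈ box N, ∑ n₃ ∈ box N, (n₁ : ℂ) * v n₁ * v n₂ *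
        (starRingEnd ℂ (v n₃) * starRingEnd ℂ (v (n₁ + n₂ - n₃))) := by
    have h2 : ((energy N v : ℝ) : ℂ) =
        2 * ∑ k ∈ box (2 * N), conv N (deriv1 v) v k * starRingEnd ℂ (conv N v v k) := by
      rw [energy, Finset.mul_sum]
      push_cast
      refine Finset.sum_congr rfl fun k _ => ?_
      rw [← Complex.mul_conj', ← mul_assoc, mul_conv, conv_comm hv0 (deriv1_support hv0)]
      ring
    rw [h2]
    congr 1
    conv_lhs => enter [2, k, 1]; rw [conv]
    simp only [Finset.sum_mul]
    rw [Finset.sum_comm]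
    refine Finset.sum_congr rfl fun n₁ hn₁ => ?_
    rw [← sum_box_sub (s := n₁) _ hn₁]
    · refine Finset.sum_congr rfl fun k _ => ?_
      rw [conv, map_sum, Finset.mul_sum]
      refine Finset.sum_congr rfl fun n₃ _ => ?_
      rw [add_sub_cancel, map_mul, deriv1]
    · intro m hm; simp [hv0 m hm]
  have h3 : chaosComplex c N g = ((3 / 4 * energy N v : ℝ) : ℂ) := by
    rw [Complex.ofReal_mul, h1, chaosComplex]
    have e : ((3 / 4 : ℝ) : ℂ) * (2 * ∑ n₁ ∈ box N, ∑ n₂ ∈ box N, ∑ n₃ ∈ box N,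
        (n₁ : ℂ) * v n₁ * v n₂ * (starRingEnd ℂ (v n₃) * starRingEnd ℂ (v (n₁ + n₂ - n₃)))) =
        (3 / 2 : ℂ) * ∑ n₁ ∈ box N, ∑ n₂ ∈ box N, ∑ n₃ ∈ box N,
        (n₁ : ℂ) * v n₁ * v n₂ * (starRingEnd ℂ (v n₃) * starRingEnd ℂ (v (n₁ + n₂ - n₃))) := by
      push_cast
      ring
    rw [e]
    congr 1
    refine Finset.sum_congr rfl fun n₁ h₁ => Finset.sum_congr rfl fun n₂ h₂ =>
      Finset.sum_congr rfl fun n₃ h₃ => ?_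
    have hterm : ∀ n₄ ∈ Finset.Icc (-(N : ℤ)) N, (if n₁ + n₂ = n₃ + n₄ then
          (c n₁ * c n₂ * c n₃ * c n₄ : ℂ) * n₁ *
            (g n₁ * g n₂ * starRingEnd ℂ (g n₃) * starRingEnd ℂ (g n₄)) /
            (bracket n₁ * bracket n₂ * bracket n₃ * bracket n₄)
        else 0) = if n₄ = n₁ + n₂ - n₃ then
          (n₁ : ℂ) * v n₁ * v n₂ * (starRingEnd ℂ (v n₃) * starRingEnd ℂ (v (n₁ + n₂ - n₃)))
        else 0 := by
      intro n₄ h₄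
      by_cases h : n₁ + n₂ = n₃ + n₄
      · have h' : n₄ = n₁ + n₂ - n₃ := by linarith
        rw [if_pos h, if_pos h', ← h', hv, signal_weight_of_mem c g h₁, signal_weight_of_mem c g h₂,
          signal_weight_of_mem c g h₃, signal_weight_of_mem c g h₄]
        simp only [map_div₀, map_mul, Complex.conj_ofReal]
        have b1 : (bracket n₁ : ℂ) ≠ 0 := by exact_mod_cast (bracket_pos n₁).ne'
        have b2 : (bracket n₂ : ℂ) ≠ 0 := by exact_mod_cast (bracket_pos n₂).ne'
        have b3 : (bracket n₃ : ℂ) ≠ 0 := by exact_mod_cast (bracket_pos n₃).ne'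
        have b4 : (bracket n₄ : ℂ) ≠ 0 := by exact_mod_cast (bracket_pos n₄).ne'
        field_simp
      · have h' : n₄ ≠ n₁ + n₂ - n₃ := fun h'' => h (by linarith)
        rw [if_neg h, if_neg h']
    rw [Finset.sum_congr rfl hterm, Finset.sum_ite_eq']
    -- If the frequency forced on `n₄` is outside the box, the original sum has no such term and the
    -- signal vanishes there.
    split_ifs with hmem
    · rfl
    · rw [hv0 _ hmem]
      simp
  rw [chaos, h3, Complex.ofReal_re]

theorem S4_eq (c : ℤ → ℝ) (N : ℕ) (u : L2T) :
    S4 c N u = 3 / 4 * energy N (signal (weight c) (modes N u)) :=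
  chaos_eq c N _

/-- Bessel's inequality. It places the cutoff on the full mass inside the cutoff on the low mass. -/
theorem lowMass_le_norm_sq (N : ℕ) (u : L2T) : lowMass N u ≤ ‖u‖ ^ 2 := by
  rw [lowMass_eq, mass]
  have h : ∀ n, ‖inner ℂ (fourierBasis (T := 2 * Real.pi) n) u‖ = ‖coeff u n‖ := fun n => by
    rw [← HilbertBasis.repr_apply_apply, fourierBasis_repr, coeff]
  have hb := (fourierBasis (T := 2 * Real.pi)).orthonormal.sum_inner_products_le u (s := box N)
  refine le_trans (le_of_eq (Finset.sum_congr rfl fun n hn => ?_)) hb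
  rw [signal_weight_modes u hn, h]

end Torus

/-! ### From the law on `H^{1/2-}` to finitely many Gaussians -/

section Transfer

variable {N : ℕ}

theorem continuous_coeff (n : ℤ) : Continuous fun u : L2T => coeff u n := by
  have h : (fun u : L2T => coeff u n) =
      fun u => inner ℂ (fourierBasis (T := 2 * Real.pi) n) u := by
    ext u
    rw [← HilbertBasis.repr_apply_apply, fourierBasis_repr, coeff]
  rw [h]
  fun_prop

theorem continuous_modes : Continuous (modes N) :=
  continuous_pi fun i => continuous_const.mul (continuous_coeff i)

theorem measurable_of_continuous_val {β : Type*} [TopologicalSpace β] [MeasurableSpace β]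
    [BorelSpace β] {F : L2T → β} (hF : Continuous F) :
    Measurable fun u : HHalfMinus => F u := by
  let _ : MeasurableSpace L2T := borel L2T
  have : BorelSpace L2T := ⟨rfl⟩
  have hval : Measurable HHalfMinus.val := fun s hs => ⟨s, hs, rfl⟩
  exact hF.measurable.comp hval

theorem measurable_modes : Measurable fun u : HHalfMinus => modes N u :=
  measurable_of_continuous_val continuous_modes

/-- Almost surely `⟨n⟩ û(n) = g_n`, and the joint law of finitely many independent variables is the
product of their laws. -/
theorem map_modes_gaussMeasure {Ω : Type*} [MeasurableSpace Ω] {P : Measure Ω}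
    [IsProbabilityMeasure P] {g : ℤ → Ω → ℂ} (hg : IsGaussianFamily P g) :
    (gaussMeasure P g).map (fun u : HHalfMinus => modes N u) = gaussPi (box N) := by
  rw [gaussMeasure, AEMeasurable.map_map_of_aemeasurable measurable_modes.aemeasurable
    (aemeasurable_randomData hg)]
  have hae : (fun u : HHalfMinus => modes N u) ∘ randomData g =ᵐ[P]
      fun ω (i : box N) => g i ω := by
    filter_upwards [ae_coeff_randomData hg] with ω hω
    ext i
    have h : (bracket i : ℂ) ≠ 0 := by exact_mod_cast (bracket_pos i).ne'
    simp only [Function.comp, modes, hω.2]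
    field_simp
  rw [Measure.map_congr hae]
  have hind : iIndepFun (fun (i : box N) => g i) P := hg.2.precomp Subtype.val_injective
  rw [(iIndepFun_iff_map_fun_eq_pi_map fun i : box N => (hg.1 i).aemeasurable).mp hind]
  simp only [gaussPi, (hg.1 _).map_eq]

theorem lintegral_gaussMeasure_comp_modes {Ω : Type*} [MeasurableSpace Ω] {P : Measure Ω}
    [IsProbabilityMeasure P] {g : ℤ → Ω → ℂ} (hg : IsGaussianFamily P g)
    {F : (box N → ℂ) → ℝ≥0∞} (hF : Measurable F) :
    ∫⁻ u : HHalfMinus, F (modes N u) ∂(gaussMeasure P g) = ∫⁻ x, F x ∂(gaussPi (box N)) := by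
  rw [← map_modes_gaussMeasure hg, lintegral_map hF measurable_modes]

end Transfer

/-! ### Measurability and passage from lower integrals to the stated norms -/

section Conclusion

variable {N : ℕ}

theorem measurable_S4 (c : ℤ → ℝ) : Measurable fun u : HHalfMinus => S4 c N u := by
  simp only [S4_eq]
  exact ((measurable_energy_signal (weight c)).const_mul _).comp measurable_modes

theorem measurable_lowMass : Measurable fun u : HHalfMinus => lowMass N u := by
  simp only [lowMass_eq]
  exact (measurable_mass_signal (weight 1)).comp measurable_modes

/-- Part (2) is thereby the case `c = 1` of part (1), up to raising the integrand to the power `p`.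
-/
theorem f_eq_S4 (u : L2T) : f N u = S4 1 N u := by
  rw [f_eq, S4_eq]

theorem torusIntegral_norm_pow_nonneg (F : ℝ → ℂ) (k : ℕ) :
    0 ≤ torusIntegral fun x => ‖F x‖ ^ k :=
  smul_nonneg (by positivity)
    (intervalIntegral.integral_nonneg Real.two_pi_pos.le fun _ _ => by positivity)

theorem measurable_torusIntegral_lowFreq (k : ℕ) :
    Measurable fun u : HHalfMinus => torusIntegral fun x => ‖lowFreq N u x‖ ^ k := by
  refine measurable_of_continuous_val (F := fun u => torusIntegral fun x => ‖lowFreq N u x‖ ^ k) ?_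
  have hc : Continuous (Function.uncurry fun (u : L2T) (x : ℝ) => ‖lowFreq N u x‖ ^ k) := by
    refine (continuous_norm.comp (continuous_finsetSum _ fun n _ => ?_)).pow k
    exact ((continuous_coeff n).comp continuous_fst).mul (by fun_prop)
  exact (intervalIntegral.continuous_parametric_intervalIntegral_of_continuous' (μ := volume)
    hc _ _).const_smul (2 * Real.pi)⁻¹

theorem lintegral_indicator_exp_S4 {Ω : Type*} [MeasurableSpace Ω] {P : Measure Ω}
    [IsProbabilityMeasure P] {g : ℤ → Ω → ℂ} (hg : IsGaussianFamily P g) (c : ℤ → ℝ) (m p : ℝ) :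
    ∫⁻ u : HHalfMinus, {u : HHalfMinus | lowMass N u < m}.indicator
        (fun u => ENNReal.ofReal (Real.exp (p * S4 c N u))) u ∂(gaussMeasure P g) =
      ∫⁻ x, {x : box N → ℂ | mass N (signal (weight 1) x) < m}.indicator
        (fun x => ENNReal.ofReal (Real.exp (p * (3 / 4 * energy N (signal (weight c) x))))) x
        ∂(gaussPi (box N)) := by
  rw [← lintegral_gaussMeasure_comp_modes hg]
  · refine lintegral_congr fun u => ?_
    simp only [Set.indicator_apply, Set.mem_ofPred_eq, lowMass_eq, S4_eq]
  · exact Measurable.indicator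
      (((measurable_energy_signal (weight c)).const_mul _).const_mul _).exp.ennreal_ofReal
      (measurableSet_lt (measurable_mass_signal _) measurable_const)

theorem integrable_and_integral_le_of_lintegral_le {α : Type*} [MeasurableSpace α] {μ : Measure α}
    {F : α → ℝ} (hF : Measurable F) (h0 : ∀ x, 0 ≤ F x) {C : ℝ} (hC : 0 ≤ C)
    (h : ∫⁻ x, ENNReal.ofReal (F x) ∂μ ≤ ENNReal.ofReal C) :
    Integrable F μ ∧ ∫ x, F x ∂μ ≤ C := by
  refine ⟨⟨hF.aestronglyMeasurable, ?_⟩, ?_⟩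
  · rw [hasFiniteIntegral_iff_ofReal (Eventually.of_forall h0)]
    exact h.trans_lt ENNReal.ofReal_lt_top
  · rw [integral_eq_lintegral_of_nonneg_ae (Eventually.of_forall h0) hF.aestronglyMeasurable]
    exact ENNReal.toReal_le_of_le_ofReal hC h

theorem memLp_and_eLpNorm_rpow_le_of_lintegral_le {α : Type*} [MeasurableSpace α] {μ : Measure α}
    {F : α → ℝ} (hF : Measurable F) {p C : ℝ} (hp : 0 < p)
    (h : ∫⁻ x, ‖F x‖ₑ ^ p ∂μ ≤ ENNReal.ofReal C) :
    MemLp F (ENNReal.ofReal p) μ ∧ eLpNorm F (ENNReal.ofReal p) μ ^ p ≤ ENNReal.ofReal C := by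
  have hp' : ENNReal.ofReal p ≠ 0 := by simpa using hp
  have e : eLpNorm F (ENNReal.ofReal p) μ ^ p = ∫⁻ x, ‖F x‖ₑ ^ p ∂μ := by
    rw [eLpNorm_eq_lintegral_rpow_enorm_toReal hp' ENNReal.ofReal_ne_top,
      ENNReal.toReal_ofReal hp.le, ← ENNReal.rpow_mul, one_div, inv_mul_cancel₀ hp.ne',
      ENNReal.rpow_one]
  rw [← e] at h
  refine ⟨⟨hF.aestronglyMeasurable, ?_⟩, h⟩
  exact (ENNReal.rpow_lt_top_iff_of_pos hp).mp (h.trans_lt ENNReal.ofReal_lt_top)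

theorem enorm_rpow_le_of_le_exp {a b p : ℝ} (ha : 0 ≤ a) (hp : 0 ≤ p) (h : a ≤ Real.exp b) :
    ‖a‖ₑ ^ p ≤ ENNReal.ofReal (Real.exp (p * b)) := by
  rw [Real.enorm_eq_ofReal ha, ENNReal.ofReal_rpow_of_nonneg ha hp, mul_comm, Real.exp_mul]
  exact ENNReal.ofReal_le_ofReal (Real.rpow_le_rpow ha h hp)

end Conclusion

end DNLS

end

/-! ### The theorem -/

theorem theorem401 :
    (∀ M p : ℝ, 1 ≤ p → ∃ m₀ : ℝ, 0 < m₀ ∧ ∃ C : ℝ,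
      ∀ (Ω : Type*) [MeasurableSpace Ω] (P : Measure Ω)
        [IsProbabilityMeasure P] (g : ℤ → Ω → ℂ), DNLS.IsGaussianFamily P g →
      ∀ c : ℤ → ℝ, (∀ n, |c n| ≤ M) → (∀ n, c (-n) = c n) →
      ∀ m : ℝ, 0 < m → m ≤ m₀ → ∀ N : ℕ,
        (Integrable
            (Set.indicator {u : DNLS.HHalfMinus | ‖(u : DNLS.L2T)‖ ^ 2 < m}
              fun u => Real.exp (p * DNLS.S4 c N u)) (DNLS.gaussMeasure P g) ∧
          ∫ u, Set.indicator {u : DNLS.HHalfMinus | ‖(u : DNLS.L2T)‖ ^ 2 < m}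
              (fun u => Real.exp (p * DNLS.S4 c N u)) u ∂(DNLS.gaussMeasure P g) ≤ C) ∧
        (Integrable
            (Set.indicator {u : DNLS.HHalfMinus | DNLS.lowMass N u < m}
              fun u => Real.exp (p * DNLS.S4 c N u)) (DNLS.gaussMeasure P g) ∧
          ∫ u, Set.indicator {u : DNLS.HHalfMinus | DNLS.lowMass N u < m}
              (fun u => Real.exp (p * DNLS.S4 c N u)) u ∂(DNLS.gaussMeasure P g) ≤ C)) ∧
    (∀ p : ℝ, 1 ≤ p → ∃ m₀ : ℝ, 0 < m₀ ∧ ∃ C : ℝ,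
      ∀ (Ω : Type*) [MeasurableSpace Ω] (P : Measure Ω)
        [IsProbabilityMeasure P] (g : ℤ → Ω → ℂ), DNLS.IsGaussianFamily P g →
      ∀ m : ℝ, 0 < m → m ≤ m₀ → ∀ N : ℕ,
        (MemLp
            (Set.indicator {u : DNLS.HHalfMinus | DNLS.lowMass N u < m}
              fun u => Real.exp (DNLS.f N u)) (ENNReal.ofReal p) (DNLS.gaussMeasure P g) ∧
          eLpNorm
            (Set.indicator {u : DNLS.HHalfMinus | DNLS.lowMass N u < m}
              fun u => Real.exp (DNLS.f N u)) (ENNReal.ofReal p) (DNLS.gaussMeasure P g) ^ p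
            ≤ ENNReal.ofReal C) ∧
        (MemLp (fun u : DNLS.HHalfMinus => DNLS.Psi m N u)
            (ENNReal.ofReal p) (DNLS.gaussMeasure P g) ∧
          eLpNorm (fun u : DNLS.HHalfMinus => DNLS.Psi m N u)
            (ENNReal.ofReal p) (DNLS.gaussMeasure P g) ^ p ≤ ENNReal.ofReal C)) := by
  constructor
  · intro M p hp
    obtain ⟨m₀, hm₀, C, hC, h⟩ := DNLS.exists_lintegral_exp_energy_le M p hp
    refine ⟨m₀, hm₀, C, fun Ω _ P _ g hg c hc heven m _ hmm N => ?_⟩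
    have hexp : Measurable fun u : DNLS.HHalfMinus => Real.exp (p * DNLS.S4 c N u) :=
      ((DNLS.measurable_S4 c).const_mul p).exp
    -- Both cutoffs in part (1) are subsets of the ball of radius `m₀` for the low mass, and the
    -- integrand is nonnegative.
    have key : ∀ A : Set DNLS.HHalfMinus, MeasurableSet A →
        (∀ u ∈ A, DNLS.lowMass N u < m₀) →
        Integrable (A.indicator fun u => Real.exp (p * DNLS.S4 c N u)) (DNLS.gaussMeasure P g) ∧
        ∫ u, A.indicator (fun u => Real.exp (p * DNLS.S4 c N u)) u ∂(DNLS.gaussMeasure P g)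
          ≤ C := by
      intro A hA hAm
      refine DNLS.integrable_and_integral_le_of_lintegral_le (hexp.indicator hA)
        (fun u => Set.indicator_nonneg (fun _ _ => (Real.exp_pos _).le) u) hC ?_
      refine le_trans ?_ ((DNLS.lintegral_indicator_exp_S4 hg c m₀ p).trans_le (h c hc heven N))
      refine lintegral_mono fun u => ?_
      by_cases hu : u ∈ A
      · have hu' : u ∈ {u : DNLS.HHalfMinus | DNLS.lowMass N u < m₀} := hAm u hu
        rw [Set.indicator_of_mem hu, Set.indicator_of_mem hu']
      · rw [Set.indicator_of_notMem hu, ENNReal.ofReal_zero]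
        exact zero_le
    refine ⟨key _ ?_ fun u hu => ?_, key _ ?_ fun u hu => lt_of_lt_of_le hu hmm⟩
    · exact measurableSet_lt ((DNLS.measurable_of_continuous_val continuous_norm).pow_const 2)
        measurable_const
    · exact (DNLS.lowMass_le_norm_sq N u).trans_lt (lt_of_lt_of_le hu hmm)
    · exact measurableSet_lt DNLS.measurable_lowMass measurable_const
  · intro p hp
    have hp0 : 0 < p := by linarith
    obtain ⟨m₀, hm₀, C, hC, h⟩ := DNLS.exists_lintegral_exp_energy_le 1 p hp
    refine ⟨m₀, hm₀, C, fun Ω _ P _ g hg m _ hmm N => ?_⟩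
    have hf : Measurable fun u : DNLS.HHalfMinus => DNLS.f N u := by
      simp only [DNLS.f_eq_S4]
      exact DNLS.measurable_S4 1
    have hA : MeasurableSet {u : DNLS.HHalfMinus | DNLS.lowMass N u < m} :=
      measurableSet_lt DNLS.measurable_lowMass measurable_const
    -- Any exponent below `f_N` obeys the bound for `f_N`. It is applied to `f_N` itself and to
    -- `f_N` minus the nonnegative sextic term.
    have key : ∀ G : DNLS.HHalfMinus → ℝ, Measurable G → (∀ u, G u ≤ DNLS.f N u) →
        MemLp ({u : DNLS.HHalfMinus | DNLS.lowMass N u < m}.indicator fun u => Real.exp (G u))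
          (ENNReal.ofReal p) (DNLS.gaussMeasure P g) ∧
        eLpNorm ({u : DNLS.HHalfMinus | DNLS.lowMass N u < m}.indicator fun u => Real.exp (G u))
          (ENNReal.ofReal p) (DNLS.gaussMeasure P g) ^ p ≤ ENNReal.ofReal C := by
      intro G hG hGf
      refine DNLS.memLp_and_eLpNorm_rpow_le_of_lintegral_le (hG.exp.indicator hA) hp0 ?_
      refine le_trans ?_ ((DNLS.lintegral_indicator_exp_S4 hg 1 m₀ p).trans_le
        (h 1 (fun _ => by simp) (fun _ => rfl) N))
      refine lintegral_mono fun u => ?_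
      by_cases hu : u ∈ {u : DNLS.HHalfMinus | DNLS.lowMass N u < m}
      · have hu' : u ∈ {u : DNLS.HHalfMinus | DNLS.lowMass N u < m₀} := lt_of_lt_of_le hu hmm
        rw [Set.indicator_of_mem hu, Set.indicator_of_mem hu', ← DNLS.f_eq_S4]
        exact DNLS.enorm_rpow_le_of_le_exp (Real.exp_pos _).le hp0.le
          (Real.exp_le_exp.mpr (hGf u))
      · rw [Set.indicator_of_notMem hu, enorm_zero, ENNReal.zero_rpow_of_pos hp0]
        exact zero_le
    refine ⟨key _ hf fun _ => le_rfl, ?_⟩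
    exact key (fun u => DNLS.f N u - 1 / 2 * DNLS.torusIntegral fun x => ‖DNLS.lowFreq N u x‖ ^ 6)
      (hf.sub ((DNLS.measurable_torusIntegral_lowFreq 6).const_mul _)) fun u => by
        have := DNLS.torusIntegral_norm_pow_nonneg (DNLS.lowFreq N u) 6
        linarith
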